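/- Let $\Bbbk$ be an arbitrary field. **Conventions.** By an *SM category* we mean a $\Bbbk$-linear abelian symmetric monoidal category $(\mathbf C,\otimes,\mathbb 1,\gamma)$ with $\mathbb 1\neq 0$ whose tensor product is right exact and $\Bbbk$-linear in both variables. A *tensor functor* between SM categories is a right exact $\Bbbk$-linear symmetric (strong) monoidal functor. A *tensor category* over $\Bbbk$ is an essentially small SM category $\mathbf T$ such that $\Bbbk\to\mathrm{End}(\mathbb 1)$ is an isomorphism and every object $X$ has a dual $X^\vee$ (with $\mathbb 1\to X\otimes X^\vee$ and $X^\vee\otimes X\to\mathbb 1$ satisfying the snake relations). A tensor category $\mathbf T$ is *locally semisimple* if there exist an SM category $\mathbf C$ and a tensor functor $F:\mathbf T\to\mathbf C$ which maps every short exact sequence in $\mathbf T$ to a split short exact sequence. For $X\in\mathbf T$ and $n\in\mathbb N=\{0,1,2,\dots\}$, $\mathrm{Sym}^nX$ is the cokernel of the morphism $\bigoplus_{i=1}^{n-1}X^{\otimes n}\to X^{\otimes n}$ with components $X^{\otimes (i-1)}\otimes(\gamma_{X,X}-1)\otimes X^{\otimes(n-i-1)}$. For $\alpha:\mathbb 1\to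 X$, let $\alpha^n$ be the composite $\mathbb 1\xrightarrow{\alpha^{\otimes n}}X^{\otimes n}\twoheadrightarrow\mathrm{Sym}^nX$. For a short exact sequence $\Sigma:0\to U\to V\to W\to 0$ in $\mathbf T$ put $\mathrm{gr}V=U\oplus W$, with $U$ in degree $0$ and $W$ in degree $1$. For $0\le j\le n+1$ let $F_j(V^{\otimes n})\subseteq V^{\otimes n}$ be the sum of the images of all $Y_1\otimes\cdots\otimes Y_n\to V^{\otimes n}$ with $Y_i\in\{U,V\}$ and fewer than $j$ of the $Y_i$ equal to $V$, let $F_j(\mathrm{Sym}^nV)$ be the image of $F_j(V^{\otimes n})$ in $\mathrm{Sym}^nV$, and let $\mathrm{gr}(\mathrm{Sym}^nV)=\bigoplus_{j=0}^nF_{j+1}(\mathrm{Sym}^nV)/F_j(\mathrm{Sym}^nV)$. Let $\theta^n_\Sigma:\mathrm{Sym}^n(\mathrm{gr}V)\to\mathrm{gr}(\mathrm{Sym}^nV)$ be the canonical morphism: the unique one such that, for all $Y_1,\dots,Y_n\in\{U,V\}$, exactly $j$ of which equal $V$, its composite with $Y_1\otimes\cdots\otimes Y_n\to(\mathrm{gr}V)^{\otimes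 n}\twoheadrightarrow\mathrm{Sym}^n(\mathrm{gr}V)$ (induced by $U\hookrightarrow\mathrm{gr}V$ and $V\twoheadrightarrow W\hookrightarrow\mathrm{gr}V$) is $Y_1\otimes\cdots\otimes Y_n\to F_{j+1}(\mathrm{Sym}^nV)\twoheadrightarrow F_{j+1}(\mathrm{Sym}^nV)/F_j(\mathrm{Sym}^nV)\hookrightarrow\mathrm{gr}(\mathrm{Sym}^nV)$. Put $\theta_\Sigma=\bigoplus_n\theta_\Sigma^n$; it is an isomorphism if and only if every $\theta^n_\Sigma$ is. Let $\mathrm{Ind}\,\mathbf T$ be the symmetric monoidal category of ind-objects of $\mathbf T$, $\mathrm{Alg}\,\mathbf T$ the category of commutative algebras in $\mathrm{Ind}\,\mathbf T$ and, for $\mathscr A\in\mathrm{Alg}\,\mathbf T$, $\mathbf{Mod}_{\mathscr A}$ the category of $\mathscr A$-modules in $\mathrm{Ind}\,\mathbf T$. For $\Sigma$ as above, $\mathscr A\otimes\Sigma$ is the short exact sequence $0\to\mathscr A\otimes U\to\mathscr A\otimes V\to\mathscr A\otimes W\to0$ in $\mathbf{Mod}_{\mathscr A}$; it splits if and only if $\mathscr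 A\otimes U\to\mathscr A\otimes V$ has an $\mathscr A$-linear retraction. **Theorem.** Let $\mathbf T$ be a tensor category over $\Bbbk$. The following are equivalent. (0) $\mathbf T$ is locally semisimple. (i) For every short exact sequence $\Sigma$ in $\mathbf T$, the morphism $\theta_\Sigma$ is an isomorphism. (ii) For every $X\in\mathbf T$, every $n\in\mathbb N$ and every non-zero $\alpha\in\mathrm{Hom}(\mathbb 1,X)$, the morphism $\alpha^n$ is non-zero. (iii) For every short exact sequence $\Sigma$ in $\mathbf T$ there is a non-zero $\mathscr A=\mathscr A_\Sigma$ in $\mathrm{Alg}\,\mathbf T$ such that $\mathscr A\otimes\Sigma$ splits in $\mathbf{Mod}_{\mathscr A}$. (iv) There is a non-zero $\mathscr A\in\mathrm{Alg}\,\mathbf T$ such that for every short exact sequence $\Sigma$ in $\mathbf T$ the sequence $\mathscr A\otimes\Sigma$ splits in $\mathbf{Mod}_{\mathscr A}$. (The notion in (0) does not depend on a bound for the size of the categories $\mathbf C$, as long as this bound admits the categories $\mathbf{Mod}_{\mathscr A}$.) -/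

import Mathlib

open CategoryTheory MonoidalCategory Limits Opposite
open scoped ExternalProduct
universe w₁ w₂ w v u
set_option linter.unusedSectionVars false

noncomputable section
namespace LSS
section
variable {T : Type u} [Category.{v} T]

/-- The element of `F` corresponding to the `i`-th leg of a presentation of `F`. -/
def gen {F : Tᵒᵖ ⥤ Type v} (P : IndObjectPresentation F) (i : P.I) : F.obj (op (P.F.obj i)) :=
  yonedaEquiv (P.ι.app i)

lemma gen_map {F : Tᵒᵖ ⥤ Type v} (P : IndObjectPresentation F) {i j : P.I} (f : i ⟶ j) :
    F.map (P.F.map f).op (gen P j) = gen P i := by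
  unfold gen
  rw [yonedaEquiv_naturality]
  congr 1
  simpa using P.ι.naturality f

lemma map_gen {F : Tᵒᵖ ⥤ Type v} (P : IndObjectPresentation F) {x : T} {i : P.I}
    (u : x ⟶ P.F.obj i) : F.map u.op (gen P i) = (P.ι.app i).app (op x) u := by
  have h := NatTrans.naturality_apply (P.ι.app i) u.op (𝟙 (P.F.obj i))
  refine h.symm.trans (congrArg ((P.ι.app i).app (op x)) ?_)
  exact Category.comp_id u

lemma gen_surj {F : Tᵒᵖ ⥤ Type v} (P : IndObjectPresentation F) (x : T) (a : F.obj (op x)) :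
    ∃ (i : P.I) (u : x ⟶ P.F.obj i), F.map u.op (gen P i) = a := by
  obtain ⟨i, u, hu⟩ := Types.jointly_surjective _
    (isColimitOfPreserves ((evaluation _ _).obj (op x)) P.coconeIsColimit) a
  exact ⟨i, u, (map_gen P u).trans hu⟩

lemma gen_eq {F : Tᵒᵖ ⥤ Type v} (P : IndObjectPresentation F) {x : T} {i j : P.I}
    (u : x ⟶ P.F.obj i) (w : x ⟶ P.F.obj j)
    (h : F.map u.op (gen P i) = F.map w.op (gen P j)) :
    ∃ (k : P.I) (f : i ⟶ k) (g : j ⟶ k), u ≫ P.F.map f = w ≫ P.F.map g := by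
  rw [map_gen, map_gen] at h
  exact (Types.FilteredColimit.isColimit_eq_iff _
    (isColimitOfPreserves ((evaluation _ _).obj (op x)) P.coconeIsColimit)).1 h

lemma mem_essImage_inclusion {K : Tᵒᵖ ⥤ Type v} (h : IsIndObject K) :
    (Ind.inclusion T).essImage K := by
  let X : ObjectProperty.FullSubcategory (IsIndObject (C := T)) := ⟨K, h⟩
  exact ⟨(Ind.equivalence T).inverse.obj X,
    ⟨(ObjectProperty.ι _).mapIso ((Ind.equivalence T).counitIso.app X)⟩⟩

lemma isIndObject_inclusion (A : Ind T) : IsIndObject ((Ind.inclusion T).obj A) :=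
  ((Ind.equivalence T).functor.obj A).property

variable [MonoidalCategory T] {F G K : Tᵒᵖ ⥤ Type v}

/-- The pairing `F(x) × G(y) → K(x ⊗ y)` given by a transformation `F ⊠ G ⟶ ⊗ ⋙ K`. -/
def pairing (α : F ⊠ G ⟶ tensor Tᵒᵖ ⋙ K) {x y : T} (a : F.obj (op x)) (b : G.obj (op y)) :
    K.obj (op (x ⊗ y)) :=
  α.app (op x, op y) ((a, b) : F.obj (op x) × G.obj (op y))

lemma pairing_map (α : F ⊠ G ⟶ tensor Tᵒᵖ ⋙ K) {x y x' y' : T} (f : x' ⟶ x) (g : y' ⟶ y)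
    (a : F.obj (op x)) (b : G.obj (op y)) :
    pairing α (F.map f.op a) (G.map g.op b) = K.map (f ⊗ₘ g).op (pairing α a b) :=
  NatTrans.naturality_apply α (X := (op x, op y)) (Y := (op x', op y'))
    (Prod.mkHom f.op g.op) ((a, b) : F.obj (op x) × G.obj (op y))

lemma exists_pairing (P : IndObjectPresentation F) (Q : IndObjectPresentation G)
    (S : Tᵒᵖ ⥤ Type v) (h : ∀ i j, S.obj (op (P.F.obj i ⊗ Q.F.obj j)))
    (hc : ∀ {i i' : P.I} {j j' : Q.I} (f : i ⟶ i') (g : j ⟶ j'),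
      S.map (P.F.map f ⊗ₘ Q.F.map g).op (h i' j') = h i j) :
    ∃ α : F ⊠ G ⟶ tensor Tᵒᵖ ⋙ S, ∀ i j, pairing α (gen P i) (gen Q j) = h i j := by
  choose i u hu using gen_surj P
  choose j w hw using gen_surj Q
  have wd : ∀ {x y : T} {i i' : P.I} {j j' : Q.I} (u : x ⟶ P.F.obj i) (u' : x ⟶ P.F.obj i')
      (w : y ⟶ Q.F.obj j) (w' : y ⟶ Q.F.obj j'),
      F.map u.op (gen P i) = F.map u'.op (gen P i') →
      G.map w.op (gen Q j) = G.map w'.op (gen Q j') →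
      S.map (u ⊗ₘ w).op (h i j) = S.map (u' ⊗ₘ w').op (h i' j') := by
    intro x y i i' j j' u u' w w' h1 h2
    obtain ⟨k, f, g, hk⟩ := gen_eq P u u' h1
    obtain ⟨l, f', g', hl⟩ := gen_eq Q w w' h2
    rw [← hc f f', ← hc g g', ← Functor.map_comp_apply, ← Functor.map_comp_apply, ← op_comp,
      ← op_comp, tensorHom_comp_tensorHom, tensorHom_comp_tensorHom, hk, hl]
  let φ : ∀ X : Tᵒᵖ × Tᵒᵖ, F.obj (op X.1.unop) × G.obj (op X.2.unop) →
      S.obj (op (X.1.unop ⊗ X.2.unop)) := fun X p =>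
    S.map (u _ p.1 ⊗ₘ w _ p.2).op (h _ _)
  have hφ : ∀ (x y x' y' : T) (f : x' ⟶ x) (g : y' ⟶ y) (a : F.obj (op x)) (b : G.obj (op y)),
      φ (op x', op y') (F.map f.op a, G.map g.op b) =
        S.map (f ⊗ₘ g).op (φ (op x, op y) (a, b)) := by
    intro x y x' y' f g a b
    dsimp only [φ]
    rw [← Functor.map_comp_apply, ← op_comp, tensorHom_comp_tensorHom]
    apply wd
    · rw [hu, op_comp, Functor.map_comp_apply, hu]
    · rw [hw, op_comp, Functor.map_comp_apply, hw]
  refine ⟨NatTrans.mk (fun X => TypeCat.ofHom (φ X)) ?_, ?_⟩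
  · intro X Y f
    apply ConcreteCategory.hom_ext
    intro p
    exact hφ X.1.unop X.2.unop Y.1.unop Y.2.unop f.1.unop f.2.unop p.1 p.2
  · intro i₀ j₀
    refine Eq.trans (wd (u _ (gen P i₀)) (𝟙 _) (w _ (gen Q j₀)) (𝟙 _) ?_ ?_) ?_
    · rw [hu]; simp
    · rw [hw]; simp
    · simp

/-- The Day convolution of two ind-objects is an ind-object, presented by the diagram
`(i, j) ↦ X i ⊗ Y j`. -/
lemma isIndObject_dayConvolution (hF : IsIndObject F) (hG : IsIndObject G)
    (α : F ⊠ G ⟶ tensor Tᵒᵖ ⋙ K) [K.IsLeftKanExtension α] : IsIndObject K := by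
  let P := hF.presentation
  let Q := hG.presentation
  have hs : ∀ s : Cocone ((P.F.prod Q.F ⋙ tensor T) ⋙ yoneda),
      ∃ α : F ⊠ G ⟶ tensor Tᵒᵖ ⋙ s.pt, ∀ i j, pairing α (gen P i) (gen Q j) =
        yonedaEquiv (s.ι.app (i, j)) := fun s =>
    exists_pairing P Q s.pt (fun i j => yonedaEquiv (s.ι.app (i, j))) (by
      intro i i' j j' f g
      refine (yonedaEquiv_naturality (s.ι.app (i', j')) (P.F.map f ⊗ₘ Q.F.map g)).trans ?_
      congr 1
      simpa using s.ι.naturality (X := (i, j)) (Y := (i', j')) (Prod.mkHom f g))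
  choose β hβ using hs
  have hd : ∀ (s : Cocone ((P.F.prod Q.F ⋙ tensor T) ⋙ yoneda)) (i : P.I) (j : Q.I),
      (K.descOfIsLeftKanExtension α s.pt (β s)).app _ (pairing α (gen P i) (gen Q j)) =
        yonedaEquiv (s.ι.app (i, j)) := fun s i j => by
    refine Eq.trans ?_ (hβ s i j)
    exact ConcreteCategory.congr_hom (K.descOfIsLeftKanExtension_fac_app α s.pt (β s)
      (op (P.F.obj i), op (Q.F.obj j)))
      ((gen P i, gen Q j) : F.obj (op (P.F.obj i)) × G.obj (op (Q.F.obj j)))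
  refine ⟨⟨{
    I := P.I × Q.I
    F := P.F.prod Q.F ⋙ tensor T
    ι :=
      { app := fun p => yonedaEquiv.symm (pairing α (gen P p.1) (gen Q p.2))
        naturality := fun p q f => ?_ }
    isColimit :=
      { desc := fun s => K.descOfIsLeftKanExtension α s.pt (β s)
        fac := fun s p => ?_
        uniq := fun s m hm => ?_ } }⟩⟩
  · refine (yonedaEquiv_symm_naturality_left (P.F.map f.1 ⊗ₘ Q.F.map f.2) K _).trans ?_
    refine Eq.trans ?_ (Category.comp_id _).symm
    congr 1
    rw [← pairing_map, gen_map, gen_map]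
  · refine (yonedaEquiv_symm_naturality_right _ _ _).trans ?_
    rw [Equiv.symm_apply_eq]
    exact hd s p.1 p.2
  · apply K.hom_ext_of_isLeftKanExtension α
    rw [K.descOfIsLeftKanExtension_fac]
    have key : ∀ (x y : T) (a : F.obj (op x)) (b : G.obj (op y)),
        pairing (α ≫ Functor.whiskerLeft (tensor Tᵒᵖ) m) a b = pairing (β s) a b := by
      intro x y a b
      obtain ⟨i, u, rfl⟩ := gen_surj P x a
      obtain ⟨j, w, rfl⟩ := gen_surj Q y b
      rw [pairing_map, pairing_map]
      congr 1
      rw [hβ]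
      have h := congrArg yonedaEquiv (hm (i, j))
      refine Eq.trans ?_ h
      refine Eq.trans ?_ (congrArg yonedaEquiv (yonedaEquiv_symm_naturality_right _ _ _)).symm
      rw [Equiv.apply_symm_apply]
      rfl
    ext X p
    exact key X.1.unop X.2.unop p.1 p.2

variable (T) in
lemma isIndObject_dayConvolutionUnit {K : Tᵒᵖ ⥤ Type v}
    (α : Functor.fromPUnit.{0} (𝟙_ (Type v)) ⟶ Functor.fromPUnit.{0} (𝟙_ Tᵒᵖ) ⋙ K)
    [K.IsLeftKanExtension α] : IsIndObject K := by
  let e : K.obj (op (𝟙_ T)) := α.app ⟨PUnit.unit⟩ PUnit.unit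
  let β : Functor.fromPUnit.{0} (𝟙_ (Type v)) ⟶
      Functor.fromPUnit.{0} (𝟙_ Tᵒᵖ) ⋙ yoneda.obj (𝟙_ T) :=
    { app := fun _ => TypeCat.ofHom fun _ => 𝟙 (𝟙_ T)
      naturality := fun _ _ _ => by ext; simp }
  let f : yoneda.obj (𝟙_ T) ⟶ K := yonedaEquiv.symm e
  let g : K ⟶ yoneda.obj (𝟙_ T) := K.descOfIsLeftKanExtension α _ β
  have hg : g.app _ e = 𝟙 (𝟙_ T) :=
    ConcreteCategory.congr_hom (K.descOfIsLeftKanExtension_fac_app α _ β ⟨PUnit.unit⟩) PUnit.unit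
  have : IsIso f := by
    refine ⟨g, ?_, ?_⟩
    · refine (yonedaEquiv_symm_naturality_right _ _ _).trans ?_
      rw [Equiv.symm_apply_eq, hg]
      rfl
    · apply K.hom_ext_of_isLeftKanExtension α
      ext ⟨⟨⟩⟩ ⟨⟩
      change f.app _ (g.app _ e) = e
      rw [hg]
      exact yonedaEquiv.apply_symm_apply e
  exact IsIndObject.map f (isIndObject_yoneda _)

end

section
variable (T : Type u) [Category.{v} T] [EssentiallySmall.{v} T] [MonoidalCategory T]

instance essentiallySmall_prod : EssentiallySmall.{v} (T × T) :=
  (essentiallySmall_congr ((equivSmallModel.{v} T).prod (equivSmallModel.{v} T))).2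
    (essentiallySmallSelf _)

instance hasPointwiseLeftKanExtension_tensor (F : Tᵒᵖ × Tᵒᵖ ⥤ Type v) :
    (tensor Tᵒᵖ).HasPointwiseLeftKanExtension F := fun X =>
  have : HasColimitsOfShape (CostructuredArrow (tensor Tᵒᵖ) X) (Type v) :=
    hasColimitsOfShape_of_essentiallySmall.{v} _ _
  inferInstance

lemma essImage_dayConvolution (A B : Ind T) : (Ind.inclusion T).essImage
    ((tensor Tᵒᵖ).pointwiseLeftKanExtension
      ((Ind.inclusion T).obj A ⊠ (Ind.inclusion T).obj B)) :=
  mem_essImage_inclusion (isIndObject_dayConvolution (isIndObject_inclusion A)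
    (isIndObject_inclusion B) ((tensor Tᵒᵖ).pointwiseLeftKanExtensionUnit _))

lemma essImage_dayConvolutionUnit : (Ind.inclusion T).essImage
    ((Functor.fromPUnit.{0} (𝟙_ Tᵒᵖ)).pointwiseLeftKanExtension
      (Functor.fromPUnit.{0} (𝟙_ (Type v)))) :=
  mem_essImage_inclusion (isIndObject_dayConvolutionUnit T
    ((Functor.fromPUnit.{0} (𝟙_ Tᵒᵖ)).pointwiseLeftKanExtensionUnit _))

/-- The tensor product of ind-objects, as a full subcategory of presheaves with Day
convolution: `colim X i ⊗ colim Y j = colim (X i ⊗ Y j)`. -/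
instance indMonoidal : MonoidalCategory (Ind T) :=
  monoidalOfHasDayConvolutions (Ind.inclusion T) Ind.inclusion.fullyFaithful
    (essImage_dayConvolution T) (essImage_dayConvolutionUnit T)

instance indLawful : LawfulDayConvolutionMonoidalCategoryStruct Tᵒᵖ (Type v) (Ind T) :=
  lawfulDayConvolutionMonoidalCategoryStructOfHasDayConvolutions
    (Ind.inclusion T) Ind.inclusion.fullyFaithful
    (essImage_dayConvolution T) (essImage_dayConvolutionUnit T)

end

section
variable (T : Type u) [Category.{v} T] [EssentiallySmall.{v} T] [MonoidalCategory T]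
  [SymmetricCategory T]
open LawfulDayConvolutionMonoidalCategoryStruct
open scoped DayConvolution
attribute [local instance] convolution convolution₂ convolution₂'

/-- The opposite of a symmetric monoidal category is symmetric. -/
instance symmetricOpposite : SymmetricCategory Tᵒᵖ where
  symmetry X Y := Quiver.Hom.unop_inj (by simp)

/-- The braiding of ind-objects induced by the one of `T`. -/
def indBraiding (A B : Ind T) : A ⊗ B ≅ B ⊗ A :=
  Ind.inclusion.fullyFaithful.preimageIso
    (DayConvolution.braiding ((ι Tᵒᵖ (Type v) (Ind T)).obj A) ((ι Tᵒᵖ (Type v) (Ind T)).obj B))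

lemma ι_map_indBraiding (A B : Ind T) : (ι Tᵒᵖ (Type v) (Ind T)).map (indBraiding T A B).hom =
    (DayConvolution.braiding ((ι Tᵒᵖ (Type v) (Ind T)).obj A)
      ((ι Tᵒᵖ (Type v) (Ind T)).obj B)).hom :=
  Ind.inclusion.fullyFaithful.map_preimage _

lemma ind_braiding_naturality_right (A : Ind T) {B C : Ind T} (f : B ⟶ C) :
    A ◁ f ≫ (indBraiding T A C).hom = (indBraiding T A B).hom ≫ f ▷ A := by
  apply Functor.Faithful.map_injective (F := ι Tᵒᵖ (Type v) (Ind T))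
  rw [Functor.map_comp, Functor.map_comp, ι_map_indBraiding, ι_map_indBraiding,
    ← id_tensorHom, ← tensorHom_id, ι_map_tensorHom_hom_eq_tensorHom,
    ι_map_tensorHom_hom_eq_tensorHom, CategoryTheory.Functor.map_id]
  exact DayConvolution.braiding_naturality_right _ _

lemma ind_symmetry (A B : Ind T) :
    (indBraiding T A B).hom ≫ (indBraiding T B A).hom = 𝟙 _ := by
  apply Functor.Faithful.map_injective (F := ι Tᵒᵖ (Type v) (Ind T))
  rw [Functor.map_comp, ι_map_indBraiding, ι_map_indBraiding, CategoryTheory.Functor.map_id]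
  have h := @DayConvolution.symmetry Tᵒᵖ _ (Type v) _ _ _ _ _
    ((ι Tᵒᵖ (Type v) (Ind T)).obj A) ((ι Tᵒᵖ (Type v) (Ind T)).obj B)
    (convolution _ _ _ A B) (convolution _ _ _ B A)
  exact h

lemma ind_braiding_naturality_left {A B : Ind T} (f : A ⟶ B) (C : Ind T) :
    f ▷ C ≫ (indBraiding T B C).hom = (indBraiding T A C).hom ≫ C ◁ f := by
  apply Functor.Faithful.map_injective (F := ι Tᵒᵖ (Type v) (Ind T))
  rw [Functor.map_comp, Functor.map_comp, ι_map_indBraiding, ι_map_indBraiding,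
    ← id_tensorHom, ← tensorHom_id, ι_map_tensorHom_hom_eq_tensorHom,
    ι_map_tensorHom_hom_eq_tensorHom, CategoryTheory.Functor.map_id]
  have h := @DayConvolution.braiding_naturality_left Tᵒᵖ _ (Type v) _ _ _ _ _
    ((ι Tᵒᵖ (Type v) (Ind T)).obj A) ((ι Tᵒᵖ (Type v) (Ind T)).obj B)
    ((ι Tᵒᵖ (Type v) (Ind T)).map f) ((ι Tᵒᵖ (Type v) (Ind T)).obj C)
    (convolution _ _ _ A C) (convolution _ _ _ C A) (convolution _ _ _ B C) (convolution _ _ _ C B)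
  exact h

set_option maxHeartbeats 1000000 in
lemma ind_hexagon (A B C : Ind T) :
    (α_ A B C).hom ≫ (indBraiding T A (B ⊗ C)).hom ≫ (α_ B C A).hom =
      (indBraiding T A B).hom ▷ C ≫ (α_ B A C).hom ≫ B ◁ (indBraiding T A C).hom := by
  apply Functor.Faithful.map_injective (F := ι Tᵒᵖ (Type v) (Ind T))
  rw [← id_tensorHom, ← tensorHom_id]
  simp only [Functor.map_comp, ι_map_indBraiding, ι_map_tensorHom_hom_eq_tensorHom,
    ι_map_associator_hom_eq_associator_hom]
  rw [CategoryTheory.Functor.map_id, CategoryTheory.Functor.map_id]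
  have h := @DayConvolution.hexagon_forward _ _ _ _ _ _ _ _
    ((ι Tᵒᵖ (Type v) (Ind T)).obj A) ((ι Tᵒᵖ (Type v) (Ind T)).obj B) _ _
    ((ι Tᵒᵖ (Type v) (Ind T)).obj C) (convolution _ _ _ A B) (convolution _ _ _ B C)
    (convolution _ _ _ A (B ⊗ C)) (convolution _ _ _ (A ⊗ B) C) (convolution _ _ _ C A)
    (convolution _ _ _ B (C ⊗ A)) (convolution _ _ _ (B ⊗ C) A) (convolution _ _ _ B A)
    (convolution _ _ _ (B ⊗ A) C) (convolution _ _ _ A C) (convolution _ _ _ B (A ⊗ C))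
  exact h

lemma indBraiding_inv (A B : Ind T) : (indBraiding T A B).inv = (indBraiding T B A).hom := by
  rw [← cancel_epi (indBraiding T A B).hom, ind_symmetry, Iso.hom_inv_id]

instance indSymmetric : SymmetricCategory (Ind T) where
  braiding := indBraiding T
  braiding_naturality_right A B C f := ind_braiding_naturality_right T A f
  braiding_naturality_left f C := ind_braiding_naturality_left T f C
  hexagon_forward := ind_hexagon T
  hexagon_reverse A B C := by
    have h : ((α_ C A B) ≪≫ indBraiding T C (A ⊗ B) ≪≫ (α_ A B C)).inv =
        (whiskerRightIso (indBraiding T C A) B ≪≫ α_ A C B ≪≫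
          whiskerLeftIso A (indBraiding T C B)).inv :=
      congrArg Iso.inv (Iso.ext (by simpa using ind_hexagon T C A B))
    simpa [indBraiding_inv] using h
  symmetry := ind_symmetry T
end


section
variable {C : Type u} [Category.{v} C] [MonoidalCategory C]

/-- The tensor product `X 0 ⊗ X 1 ⊗ ⋯ ⊗ X (n - 1)`, bracketed to the left; the empty tensor
product is the unit. -/
def tensorFam : (n : ℕ) → (Fin n → C) → C
  | 0, _ => 𝟙_ C
  | n + 1, X => tensorFam n (fun i => X i.castSucc) ⊗ X (Fin.last n)

/-- The tensor product `f 0 ⊗ f 1 ⊗ ⋯ ⊗ f (n - 1)` of morphisms. -/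
def tensorFamMap : (n : ℕ) → {X Y : Fin n → C} → (∀ i, X i ⟶ Y i) →
    (tensorFam n X ⟶ tensorFam n Y)
  | 0, _, _, _ => 𝟙 (𝟙_ C)
  | n + 1, _, _, f => tensorFamMap n (fun i => f i.castSucc) ⊗ₘ f (Fin.last n)

/-- The tensor power `X ⊗ ⋯ ⊗ X` with `n` factors. -/
abbrev tensorPow (n : ℕ) (X : C) : C := tensorFam n (fun _ => X)

lemma tensorFamMap_id (n : ℕ) (X : Fin n → C) :
    tensorFamMap n (fun i => 𝟙 (X i)) = 𝟙 (tensorFam n X) := by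
  induction n with
  | zero => rfl
  | succ n ih =>
    change tensorFamMap n (fun i => 𝟙 (X i.castSucc)) ⊗ₘ 𝟙 (X (Fin.last n)) = _
    rw [ih (fun i => X i.castSucc), id_tensorHom_id]
    rfl

lemma tensorFamMap_comp (n : ℕ) {X Y Z : Fin n → C} (f : ∀ i, X i ⟶ Y i) (g : ∀ i, Y i ⟶ Z i) :
    tensorFamMap n f ≫ tensorFamMap n g = tensorFamMap n (fun i => f i ≫ g i) := by
  induction n with
  | zero => exact Category.comp_id _
  | succ n ih =>
    change (tensorFamMap n (fun i => f i.castSucc) ⊗ₘ f (Fin.last n)) ≫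
      (tensorFamMap n (fun i => g i.castSucc) ⊗ₘ g (Fin.last n)) = _
    rw [tensorHom_comp_tensorHom, ih]
    rfl

/-- The `n`-th tensor power `𝟙 ⟶ X ⊗ ⋯ ⊗ X` of a morphism `α : 𝟙 ⟶ X`. -/
def unitTensorPow {X : C} (α : 𝟙_ C ⟶ X) : (n : ℕ) → (𝟙_ C ⟶ tensorPow n X)
  | 0 => 𝟙 (𝟙_ C)
  | n + 1 => (λ_ (𝟙_ C)).inv ≫ (unitTensorPow α n ⊗ₘ α)

variable [BraidedCategory C]

lemma swap_naturality {P Q X Y : C} (p : P ⟶ Q) (a b : X ⟶ Y) :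
    ((α_ P X X).hom ≫ P ◁ (β_ X X).hom ≫ (α_ P X X).inv) ≫ ((p ⊗ₘ a) ⊗ₘ b) =
      ((p ⊗ₘ b) ⊗ₘ a) ≫ ((α_ Q Y Y).hom ≫ Q ◁ (β_ Y Y).hom ≫ (α_ Q Y Y).inv) := by
  simp only [Category.assoc, associator_naturality_assoc]
  rw [← associator_inv_naturality, ← id_tensorHom, ← id_tensorHom, tensorHom_comp_tensorHom_assoc,
    tensorHom_comp_tensorHom_assoc, BraidedCategory.braiding_naturality, Category.id_comp,
    Category.comp_id]

/-- The braiding applied to the last two factors of a tensor power. -/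
def lastSwap (X : C) (n : ℕ) : tensorPow (n + 2) X ⟶ tensorPow (n + 2) X :=
  (α_ (tensorPow n X) X X).hom ≫ tensorPow n X ◁ (β_ X X).hom ≫ (α_ (tensorPow n X) X X).inv

/-- The endomorphism of the `n`-fold tensor power which applies the braiding to the factors in
the positions `i` and `i + 1` (counted from `0`), for `i + 1 < n`. -/
def adjSwap (X : C) : (n : ℕ) → (i : ℕ) → (tensorPow n X ⟶ tensorPow n X)
  | 0, _ => 𝟙 (𝟙_ C)
  | 1, _ => 𝟙 (𝟙_ C ⊗ X)
  | n + 2, i =>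
    if i = n then lastSwap X n else adjSwap X (n + 1) i ▷ X

lemma adjSwap_last (X : C) (n : ℕ) : adjSwap X (n + 2) n = lastSwap X n := if_pos rfl

lemma adjSwap_of_ne (X : C) {n i : ℕ} (h : i ≠ n) :
    adjSwap X (n + 2) i = adjSwap X (n + 1) i ▷ X := if_neg h

lemma adjSwap_naturality (n i : ℕ) : ∃ σ : Equiv.Perm (Fin n), ∀ {X Y : C} (f : Fin n → (X ⟶ Y)),
    adjSwap X n i ≫ tensorFamMap n f = tensorFamMap n (fun j => f (σ j)) ≫ adjSwap Y n i := by
  induction n with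
  | zero => exact ⟨1, fun f => rfl⟩
  | succ n ih =>
    obtain _ | n := n
    · exact ⟨1, fun f => (Category.id_comp _).trans (Category.comp_id _).symm⟩
    · by_cases hi : i = n
      · refine ⟨Equiv.swap (Fin.last n).castSucc (Fin.last (n + 1)), fun {X Y} f => ?_⟩
        have h1 : (fun j : Fin n => f (Equiv.swap (Fin.last n).castSucc (Fin.last (n + 1))
            j.castSucc.castSucc)) = fun j => f j.castSucc.castSucc := by
          funext j
          congr 1
          apply Equiv.swap_apply_of_ne_of_ne
          · exact fun h => (Fin.castSucc_lt_last j).ne (Fin.castSucc_injective _ h)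
          · exact (Fin.castSucc_lt_last _).ne
        rw [hi, adjSwap_last, adjSwap_last]
        change ((α_ (tensorPow n X) X X).hom ≫ tensorPow n X ◁ (β_ X X).hom ≫
          (α_ (tensorPow n X) X X).inv) ≫ ((tensorFamMap n (fun j => f j.castSucc.castSucc) ⊗ₘ f (Fin.last n).castSucc) ⊗ₘ
          f (Fin.last (n + 1))) = ((tensorFamMap n (fun j => f (Equiv.swap (Fin.last n).castSucc
            (Fin.last (n + 1)) j.castSucc.castSucc)) ⊗ₘ
            f (Equiv.swap (Fin.last n).castSucc (Fin.last (n + 1)) (Fin.last n).castSucc)) ⊗ₘ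
            f (Equiv.swap (Fin.last n).castSucc (Fin.last (n + 1)) (Fin.last (n + 1)))) ≫
          ((α_ (tensorPow n Y) Y Y).hom ≫ tensorPow n Y ◁ (β_ Y Y).hom ≫
          (α_ (tensorPow n Y) Y Y).inv)
        rw [h1, Equiv.swap_apply_left, Equiv.swap_apply_right]
        exact swap_naturality _ _ _
      · obtain ⟨σ, hσ⟩ := ih
        refine ⟨⟨Fin.lastCases (Fin.last _) (fun j => (σ j).castSucc),
          Fin.lastCases (Fin.last _) (fun j => (σ.symm j).castSucc),
          Fin.lastCases (by simp) (by simp), Fin.lastCases (by simp) (by simp)⟩, fun {X Y} f => ?_⟩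
        rw [adjSwap_of_ne X hi, adjSwap_of_ne Y hi]
        change adjSwap X (n + 1) i ▷ X ≫ (tensorFamMap (n + 1) (fun j => f j.castSucc) ⊗ₘ
          f (Fin.last (n + 1))) = (tensorFamMap (n + 1) _ ⊗ₘ f _) ≫ adjSwap Y (n + 1) i ▷ Y
        rw [← tensorHom_id, ← tensorHom_id, tensorHom_comp_tensorHom, tensorHom_comp_tensorHom, hσ]
        simp

end

section
variable {C : Type u} [Category.{v} C] [Abelian C] [MonoidalCategory C] [SymmetricCategory C]

attribute [local instance] Abelian.hasFiniteBiproducts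

/-- The symmetric power `Symⁿ X`: the cokernel of
`⨁_{0 ≤ i < n - 1} X^{⊗ n} ⟶ X^{⊗ n}`, with components `adjSwap X n i - 1`. -/
def symPow (n : ℕ) (X : C) : C :=
  cokernel (biproduct.desc (fun i : Fin (n - 1) => adjSwap X n i - 𝟙 (tensorPow n X)))

/-- The projection `X^{⊗ n} ⟶ Symⁿ X`. -/
def symPowπ (n : ℕ) (X : C) : tensorPow n X ⟶ symPow n X :=
  cokernel.π (biproduct.desc (fun i : Fin (n - 1) => adjSwap X n i - 𝟙 (tensorPow n X)))

instance (n : ℕ) (X : C) : Epi (symPowπ n X) := inferInstanceAs (Epi (cokernel.π _))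

lemma adjSwap_symPowπ (n : ℕ) (X : C) (i : Fin (n - 1)) :
    adjSwap X n i ≫ symPowπ n X = symPowπ n X := by
  have h := biproduct.ι _ i ≫= cokernel.condition
    (biproduct.desc (fun i : Fin (n - 1) => adjSwap X n i - 𝟙 (tensorPow n X)))
  rw [biproduct.ι_desc_assoc, Preadditive.sub_comp, comp_zero, sub_eq_zero] at h
  exact h.trans (Category.id_comp _)

lemma symPow_desc {n : ℕ} {X Z : C} (f : tensorPow n X ⟶ Z)
    (hf : ∀ i : Fin (n - 1), adjSwap X n i ≫ f = f) : ∃ g : symPow n X ⟶ Z, symPowπ n X ≫ g = f :=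
  ⟨cokernel.desc _ f (by
    apply biproduct.hom_ext'
    intro i
    rw [biproduct.ι_desc_assoc, Preadditive.sub_comp, hf, Category.id_comp, sub_self, comp_zero]),
    cokernel.π_desc _ _ _⟩

/-- The morphism `αⁿ : 𝟙 ⟶ Symⁿ X` defined by a morphism `α : 𝟙 ⟶ X`. -/
def symPowElement {X : C} (α : 𝟙_ C ⟶ X) (n : ℕ) : 𝟙_ C ⟶ symPow n X :=
  unitTensorPow α n ≫ symPowπ n X


section filtration
variable (S : ShortComplex C) (n : ℕ)

/-- The two-step filtration `U ⊆ V` attached to `0 → U → V → W → 0`: the letter `false` stands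
for `U`, the letter `true` for `V`. -/
def letter : Bool → C
  | false => S.X₁
  | true => S.X₂

/-- The morphisms `U ⟶ V` and `V ⟶ V`. -/
def letterToMid : (b : Bool) → (letter S b ⟶ S.X₂)
  | false => S.f
  | true => 𝟙 S.X₂

/-- The morphisms `U ⟶ U ⊞ W` and `V ⟶ W ⟶ U ⊞ W` to the associated graded object. -/
def letterToGr : (b : Bool) → (letter S b ⟶ S.X₁ ⊞ S.X₃)
  | false => biprod.inl
  | true => S.g ≫ biprod.inr

variable {n} in
/-- The number of letters `V` in a word in the letters `U` and `V`. -/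
def weight (w : Fin n → Bool) : ℕ := (Finset.univ.filter (fun i => w i = true)).card

/-- The filtration of `V^{⊗ n}` induced by `0 ⊆ U ⊆ V`: its `j`-th step is the sum of the
images of the tensor products of `n` factors `U` and `V` with fewer than `j` factors `V`. The
step `0` is zero and the step `n + 1` is everything. -/
def filtPow (j : ℕ) : Subobject (tensorPow n S.X₂) :=
  (Finset.univ.filter (fun w : Fin n → Bool => weight w < j)).sup
    (fun w => imageSubobject (tensorFamMap n (fun i => letterToMid S (w i))))

/-- The quotient filtration on `Symⁿ V`. -/
def filtSym (j : ℕ) : Subobject (symPow n S.X₂) :=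
  imageSubobject ((filtPow S n j).arrow ≫ symPowπ n S.X₂)

lemma filtPow_mono {i j : ℕ} (h : i ≤ j) : filtPow S n i ≤ filtPow S n j :=
  Finset.sup_mono (fun w hw => by
    simp only [Finset.mem_filter, Finset.mem_univ, true_and] at hw ⊢
    omega)

lemma filtSym_mono {i j : ℕ} (h : i ≤ j) : filtSym S n i ≤ filtSym S n j := by
  refine imageSubobject_le _ (Subobject.ofLE _ _ (filtPow_mono S n h) ≫
    factorThruImageSubobject ((filtPow S n j).arrow ≫ symPowπ n S.X₂)) ?_
  unfold filtSym
  rw [Category.assoc, imageSubobject_arrow_comp, Subobject.ofLE_arrow_assoc]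

/-- The `j`-th graded piece of `Symⁿ V`. -/
def grSymPiece (j : ℕ) : C :=
  cokernel (Subobject.ofLE (filtSym S n j) (filtSym S n (j + 1)) (filtSym_mono S n j.le_succ))

/-- The projection of the step `j + 1` of the filtration of `Symⁿ V` onto the `j`-th piece. -/
def grSymPieceπ (j : ℕ) : ((filtSym S n (j + 1) : Subobject (symPow n S.X₂)) : C) ⟶
    grSymPiece S n j :=
  cokernel.π _

lemma ofLE_grSymPieceπ (j : ℕ) : Subobject.ofLE (filtSym S n j) (filtSym S n (j + 1))
    (filtSym_mono S n j.le_succ) ≫ grSymPieceπ S n j = 0 :=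
  cokernel.condition _

/-- The associated graded object of `Symⁿ V`. -/
def grSym : C := ⨁ (fun j : Fin (n + 1) => grSymPiece S n j)

/-- The inclusion of the `j`-th piece of the associated graded object. -/
def grSymι (j : Fin (n + 1)) : grSymPiece S n j ⟶ grSym S n :=
  biproduct.ι (fun j : Fin (n + 1) => grSymPiece S n j) j

variable {S n}

/-- The class in `gr_j (Symⁿ V)` of a morphism which factors through the step `j + 1` of the
filtration of `Symⁿ V`. -/
def toGr {Z : C} (j : ℕ) (hj : j < n + 1) (h : Z ⟶ symPow n S.X₂)
    (hh : (filtSym S n (j + 1)).Factors h) : Z ⟶ grSym S n :=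
  (filtSym S n (j + 1)).factorThru h hh ≫ grSymPieceπ S n j ≫ grSymι S n ⟨j, hj⟩

lemma toGr_congr {Z : C} {j j' : ℕ} (hj : j < n + 1) (hj' : j' < n + 1)
    {h h' : Z ⟶ symPow n S.X₂} (hh : (filtSym S n (j + 1)).Factors h)
    (hh' : (filtSym S n (j' + 1)).Factors h') (e : j = j') (e' : h = h') :
    toGr j hj h hh = toGr j' hj' h' hh' := by
  subst e e'
  rfl

lemma comp_toGr {Y Z : C} (a : Y ⟶ Z) (j : ℕ) (hj : j < n + 1) (h : Z ⟶ symPow n S.X₂)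
    (hh : (filtSym S n (j + 1)).Factors h) :
    a ≫ toGr j hj h hh = toGr j hj (a ≫ h) (Subobject.factors_of_factors_right a hh) := by
  unfold toGr
  rw [← Category.assoc, ← Subobject.factorThru_right]

lemma toGr_eq_zero {Z : C} (j : ℕ) (hj : j < n + 1) (h : Z ⟶ symPow n S.X₂)
    (hh : (filtSym S n (j + 1)).Factors h) (h0 : (filtSym S n j).Factors h) :
    toGr j hj h hh = 0 := by
  have e : (filtSym S n (j + 1)).factorThru h hh =
      (filtSym S n j).factorThru h h0 ≫ Subobject.ofLE _ _ (filtSym_mono S n j.le_succ) := by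
    rw [← cancel_mono (filtSym S n (j + 1)).arrow]
    simp
  unfold toGr
  rw [e, Category.assoc, reassoc_of% ofLE_grSymPieceπ S n j, zero_comp, comp_zero]

lemma weight_lt (w : Fin n → Bool) : weight w < n + 1 :=
  Nat.lt_succ_of_le ((Finset.card_le_univ _).trans_eq (Fintype.card_fin n))

lemma filtSym_factors_word (w : Fin n → Bool) {j : ℕ} (h : weight w < j) :
    (filtSym S n j).Factors
      (tensorFamMap n (fun i => letterToMid S (w i)) ≫ symPowπ n S.X₂) := by
  have hle : imageSubobject (tensorFamMap n (fun i => letterToMid S (w i))) ≤ filtPow S n j :=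
    Finset.le_sup (f := fun w : Fin n → Bool =>
      imageSubobject (tensorFamMap n (fun i => letterToMid S (w i)))) (by simpa using h)
  have h1 : (filtPow S n j).Factors (tensorFamMap n (fun i => letterToMid S (w i))) :=
    Subobject.factors_of_le _ hle (by
      simpa using imageSubobject_factors_comp_self (f := tensorFamMap n
        (fun i => letterToMid S (w i))) (𝟙 _))
  rw [← (filtPow S n j).factorThru_arrow _ h1, Category.assoc]
  exact imageSubobject_factors_comp_self (f := (filtPow S n j).arrow ≫ symPowπ n S.X₂) _

/-- The class in the associated graded object of `Symⁿ V` of the tensors which belong to a word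
in the letters `U` and `V`. -/
def wordToGr (w : Fin n → Bool) : tensorFam n (fun i => letter S (w i)) ⟶ grSym S n :=
  toGr (weight w) (weight_lt w) (tensorFamMap n (fun i => letterToMid S (w i)) ≫ symPowπ n S.X₂)
    (filtSym_factors_word w (weight w).lt_succ_self)

end filtration

/-- Right exactness of the tensor product in both variables. -/
class RightExactTensor (C : Type u) [Category.{v} C] [MonoidalCategory C] : Prop where
  tensorLeft_rightExact : ∀ X : C, PreservesFiniteColimits (tensorLeft X)
  tensorRight_rightExact : ∀ X : C, PreservesFiniteColimits (tensorRight X)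

attribute [instance] RightExactTensor.tensorLeft_rightExact RightExactTensor.tensorRight_rightExact

end

section descent
variable {C : Type u} [Category.{v} C] [Abelian C] [MonoidalCategory C]

lemma tensorFamMap_eq_zero [MonoidalPreadditive C] {n : ℕ} {X Y : Fin n → C} (f : ∀ i, X i ⟶ Y i)
    (i : Fin n) (hi : f i = 0) : tensorFamMap n f = 0 := by
  induction n with
  | zero => exact i.elim0
  | succ n ih =>
    change tensorFamMap n (fun i => f i.castSucc) ⊗ₘ f (Fin.last n) = 0
    rw [MonoidalCategory.tensorHom_def]
    induction i using Fin.lastCases with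
    | last => rw [hi, MonoidalPreadditive.whiskerLeft_zero, comp_zero]
    | cast i => rw [ih (fun i => f i.castSucc) i hi, MonoidalPreadditive.zero_whiskerRight, zero_comp]

lemma tensorFamMap_update_last {H : C} (n : ℕ) (κ : H ⟶ H) :
    tensorFamMap (n + 1) (Function.update (fun _ => 𝟙 H) (Fin.last n) κ) = tensorPow n H ◁ κ := by
  change (tensorFamMap n (fun i => Function.update (fun _ => 𝟙 H) (Fin.last n) κ
    i.castSucc) ⊗ₘ Function.update (fun _ => 𝟙 H) (Fin.last n) κ (Fin.last n)) = _
  have h1 : (fun i : Fin n => Function.update (fun _ : Fin (n + 1) => 𝟙 H) (Fin.last n) κ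
      i.castSucc) = fun _ => 𝟙 H := by
    funext i
    rw [Function.update_of_ne (Fin.castSucc_lt_last i).ne]
  rw [h1, tensorFamMap_id, Function.update_self, id_tensorHom]

lemma tensorFamMap_update_castSucc {H : C} (n : ℕ) (i : Fin n) (κ : H ⟶ H) :
    tensorFamMap (n + 1) (Function.update (fun _ => 𝟙 H) i.castSucc κ) =
      tensorFamMap n (Function.update (fun _ => 𝟙 H) i κ) ▷ H := by
  change (tensorFamMap n (fun j => Function.update (fun _ => 𝟙 H) i.castSucc κ
    j.castSucc) ⊗ₘ Function.update (fun _ => 𝟙 H) i.castSucc κ (Fin.last n)) = _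
  have h5 : (fun j : Fin n => Function.update (fun _ : Fin (n + 1) => 𝟙 H) i.castSucc κ
      j.castSucc) = Function.update (fun _ => 𝟙 H) i κ := by
    funext j
    by_cases hij : j = i
    · subst hij
      rw [Function.update_self, Function.update_self]
    · rw [Function.update_of_ne hij,
        Function.update_of_ne (fun h => hij (Fin.castSucc_injective _ h))]
  rw [h5, Function.update_of_ne (Fin.castSucc_lt_last i).ne', tensorHom_id]

variable [RightExactTensor C]

lemma epi_tensorFamMap {n : ℕ} {X Y : Fin n → C} (f : ∀ i, X i ⟶ Y i) (hf : ∀ i, Epi (f i)) :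
    Epi (tensorFamMap n f) := by
  induction n with
  | zero => exact inferInstanceAs (Epi (𝟙 _))
  | succ n ih =>
    have h1 := ih (fun i => f i.castSucc) (fun i => hf _)
    have h2 := hf (Fin.last n)
    have : Epi (tensorFamMap n (fun i => f i.castSucc) ▷ X (Fin.last n)) :=
      inferInstanceAs (Epi ((tensorRight _).map _))
    have : Epi (tensorFam n (fun i => Y i.castSucc) ◁ f (Fin.last n)) :=
      inferInstanceAs (Epi ((tensorLeft _).map _))
    change Epi (tensorFamMap n (fun i => f i.castSucc) ⊗ₘ f (Fin.last n))
    rw [MonoidalCategory.tensorHom_def]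
    exact epi_comp _ _

lemma desc_last [MonoidalPreadditive C] {P H G B Z : C} {κ : H ⟶ H} {e : H ⟶ G} {w : κ ≫ e = 0}
    (he : IsColimit (CokernelCofork.ofπ e w)) (h : (P ⊗ H) ⊗ B ⟶ Z) (h0 : (P ◁ κ) ▷ B ≫ h = 0) :
    ∃ h1 : (P ⊗ G) ⊗ B ⟶ Z, (P ◁ e) ▷ B ≫ h1 = h := by
  obtain ⟨h1, hh1⟩ := CokernelCofork.IsColimit.desc'
    (CokernelCofork.mapIsColimit _ he (tensorLeft P ⋙ tensorRight B)) h h0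
  exact ⟨h1, hh1⟩

lemma desc_comm [MonoidalPreadditive C] {P H G B Z : C} (m : P ⟶ P) (e : H ⟶ G) [Epi e]
    (h1 : (P ⊗ G) ⊗ B ⟶ Z)
    (h3 : (m ▷ H) ▷ B ≫ (P ◁ e) ▷ B ≫ h1 = 0) : m ▷ (G ⊗ B) ≫ (α_ P G B).inv ≫ h1 = 0 := by
  have : Epi (P ◁ (e ▷ B)) :=
    inferInstanceAs (Epi ((tensorLeft P).map ((tensorRight B).map e)))
  rw [← cancel_epi (P ◁ (e ▷ B)), comp_zero]
  have h6 : P ◁ (e ▷ B) ≫ m ▷ (G ⊗ B) ≫ (α_ P G B).inv ≫ h1 =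
      (α_ P H B).inv ≫ (m ▷ H) ▷ B ≫ (P ◁ e) ▷ B ≫ h1 := by
    rw [whisker_exchange_assoc]
    simp
  rw [h6, h3, comp_zero]

lemma desc_fact {P Q H G B Z : C} (m : P ⟶ Q) (e : H ⟶ G) (h1 : (P ⊗ G) ⊗ B ⟶ Z)
    (h2 : Q ⊗ G ⊗ B ⟶ Z) (h3 : m ▷ (G ⊗ B) ≫ h2 = (α_ P G B).inv ≫ h1) :
    (m ⊗ₘ e) ▷ B ≫ (α_ Q G B).hom ≫ h2 = (P ◁ e) ▷ B ≫ h1 := by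
  have h4 : h1 = (α_ P G B).hom ≫ m ▷ (G ⊗ B) ≫ h2 := by rw [h3, Iso.hom_inv_id_assoc]
  rw [h4, MonoidalCategory.tensorHom_def']
  simp

/-- A morphism out of a tensor power of `H` descends to the tensor power of a cokernel `G` of
`κ : H ⟶ H` if it vanishes on `κ` in each position. -/
lemma tensorPow_desc [MonoidalPreadditive C] {H G : C} {κ : H ⟶ H} {e : H ⟶ G} {w : κ ≫ e = 0}
    (he : IsColimit (CokernelCofork.ofπ e w)) (n : ℕ) : ∀ (B Z : C) (h : tensorPow n H ⊗ B ⟶ Z),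
    (∀ i : Fin n, tensorFamMap n (Function.update (fun _ => 𝟙 H) i κ) ▷ B ≫ h = 0) →
    ∃ h' : tensorPow n G ⊗ B ⟶ Z, tensorFamMap n (fun _ => e) ▷ B ≫ h' = h := by
  have epi_e : Epi e := Cofork.IsColimit.epi he
  induction n with
  | zero => exact fun B Z h _ => ⟨h, (congrArg (· ≫ h) (id_whiskerRight (𝟙_ C) B)).trans
      (Category.id_comp h)⟩
  | succ n ih =>
    intro B Z h hh
    obtain ⟨h1, hh1⟩ := desc_last (P := tensorPow n H) he h (by
      have := hh (Fin.last n)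
      rw [tensorFamMap_update_last] at this
      exact this)
    obtain ⟨h2, hh2⟩ := ih (G ⊗ B) Z ((α_ (tensorPow n H) G B).inv ≫ h1) (fun i => by
      refine desc_comm _ e _ ?_
      rw [hh1]
      have := hh i.castSucc
      rw [tensorFamMap_update_castSucc] at this
      exact this)
    exact ⟨(α_ (tensorPow n G) G B).hom ≫ h2, (desc_fact _ _ _ _ hh2).trans hh1⟩

end descent

section theta
variable {C : Type u} [Category.{v} C] [Abelian C] [MonoidalCategory C] [MonoidalPreadditive C]

attribute [local instance] Abelian.hasFiniteBiproducts

lemma sum_tensorFamMap {X Y : C} (p : Bool → (X ⟶ Y)) (n : ℕ) :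
    ∑ w : Fin n → Bool, tensorFamMap n (fun i => p (w i)) =
      tensorFamMap n (fun _ => p true + p false) := by
  induction n with
  | zero => exact Fintype.sum_unique _
  | succ n ih =>
    rw [← (Fin.snocEquiv (fun _ : Fin (n + 1) => Bool)).sum_comp, Fintype.sum_prod_type]
    have h (b : Bool) (w : Fin n → Bool) : tensorFamMap (n + 1)
        (fun i => p (Fin.snocEquiv (fun _ : Fin (n + 1) => Bool) (b, w) i)) =
        tensorFamMap n (fun i => p (w i)) ⊗ₘ p b := by
      change tensorFamMap n (fun i => p (Fin.snoc (α := fun _ => Bool) w b i.castSucc)) ⊗ₘ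
        p (Fin.snoc (α := fun _ => Bool) w b (Fin.last n)) = _
      simp only [Fin.snoc_castSucc, Fin.snoc_last]
    have h2 (b : Bool) : ∑ w : Fin n → Bool, (tensorFamMap n (fun i => p (w i)) ⊗ₘ p b) =
        tensorFamMap n (fun _ => p true + p false) ⊗ₘ p b := by
      rw [← ih, sum_tensor]
    have h3 (b : Bool) := (Finset.sum_congr rfl (fun w _ => h b w)).trans (h2 b)
    refine (Finset.sum_congr rfl (fun b _ => h3 b)).trans ?_
    exact (Fintype.sum_bool _).trans (MonoidalPreadditive.tensor_add _ _ _).symm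

variable [RightExactTensor C] {S : ShortComplex C}

/-- The projections of `U ⊞ V` onto `U` and `V`. -/
def toLetter (S : ShortComplex C) : (b : Bool) → (S.X₁ ⊞ S.X₂ ⟶ letter S b)
  | false => biprod.fst
  | true => biprod.snd

/-- The inclusions of `U` and `V` into `U ⊞ V`. -/
def ofLetter (S : ShortComplex C) : (b : Bool) → (letter S b ⟶ S.X₁ ⊞ S.X₂)
  | false => biprod.inl
  | true => biprod.inr

lemma ofLetter_map (b : Bool) :
    ofLetter S b ≫ biprod.map (𝟙 S.X₁) S.g = letterToGr S b := by
  cases b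
  · exact (biprod.inl_map _ _).trans (Category.id_comp _)
  · exact biprod.inr_map _ _

lemma ofLetter_toLetter_self (b : Bool) : ofLetter S b ≫ toLetter S b = 𝟙 _ := by
  cases b
  · exact biprod.inl_fst
  · exact biprod.inr_snd

lemma ofLetter_toLetter_mid {b c : Bool} (h : b ≠ c) :
    ofLetter S b ≫ toLetter S c ≫ letterToMid S c = 0 := by
  cases b <;> cases c
  · exact absurd rfl h
  · exact biprod.inl_snd_assoc _ |>.trans zero_comp
  · exact biprod.inr_fst_assoc _ |>.trans zero_comp
  · exact absurd rfl h

lemma kappa_map (S : ShortComplex C) :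
    (biprod.fst ≫ S.f ≫ biprod.inr : S.X₁ ⊞ S.X₂ ⟶ S.X₁ ⊞ S.X₂) ≫
      biprod.map (𝟙 S.X₁) S.g = 0 := by
  simp [S.zero_assoc]

/-- `U ⊞ W` is the cokernel of `U ⊞ V ⟶ U ⟶ V ⟶ U ⊞ V`. -/
def isColimitKappa (hS : S.ShortExact) : IsColimit (CokernelCofork.ofπ _ (kappa_map S)) :=
  CokernelCofork.IsColimit.ofπ _ _
    (fun k hk => biprod.desc (biprod.inl ≫ k) (hS.gIsCokernel.desc (CokernelCofork.ofπ
      (biprod.inr ≫ k) (by simpa using biprod.inl ≫= hk))))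
    (fun k hk => by
      apply biprod.hom_ext'
      · simp
      · rw [biprod.inr_map_assoc, biprod.inr_desc]
        exact hS.gIsCokernel.fac _ WalkingParallelPair.one)
    (fun k hk m hm => by
      have := hS.epi_g
      apply biprod.hom_ext'
      · rw [biprod.inl_desc, ← hm]
        simp
      · rw [biprod.inr_desc, ← cancel_epi S.g]
        refine Eq.trans ?_ (hS.gIsCokernel.fac (CokernelCofork.ofπ
          (biprod.inr ≫ k) _) WalkingParallelPair.one).symm
        change S.g ≫ biprod.inr ≫ m = biprod.inr ≫ k
        rw [← hm]
        simp)

/-- Two morphisms out of a tensor power of `U ⊞ W` agree if they agree after composition with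
`X₁ ⊗ ⋯ ⊗ Xₙ ⟶ (U ⊞ W)^{⊗ n}` for all words `X₁ ⋯ Xₙ` in the letters `U` and `V`. -/
lemma grPow_hom_ext (hS : S.ShortExact) {n : ℕ} {Z : C} {a b : tensorPow n (S.X₁ ⊞ S.X₃) ⟶ Z}
    (h : ∀ w : Fin n → Bool, tensorFamMap n (fun i => letterToGr S (w i)) ≫ a =
      tensorFamMap n (fun i => letterToGr S (w i)) ≫ b) : a = b := by
  have : Epi (biprod.map (𝟙 S.X₁) S.g) := Cofork.IsColimit.epi (isColimitKappa hS)
  have : Epi (tensorFamMap n (fun _ => biprod.map (𝟙 S.X₁) S.g)) :=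
    epi_tensorFamMap _ (fun _ => this)
  have h1 : tensorFamMap n (fun _ => biprod.map (𝟙 S.X₁) S.g) =
      ∑ w : Fin n → Bool, tensorFamMap n (fun i => toLetter S (w i)) ≫
        tensorFamMap n (fun i => letterToGr S (w i)) := by
    have h2 : biprod.map (𝟙 S.X₁) S.g =
        toLetter S true ≫ letterToGr S true + toLetter S false ≫ letterToGr S false := by
      rw [← ofLetter_map, ← ofLetter_map, ← Category.assoc, ← Category.assoc,
        ← Preadditive.add_comp]
      refine (Category.id_comp _).symm.trans (congrArg (· ≫ _) ?_)
      exact biprod.total.symm.trans (add_comm _ _)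
    rw [h2, ← sum_tensorFamMap (fun b => toLetter S b ≫ letterToGr S b)]
    exact Finset.sum_congr rfl (fun w _ => (tensorFamMap_comp _ _ _).symm)
  rw [← cancel_epi (tensorFamMap n (fun _ => biprod.map (𝟙 S.X₁) S.g)), h1,
    Preadditive.sum_comp, Preadditive.sum_comp]
  refine Finset.sum_congr rfl (fun w _ => ?_)
  rw [Category.assoc, Category.assoc, h]

variable [SymmetricCategory C]

lemma weight_comp_perm {n : ℕ} (w : Fin n → Bool) (σ : Equiv.Perm (Fin n)) :
    weight (fun i => w (σ i)) = weight w :=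
  Finset.card_equiv σ (by simp)

lemma weight_update_lt {n : ℕ} (w : Fin n → Bool) (i : Fin n) (hi : w i = true) :
    weight (Function.update w i false) < weight w := by
  apply Finset.card_lt_card
  rw [Finset.ssubset_iff_of_subset]
  · exact ⟨i, by simpa using hi, by simp⟩
  · intro j
    by_cases hj : j = i
    · subst hj; simp
    · simp [Function.update_of_ne hj]

/-- The composite `U ⊞ V ⟶ V` of the projection to a letter with its morphism to `V`. -/
def midProj (S : ShortComplex C) (b : Bool) : S.X₁ ⊞ S.X₂ ⟶ S.X₂ := toLetter S b ≫ letterToMid S b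

lemma filtSym_factors_midProj {n : ℕ} (w : Fin n → Bool) {j : ℕ} (h : weight w < j) :
    (filtSym S n j).Factors (tensorFamMap n (fun i => midProj S (w i)) ≫ symPowπ n S.X₂) := by
  unfold midProj
  rw [← tensorFamMap_comp, Category.assoc]
  exact Subobject.factors_of_factors_right _ (filtSym_factors_word w h)

/-- The sum over all words of `wordToGr`, on the tensor power of `U ⊞ V`. -/
def thetaLift (S : ShortComplex C) (n : ℕ) : tensorPow n (S.X₁ ⊞ S.X₂) ⟶ grSym S n :=
  ∑ w : Fin n → Bool, toGr (weight w) (weight_lt w)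
    (tensorFamMap n (fun i => midProj S (w i)) ≫ symPowπ n S.X₂)
    (filtSym_factors_midProj w (weight w).lt_succ_self)

lemma word_thetaLift {n : ℕ} (w : Fin n → Bool) :
    tensorFamMap n (fun i => ofLetter S (w i)) ≫ thetaLift S n = wordToGr w := by
  unfold thetaLift
  rw [Preadditive.comp_sum, Finset.sum_eq_single w]
  · rw [comp_toGr]
    refine toGr_congr _ _ _ _ rfl ?_
    rw [← Category.assoc, tensorFamMap_comp]
    congr 2
    funext i
    unfold midProj
    rw [← Category.assoc, ofLetter_toLetter_self, Category.id_comp]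
  · intro w' _ hw
    obtain ⟨i, hi⟩ := Function.ne_iff.1 hw
    rw [comp_toGr]
    apply toGr_eq_zero
    rw [← Category.assoc, tensorFamMap_comp,
      tensorFamMap_eq_zero _ i (ofLetter_toLetter_mid (S := S) (Ne.symm hi)), zero_comp]
    exact Subobject.factors_zero
  · exact fun h => absurd (Finset.mem_univ _) h

lemma swap_thetaLift (n i : ℕ) (hi : i < n - 1) :
    adjSwap (S.X₁ ⊞ S.X₂) n i ≫ thetaLift S n = thetaLift S n := by
  obtain ⟨σ, hσ⟩ := adjSwap_naturality (C := C) n i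
  unfold thetaLift
  rw [Preadditive.comp_sum, ← (Equiv.arrowCongr σ.symm (Equiv.refl Bool)).sum_comp
    (fun w => toGr (weight w) _ _ _)]
  refine Finset.sum_congr rfl (fun w _ => ?_)
  rw [comp_toGr]
  refine toGr_congr _ _ _ _ (weight_comp_perm w σ).symm ?_
  rw [← Category.assoc, hσ, Category.assoc, adjSwap_symPowπ n S.X₂ ⟨i, hi⟩]
  rfl

lemma kappa_thetaLift {n : ℕ} (i : Fin n) :
    tensorFamMap n (Function.update (fun _ => 𝟙 (S.X₁ ⊞ S.X₂)) i
      (biprod.fst ≫ S.f ≫ biprod.inr)) ≫ thetaLift S n = 0 := by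
  unfold thetaLift
  rw [Preadditive.comp_sum]
  refine Finset.sum_eq_zero (fun w _ => ?_)
  rw [comp_toGr]
  apply toGr_eq_zero
  rw [← Category.assoc, tensorFamMap_comp]
  cases hi : w i
  · rw [tensorFamMap_eq_zero _ i, zero_comp]
    · exact Subobject.factors_zero
    · rw [Function.update_self, hi]
      change (biprod.fst ≫ S.f ≫ biprod.inr) ≫ biprod.fst ≫ S.f = 0
      simp
  · convert filtSym_factors_midProj (S := S) _ (weight_update_lt w i hi) using 4 with j
    by_cases hj : j = i
    · subst hj
      rw [Function.update_self, Function.update_self, hi]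
      change (biprod.fst ≫ S.f ≫ biprod.inr) ≫ biprod.snd ≫ 𝟙 _ = biprod.fst ≫ S.f
      simp
    · rw [Function.update_of_ne hj, Function.update_of_ne hj, Category.id_comp]

/-- Existence of `θⁿ`. -/
lemma exists_theta (hS : S.ShortExact) (n : ℕ) :
    ∃ θ : symPow n (S.X₁ ⊞ S.X₃) ⟶ grSym S n, ∀ w : Fin n → Bool,
      tensorFamMap n (fun i => letterToGr S (w i)) ≫ symPowπ n (S.X₁ ⊞ S.X₃) ≫ θ =
        wordToGr w := by
  have : Epi (biprod.map (𝟙 S.X₁) S.g) := Cofork.IsColimit.epi (isColimitKappa hS)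
  have : Epi (tensorFamMap n (fun _ => biprod.map (𝟙 S.X₁) S.g)) :=
    epi_tensorFamMap _ (fun _ => this)
  obtain ⟨ψ', hψ'⟩ := tensorPow_desc (isColimitKappa hS) n (𝟙_ C) _
    ((ρ_ _).hom ≫ thetaLift S n) (fun i => by
      rw [rightUnitor_naturality_assoc, kappa_thetaLift, comp_zero])
  obtain ⟨ψ, hψ⟩ : ∃ ψ : tensorPow n (S.X₁ ⊞ S.X₃) ⟶ grSym S n,
      tensorFamMap n (fun _ => biprod.map (𝟙 S.X₁) S.g) ≫ ψ = thetaLift S n :=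
    ⟨(ρ_ _).inv ≫ ψ', by
      rw [rightUnitor_inv_naturality_assoc, hψ', Iso.inv_hom_id_assoc]⟩
  obtain ⟨θ, hθ⟩ := symPow_desc ψ (fun i => by
    rw [← cancel_epi (tensorFamMap n (fun _ => biprod.map (𝟙 S.X₁) S.g))]
    obtain ⟨σ, hσ⟩ := adjSwap_naturality (C := C) n i
    rw [← Category.assoc, ← hσ (fun _ => biprod.map (𝟙 S.X₁) S.g), Category.assoc, hψ,
      swap_thetaLift n i i.2])
  refine ⟨θ, fun w => ?_⟩
  rw [hθ, ← word_thetaLift, ← hψ, ← Category.assoc, tensorFamMap_comp]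
  congr 2
  funext i
  exact (ofLetter_map _).symm

/-- The component `θⁿ : Symⁿ (gr V) ⟶ gr (Symⁿ V)` of the morphism `θ_Σ`, for a short exact
sequence `Σ : 0 → U → V → W → 0` and `gr V = U ⊞ W`. It is the morphism which sends the product
of the classes of `n` generalized elements of `U` (in degree `0`) and of `V` (in degree `1`)
to the class of their product in `Symⁿ V`, see `theta_spec` and `eq_theta`. -/
def theta (hS : S.ShortExact) (n : ℕ) : symPow n (S.X₁ ⊞ S.X₃) ⟶ grSym S n :=
  Classical.choose (exists_theta hS n)

lemma theta_spec (hS : S.ShortExact) {n : ℕ} (w : Fin n → Bool) :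
    tensorFamMap n (fun i => letterToGr S (w i)) ≫ symPowπ n (S.X₁ ⊞ S.X₃) ≫ theta hS n =
      wordToGr w :=
  Classical.choose_spec (exists_theta hS n) w

lemma eq_theta (hS : S.ShortExact) {n : ℕ} (θ : symPow n (S.X₁ ⊞ S.X₃) ⟶ grSym S n)
    (h : ∀ w : Fin n → Bool, tensorFamMap n (fun i => letterToGr S (w i)) ≫
      symPowπ n (S.X₁ ⊞ S.X₃) ≫ θ = wordToGr w) : θ = theta hS n := by
  rw [← cancel_epi (symPowπ n (S.X₁ ⊞ S.X₃))]
  exact grPow_hom_ext hS (fun w => (h w).trans (theta_spec hS w).symm)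

end theta


section modules
variable {D : Type u} [Category.{v} D] [MonoidalCategory D]

/-- The free `A`-module `A ⊗ X` on an object `X`. -/
def freeMod (A : D) [MonObj A] (X : D) : Mod D A where
  X := A ⊗ X
  mod :=
    { smul := (α_ A A X).inv ≫ MonObj.mul ▷ X
      one_smul := by
        change MonObj.one ▷ (A ⊗ X) ≫ (α_ A A X).inv ≫ MonObj.mul ▷ X = (λ_ (A ⊗ X)).hom
        rw [associator_inv_naturality_left_assoc, ← comp_whiskerRight, MonObj.one_mul]
        simp
      mul_smul := by
        change MonObj.mul ▷ (A ⊗ X) ≫ (α_ A A X).inv ≫ MonObj.mul ▷ X =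
          (α_ A A (A ⊗ X)).hom ≫ A ◁ ((α_ A A X).inv ≫ MonObj.mul ▷ X) ≫
            (α_ A A X).inv ≫ MonObj.mul ▷ X
        rw [associator_inv_naturality_left_assoc, ← comp_whiskerRight, MonObj.mul_assoc]
        simp }

/-- The functor `X ↦ A ⊗ X` to the category of `A`-modules. -/
def freeModFunctor (A : D) [MonObj A] : D ⥤ Mod D A where
  obj X := freeMod A X
  map {X Y} f := Mod.Hom.mk' (M := freeMod A X) (N := freeMod A Y) (A ◁ f) (by
    change ((α_ A A X).inv ≫ MonObj.mul ▷ X) ≫ A ◁ f =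
      A ◁ (A ◁ f) ≫ (α_ A A Y).inv ≫ MonObj.mul ▷ Y
    rw [Category.assoc, ← whisker_exchange, associator_inv_naturality_right_assoc])
  map_id X := Mod.hom_ext _ _ (whiskerLeft_id A X)
  map_comp f g := Mod.hom_ext _ _ (whiskerLeft_comp A f g)

end modules

section algebras
variable {T : Type u} [Category.{v} T] [EssentiallySmall.{v} T] [MonoidalCategory T]
  [SymmetricCategory T]

/-- The functor `A ⊗ -` from `T` to the category of modules over a commutative algebra `A` in
the category of ind-objects of `T`. -/
def extendScalars (A : CommMon (Ind T)) : T ⥤ Mod (Ind T) A.X :=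
  Ind.yoneda ⋙ freeModFunctor A.X

/-- The short exact sequence `A ⊗ Σ` splits in the category of `A`-modules: its monomorphism
`A ⊗ U ⟶ A ⊗ V` has an `A`-linear retraction. -/
def SplitsOver [HasZeroMorphisms T] (A : CommMon (Ind T)) (S : ShortComplex T) : Prop :=
  IsSplitMono ((extendScalars A).map S.f)

end algebras

section definitions

/-- Tensor categories over a field `k`: the essentially small `k`-linear abelian symmetric
monoidal categories, with a tensor product which is right exact and `k`-linear in both variables,
such that `k ⟶ End 𝟙` is an isomorphism (in particular `𝟙` is not zero) and every object has a
dual. -/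
class TensorCategory (k : Type w) [Field k] (T : Type u) [Category.{v} T] [EssentiallySmall.{v} T]
    [Abelian T] [Linear k T] [MonoidalCategory T] [SymmetricCategory T] [MonoidalPreadditive T]
    [MonoidalLinear k T] [RightExactTensor T] : Prop where
  bijective_end : Function.Bijective (fun a : k => a • 𝟙 (𝟙_ T))
  exists_dual : ∀ X : T, ∃ Y : T, Nonempty (ExactPairing X Y)

/-- Local semisimplicity: there are a `k`-linear abelian symmetric monoidal category `C` with
`𝟙 ≠ 0` and a tensor product which is right exact and `k`-linear in both variables, and a tensor
functor `F : T ⥤ C` (a right exact `k`-linear symmetric monoidal functor) which maps every short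
exact sequence to a split one. The universe levels `w₁`, `w₂` bound the size of `C`. -/
def LocallySemisimple (k : Type w) [Field k] (T : Type u) [Category.{v} T] [Abelian T]
    [Linear k T] [MonoidalCategory T] [SymmetricCategory T] : Prop :=
  ∃ (C : Type w₁) (_ : Category.{w₂} C) (_ : Abelian C) (_ : Linear k C) (_ : MonoidalCategory C)
    (_ : SymmetricCategory C) (_ : MonoidalPreadditive C) (_ : MonoidalLinear k C)
    (_ : RightExactTensor C) (_ : ¬ IsZero (𝟙_ C))
    (F : T ⥤ C) (_ : F.Additive) (_ : F.Linear k) (_ : PreservesFiniteColimits F)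
    (_ : F.Braided), ∀ S : ShortComplex T, S.ShortExact → Nonempty (S.map F).Splitting

end definitions

end LSS

end

/-! The unit of `T` is simple: a subobject `U` of `𝟙` is rigid, hence a direct summand, and `End 𝟙`
has no idempotents except `0` and `1`. So every non-zero `α : 𝟙 ⟶ X` is a monomorphism, and
tensoring with an object is exact.

(0) ⇒ (i). `θ` is always an epimorphism, because `gr Symⁿ V` is generated by the classes of words in
`U` and `V` (`epi_theta`). If `F` splits `Σ`, then the splitting `F V ≅ F U ⊕ F W` gives projections
of `F V ⊗ ⋯ ⊗ F V` onto the words of weight `j`. They are triangular with respect to the filtration,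
so they assemble to a retraction of `F θ` (`isSplitMono_map_theta`). A functor that splits all short
exact sequences reflects monomorphisms, since it kills no non-zero object (`mono_of_mono_map`);
hence `θ` is an isomorphism.

(i) ⇒ (ii). For the sequence `𝟙 ⟶ X ⟶ X/𝟙` defined by `α`, the morphism `θ` sends the `n`-th power
of the split inclusion `𝟙 ⟶ 𝟙 ⊕ X/𝟙` to the class of `αⁿ` in degree `0`. The former is not zero, so
the latter is not zero (`symPowElement_ne_zero_of_isIso_theta`).

(iii) ⇒ (ii). A retraction of `A ⊗ α` gives `ρ : X ⟶ A` with `α ≫ ρ = 1`. As `A` is commutative, the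
power of `ρ` factors through `Symⁿ X` and sends `αⁿ` to `1 ≠ 0`
(`symPowElement_ne_zero_of_splitsOver`).

(ii) ⇒ (iv). The algebra `Sym X / (α - 1)` is the filtered colimit of `Symⁿ X` along multiplication
by `α`; its unit vanishes only if some `αⁿ` does. The colimit of these algebras over finite
amalgamated sums of objects under `𝟙` is a non-zero `A` whose unit factors through every non-zero `𝟙
⟶ X` (`exists_commMon_factors_all`). For a monomorphism `f : U ⟶ V` with `U'` dual to `U`, the
pushout of `f ⊗ U'` along the evaluation `U ⊗ U' ⟶ 𝟙` is such a morphism `α : 𝟙 ⟶ E`, and a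
factorization of the unit through `α` translates by duality into a retraction of `A ⊗ f`
(`exists_retraction_data`, `splitsOver_of_factors`).

(iv) ⇒ (0). The target category does not have to be the category of all modules. The free modules `A
⊗ X` with `X` in `T` form an essentially small additive symmetric monoidal category, realized by
Kleisli morphisms. Its additive presheaves of abelian groups with Day convolution form an abelian
symmetric monoidal category with a right exact tensor product, and the Yoneda embedding is symmetric
monoidal. Split sequences remain split, so the composite from `T` is automatically right exact
(`locallySemisimple_of_splitsOver`). -/

noncomputable section
namespace LSS

/-! ### Rigid subobjects of the unit object -/

section rigid
variable {T : Type u} [Category.{v} T] [MonoidalCategory T]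

/-- `X ⊗ -` is right adjoint to `X' ⊗ -`. With the assumed right exactness this makes tensoring with
a rigid object exact. -/
lemma mono_whiskerLeft_of_exactPairing (X X' : T) [ExactPairing X X'] {Y Z : T} (f : Y ⟶ Z)
    [Mono f] : Mono (X ◁ f) :=
  have := (tensorLeftAdjunction X X').isRightAdjoint
  inferInstanceAs (Mono ((tensorLeft X).map f))

lemma mono_whiskerRight_of_mono_whiskerLeft [BraidedCategory T] (X : T) {Y Z : T} (f : Y ⟶ Z)
    [Mono (X ◁ f)] : Mono (f ▷ X) := by
  have h : f ▷ X = (β_ Y X).hom ≫ X ◁ f ≫ (β_ Z X).inv := by simp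
  rw [h]
  infer_instance

variable [Abelian T] [MonoidalPreadditive T] [RightExactTensor T]

lemma isZero_tensorLeft (X : T) {Y : T} (h : IsZero Y) : IsZero (X ⊗ Y) :=
  (tensorLeft X).map_isZero h

lemma epi_whiskerLeft (X : T) {Y Z : T} (f : Y ⟶ Z) [Epi f] : Epi (X ◁ f) :=
  inferInstanceAs (Epi ((tensorLeft X).map f))

lemma epi_whiskerRight (X : T) {Y Z : T} (f : Y ⟶ Z) [Epi f] : Epi (f ▷ X) :=
  inferInstanceAs (Epi ((tensorRight X).map f))

lemma epi_whiskerLeft_of_isZero (X : T) {Y Z : T} (f : Y ⟶ Z) (h : IsZero (X ⊗ cokernel f)) :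
    Epi (X ◁ f) :=
  Preadditive.epi_of_isZero_cokernel ((tensorLeft X).map f)
    (h.of_iso (PreservesCokernel.iso (tensorLeft X) f).symm)

variable [BraidedCategory T]

/-- A rigid subobject of the unit object is a direct summand. -/
lemma exists_retraction_of_mono_unit {U V : T} [ExactPairing U V] (i : U ⟶ 𝟙_ T) [Mono i]
    (hm : ∀ X : T, Mono (X ◁ i)) : ∃ r : 𝟙_ T ⟶ U, i ≫ r = 𝟙 U := by
  -- Let `Q` be the cokernel of `i`. By the exchange law the epimorphism `𝟙 ⊗ U ⟶ Q ⊗ U`, followed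
  -- by the monomorphism `Q ◁ i`, is `U ⟶ 𝟙 ⟶ Q` up to unitors, which is zero.
  have hQU : IsZero (cokernel i ⊗ U) := by
    have h0 : cokernel.π i ▷ U ≫ cokernel i ◁ i = 0 := by
      rw [← whisker_exchange]
      have : i ≫ cokernel.π i = 0 := cokernel.condition i
      have h : 𝟙_ T ◁ i ≫ cokernel.π i ▷ 𝟙_ T =
          (λ_ U).hom ≫ (i ≫ cokernel.π i) ≫ (ρ_ _).inv := by
        have h : (λ_ (𝟙_ T)).inv ≫ (ρ_ (𝟙_ T)).hom = 𝟙 _ := by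
          rw [unitors_inv_equal, Iso.inv_hom_id]
        simp [reassoc_of% h]
      rw [h, this, zero_comp, comp_zero]
    have := hm (cokernel i)
    have h1 : cokernel.π i ▷ U = 0 := by rw [← cancel_mono (cokernel i ◁ i), h0, zero_comp]
    have := epi_whiskerRight U (cokernel.π i)
    exact IsZero.of_epi_eq_zero _ h1
  have hUVQ : IsZero (U ⊗ V ⊗ cokernel i) :=
    (isZero_tensorLeft V hQU).of_iso
      ((α_ _ _ _).symm ≪≫ whiskerRightIso (β_ U V) _ ≪≫ α_ _ _ _ ≪≫ whiskerLeftIso V (β_ _ _))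
  -- Duality identifies the endomorphisms of `V ⊗ Q` with `Hom(Q, U ⊗ V ⊗ Q)`, which is zero.
  have hVQ : IsZero (V ⊗ cokernel i) := by
    rw [IsZero.iff_id_eq_zero]
    exact ((tensorLeftAdjunction U V).homEquiv _ _).injective (hUVQ.eq_of_tgt _ _)
  have := hm V
  have := epi_whiskerLeft_of_isZero V i hVQ
  have : IsIso (V ◁ i) := isIso_of_mono_of_epi _
  -- Since `V ◁ i` is invertible, duality shows that restriction along `i` is a bijection from
  -- `Hom(𝟙, U)` to `Hom(U, U)`. The retraction is the preimage of the identity.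
  let adj := tensorLeftAdjunction U V
  refine ⟨adj.homEquiv _ _ (inv (V ◁ i) ≫ (adj.homEquiv _ _).symm (ρ_ U).inv) ≫ (ρ_ U).hom, ?_⟩
  rw [← Category.assoc, ← adj.homEquiv_naturality_left]
  change adj.homEquiv _ _ (V ◁ i ≫ _) ≫ _ = _
  rw [IsIso.hom_inv_id_assoc, Equiv.apply_symm_apply, Iso.inv_hom_id]

end rigid

/-- Abelian symmetric monoidal categories in which every object has a dual and the unit object is
non-zero and indecomposable. -/
class RigidConnected (T : Type u) [Category.{v} T] [Preadditive T] [MonoidalCategory T] : Prop where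
  exists_dual : ∀ X : T, ∃ Y : T, Nonempty (ExactPairing X Y)
  id_unit_ne_zero : 𝟙 (𝟙_ T) ≠ 0
  eq_zero_or_eq_id : ∀ e : 𝟙_ T ⟶ 𝟙_ T, e ≫ e = e → e = 0 ∨ e = 𝟙 _

/-- An idempotent of the field `k ≅ End 𝟙` is `0` or `1`. Simplicity of the unit will follow from
this and the existence of duals. -/
lemma TensorCategory.rigidConnected (k : Type w) [Field k] (T : Type u) [Category.{v} T]
    [EssentiallySmall.{v} T] [Abelian T] [Linear k T] [MonoidalCategory T] [SymmetricCategory T]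
    [MonoidalPreadditive T] [MonoidalLinear k T] [RightExactTensor T] [TensorCategory k T] :
    RigidConnected T where
  exists_dual := TensorCategory.exists_dual k
  id_unit_ne_zero h := one_ne_zero ((TensorCategory.bijective_end (k := k) (T := T)).1
    (show (1 : k) • 𝟙 (𝟙_ T) = (0 : k) • 𝟙 (𝟙_ T) by rw [h, smul_zero, smul_zero]))
  eq_zero_or_eq_id e he := by
    obtain ⟨a, rfl⟩ := (TensorCategory.bijective_end (k := k) (T := T)).2 e
    have h : a * a = a := (TensorCategory.bijective_end (k := k) (T := T)).1 (by
      simpa [smul_smul] using he)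
    rcases eq_or_ne a 0 with h0 | h0
    · simp [h0]
    · simp [mul_left_cancel₀ h0 (h.trans (mul_one a).symm)]

/-! ### Simplicity of the unit object -/

namespace RigidConnected
variable {T : Type u} [Category.{v} T] [Abelian T] [MonoidalCategory T] [SymmetricCategory T]
  [MonoidalPreadditive T] [RightExactTensor T] [RigidConnected T]

lemma mono_whiskerLeft (X : T) {Y Z : T} (f : Y ⟶ Z) [Mono f] : Mono (X ◁ f) := by
  obtain ⟨X', ⟨_⟩⟩ := exists_dual X
  exact mono_whiskerLeft_of_exactPairing X X' f

lemma mono_whiskerRight (X : T) {Y Z : T} (f : Y ⟶ Z) [Mono f] : Mono (f ▷ X) :=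
  have := mono_whiskerLeft X f
  mono_whiskerRight_of_mono_whiskerLeft X f

/-- The unit object is simple. -/
lemma isZero_or_isIso {U : T} (i : U ⟶ 𝟙_ T) [Mono i] : IsZero U ∨ IsIso i := by
  obtain ⟨V, ⟨_⟩⟩ := exists_dual U
  obtain ⟨r, hr⟩ := exists_retraction_of_mono_unit (V := V) i (fun X => mono_whiskerLeft X i)
  -- The projection `𝟙 ⟶ U ⟶ 𝟙` onto the direct summand `U` is an idempotent.
  obtain h | h := eq_zero_or_eq_id (r ≫ i) (by rw [Category.assoc, reassoc_of% hr])
  · left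
    have h1 : i ≫ (r ≫ i) ≫ r = 𝟙 U := by rw [Category.assoc, reassoc_of% hr, hr]
    rw [IsZero.iff_id_eq_zero, ← h1, h, zero_comp, comp_zero]
  · right
    have : IsSplitEpi i := ⟨⟨⟨r, h⟩⟩⟩
    exact isIso_of_mono_of_isSplitEpi i

/-- A non-zero morphism out of the unit object is a monomorphism. -/
lemma mono_of_ne_zero {X : T} (f : 𝟙_ T ⟶ X) (hf : f ≠ 0) : Mono f := by
  obtain h | h := isZero_or_isIso (kernel.ι f)
  · exact Preadditive.mono_of_isZero_kernel f h
  · exact absurd ((cancel_epi (kernel.ι f)).1 ((kernel.condition f).trans comp_zero.symm)) hf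

lemma shortExact_of_ne_zero {X : T} (f : 𝟙_ T ⟶ X) (hf : f ≠ 0) :
    (ShortComplex.mk f (cokernel.π f) (cokernel.condition f)).ShortExact :=
  have := mono_of_ne_zero f hf
  { exact := ShortComplex.exact_of_g_is_cokernel _ (cokernelIsCokernel f) }

end RigidConnected

/-! ### Generation of the graded symmetric power by words -/

lemma exists_epi_imageSubobject {C : Type u} [Category.{v} C] [Abelian C] {X Y : C} (f : X ⟶ Y) :
    ∃ e : X ⟶ imageSubobject f, Epi e ∧ e ≫ (imageSubobject f).arrow = f :=
  ⟨factorThruImageSubobject f, inferInstance, imageSubobject_arrow_comp f⟩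

section
variable {C : Type u} [Category.{v} C] [Abelian C] [MonoidalCategory C] [SymmetricCategory C]
attribute [local instance] Abelian.hasFiniteBiproducts
variable {S : ShortComplex C} {n : ℕ}

lemma filtPow_factors_word (w : Fin n → Bool) {j : ℕ} (h : weight w < j) :
    (filtPow S n j).Factors (tensorFamMap n (fun i => letterToMid S (w i))) := by
  have hle : imageSubobject (tensorFamMap n (fun i => letterToMid S (w i))) ≤ filtPow S n j :=
    Finset.le_sup (f := fun w : Fin n → Bool =>
      imageSubobject (tensorFamMap n (fun i => letterToMid S (w i)))) (by simpa using h)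
  exact Subobject.factors_of_le _ hle (by
    simpa using imageSubobject_factors_comp_self (f := tensorFamMap n
      (fun i => letterToMid S (w i))) (𝟙 _))

/-- The kernel of `z`, as a subobject of the tensor power, contains the image of each word of weight
less than `j`, hence the supremum of these images. -/
lemma filtPow_hom_eq_zero {j : ℕ} {Z : C} (z : (filtPow S n j : C) ⟶ Z)
    (h : ∀ (w : Fin n → Bool) (hw : weight w < j),
      (filtPow S n j).factorThru _ (filtPow_factors_word w hw) ≫ z = 0) : z = 0 := by
  have hle : filtPow S n j ≤ Subobject.mk (kernel.ι z ≫ (filtPow S n j).arrow) := by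
    refine Finset.sup_le (fun w hw => imageSubobject_le_mk _ _ (kernel.lift z _ (h w ?_)) ?_)
    · simpa using hw
    · rw [kernel.lift_ι_assoc, Subobject.factorThru_arrow]
  have h1 : Subobject.ofLEMk _ _ hle ≫ kernel.ι z = 𝟙 _ := by
    rw [← cancel_mono (filtPow S n j).arrow, Category.assoc, Subobject.ofLEMk_comp,
      Category.id_comp]
  rw [← Category.id_comp z, ← h1, Category.assoc, kernel.condition, comp_zero]

lemma filtSym_hom_eq_zero {j : ℕ} {Z : C} (z : (filtSym S n j : C) ⟶ Z)
    (h : ∀ (w : Fin n → Bool) (hw : weight w < j),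
      (filtSym S n j).factorThru _ (filtSym_factors_word w hw) ≫ z = 0) : z = 0 := by
  obtain ⟨e, _, he⟩ : ∃ e : (filtPow S n j : C) ⟶ filtSym S n j, Epi e ∧
      e ≫ (filtSym S n j).arrow = (filtPow S n j).arrow ≫ symPowπ n S.X₂ :=
    exists_epi_imageSubobject _
  rw [← cancel_epi e, comp_zero]
  refine filtPow_hom_eq_zero _ (fun w hw => ?_)
  rw [← Category.assoc]
  refine Eq.trans (congrArg (· ≫ z) ?_) (h w hw)
  rw [← cancel_mono (filtSym S n j).arrow, Subobject.factorThru_arrow, Category.assoc, he,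
    Subobject.factorThru_arrow_assoc]

/-- The step `j + 1` of the filtration is generated by words of weight at most `j`. Those of smaller
weight die in the `j`-th piece, so the words of weight exactly `j` generate it. -/
lemma grSym_hom_eq_zero {Z : C} (z : grSym S n ⟶ Z)
    (h : ∀ w : Fin n → Bool, wordToGr w ≫ z = 0) : z = 0 := by
  apply biproduct.hom_ext'
  intro j
  refine Eq.trans ?_ comp_zero.symm
  change grSymι S n j ≫ z = 0
  have : Epi (grSymPieceπ S n j) := inferInstanceAs (Epi (cokernel.π _))
  rw [← cancel_epi (grSymPieceπ S n j), comp_zero]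
  apply filtSym_hom_eq_zero
  intro w hw
  obtain hw' | hw' := (Nat.lt_succ_iff.1 hw).lt_or_eq
  · have h0 := toGr_eq_zero (S := S) j j.2 _ (filtSym_factors_word w hw)
      (filtSym_factors_word w hw')
    unfold toGr at h0
    simpa using h0 =≫ z
  · have h0 := (toGr_congr (weight_lt w) j.2 (filtSym_factors_word (S := S) w
      (weight w).lt_succ_self) (filtSym_factors_word w hw) hw' rfl).symm =≫ z
    have h1 := h0.trans (h w)
    unfold toGr at h1
    simpa using h1

variable [MonoidalPreadditive C] [RightExactTensor C]

/-- By `theta_spec` the image of `θ` contains the class of each word, and these classes generate the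
target. -/
lemma epi_theta (hS : S.ShortExact) (n : ℕ) : Epi (theta hS n) := by
  refine Preadditive.epi_of_cancel_zero _ (fun z hz => grSym_hom_eq_zero z (fun w => ?_))
  rw [← theta_spec hS w, Category.assoc, Category.assoc, hz, comp_zero, comp_zero]

end

/-! ### Tensor powers and symmetric powers under braided functors -/

section
variable {C : Type u} [Category.{v} C] [MonoidalCategory C]

/-- The comparison morphism between the tensor product of the `F X i` and `F` of the tensor
product of the `X i`. -/
def tensorFamIso {D : Type w₁} [Category.{w₂} D] [MonoidalCategory D] (F : C ⥤ D) [F.Monoidal] :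
    (n : ℕ) → (X : Fin n → C) → (tensorFam n (fun i => F.obj (X i)) ≅ F.obj (tensorFam n X))
  | 0, _ => Functor.Monoidal.εIso F
  | n + 1, X => whiskerRightIso (tensorFamIso F n (fun i => X i.castSucc)) (F.obj (X (Fin.last n)))
      ≪≫ Functor.Monoidal.μIso F _ _

variable {D : Type w₁} [Category.{w₂} D] [MonoidalCategory D] (F : C ⥤ D)

lemma tensorFamIso_succ_hom [F.Monoidal] (n : ℕ) (X : Fin (n + 1) → C) :
    (tensorFamIso F (n + 1) X).hom =
      (tensorFamIso F n (fun i => X i.castSucc)).hom ▷ F.obj (X (Fin.last n)) ≫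
        Functor.LaxMonoidal.μ F _ _ := rfl

lemma tensorFamIso_naturality [F.Monoidal] {n : ℕ} {X Y : Fin n → C} (f : ∀ i, X i ⟶ Y i) :
    (tensorFamIso F n X).hom ≫ F.map (tensorFamMap n f) =
      tensorFamMap n (fun i => F.map (f i)) ≫ (tensorFamIso F n Y).hom := by
  induction n with
  | zero =>
    exact ((congrArg ((tensorFamIso F 0 X).hom ≫ ·) (F.map_id (𝟙_ C))).trans
      (Category.comp_id _)).trans (Category.id_comp (Functor.LaxMonoidal.ε F)).symm
  | succ n ih =>
    change _ ≫ F.map (tensorFamMap n (fun i => f i.castSucc) ⊗ₘ f (Fin.last n)) =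
      (tensorFamMap n (fun i => F.map (f i.castSucc)) ⊗ₘ F.map (f (Fin.last n))) ≫ _
    rw [tensorFamIso_succ_hom, tensorFamIso_succ_hom, Category.assoc,
      ← Functor.LaxMonoidal.μ_natural, ← tensorHom_id, ← tensorHom_id,
      tensorHom_comp_tensorHom_assoc, tensorHom_comp_tensorHom_assoc, ih, Category.id_comp,
      Category.comp_id]

/-- By associativity of the tensorator the comparison morphism can be bracketed so that the
tensorator of the last two factors appears; this tensorator intertwines the two braidings. -/
lemma map_swap [BraidedCategory C] [BraidedCategory D] [F.Braided] {Q : D} {P X : C}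
    (p : Q ⟶ F.obj P) :
    ((p ▷ F.obj X ≫ Functor.LaxMonoidal.μ F P X) ▷ F.obj X ≫ Functor.LaxMonoidal.μ F (P ⊗ X) X) ≫
        F.map ((α_ P X X).hom ≫ P ◁ (β_ X X).hom ≫ (α_ P X X).inv) =
      ((α_ Q (F.obj X) (F.obj X)).hom ≫ Q ◁ (β_ (F.obj X) (F.obj X)).hom ≫
        (α_ Q (F.obj X) (F.obj X)).inv) ≫
      ((p ▷ F.obj X ≫ Functor.LaxMonoidal.μ F P X) ▷ F.obj X ≫
        Functor.LaxMonoidal.μ F (P ⊗ X) X) := by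
  have h1 : (p ▷ F.obj X ≫ Functor.LaxMonoidal.μ F P X) ▷ F.obj X ≫
        Functor.LaxMonoidal.μ F (P ⊗ X) X =
      (α_ _ _ _).hom ≫ p ▷ _ ≫ F.obj P ◁ Functor.LaxMonoidal.μ F X X ≫
        Functor.LaxMonoidal.μ F _ _ ≫ F.map (α_ P X X).inv := by
    rw [Functor.LaxMonoidal.associativity_inv F P X X]
    simp
  rw [h1]
  simp only [Category.assoc, F.map_comp, Iso.inv_hom_id_assoc, Iso.map_inv_hom_id_assoc]
  rw [← Functor.LaxMonoidal.μ_natural_right_assoc, ← whiskerLeft_comp_assoc,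
    Functor.LaxBraided.braided, whisker_exchange_assoc, whiskerLeft_comp_assoc]

lemma map_whiskerRight_of_comm [F.LaxMonoidal] {Q : D} {P X : C} (p : Q ⟶ F.obj P) (f : P ⟶ P)
    (g : Q ⟶ Q) (h : p ≫ F.map f = g ≫ p) :
    (p ▷ F.obj X ≫ Functor.LaxMonoidal.μ F P X) ≫ F.map (f ▷ X) =
      g ▷ F.obj X ≫ p ▷ F.obj X ≫ Functor.LaxMonoidal.μ F P X := by
  rw [Category.assoc, ← Functor.LaxMonoidal.μ_natural_left, ← comp_whiskerRight_assoc, h,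
    comp_whiskerRight_assoc]

lemma tensorFamIso_adjSwap [BraidedCategory C] [BraidedCategory D] [F.Braided] (X : C) (n i : ℕ) :
    (tensorFamIso F n (fun _ => X)).hom ≫ F.map (adjSwap X n i) =
      adjSwap (F.obj X) n i ≫ (tensorFamIso F n (fun _ => X)).hom := by
  induction n with
  | zero => exact tensorFamIso_naturality F (n := 0) (X := fun _ => X) (fun _ => 𝟙 X)
  | succ n ih =>
    obtain _ | n := n
    · exact ((congrArg ((tensorFamIso F 1 fun _ => X).hom ≫ ·) (F.map_id _)).trans
        (Category.comp_id _)).trans (Category.id_comp _).symm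
    · by_cases hi : i = n
      · rw [hi, adjSwap_last, adjSwap_last]
        exact map_swap F _
      · rw [adjSwap_of_ne X hi, adjSwap_of_ne (F.obj X) hi]
        exact map_whiskerRight_of_comm F _ _ _ ih

end

section
variable {C : Type u} [Category.{v} C] [Abelian C] {D : Type w₁} [Category.{w₂} D]
  [Preadditive D] (F : C ⥤ D) [F.Additive] [PreservesFiniteColimits F]
attribute [local instance] Abelian.hasFiniteBiproducts

/-- The morphism from the finite direct sum of the `X i` to `Y` is an epimorphism, and `F` preserves
it by right exactness. Thus morphisms out of `F Y` can still be tested on the family `f`; this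
replaces exactness on the left, which `F` need not have. -/
lemma map_hom_eq_zero {ι : Type} [Fintype ι] {X : ι → C} {Y : C} (f : ∀ i, X i ⟶ Y)
    (hf : ∀ {Z : C} (a : Y ⟶ Z), (∀ i, f i ≫ a = 0) → a = 0) {Z : D} (a : F.obj Y ⟶ Z)
    (ha : ∀ i, F.map (f i) ≫ a = 0) : a = 0 := by
  have h : Epi (biproduct.desc f) := Preadditive.epi_of_cancel_zero _ (fun z hz => hf z (fun i => by
    rw [← biproduct.ι_desc f i, Category.assoc, hz, comp_zero]))
  rw [← cancel_epi (F.map (biproduct.desc f)), comp_zero, biproduct.desc_eq, F.map_sum,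
    Preadditive.sum_comp]
  refine Finset.sum_eq_zero (fun i _ => ?_)
  rw [F.map_comp, Category.assoc, ha, comp_zero]

end

section
variable {C : Type u} [Category.{v} C] [Abelian C] [MonoidalCategory C] [SymmetricCategory C]
  {D : Type w₁} [Category.{w₂} D] [Preadditive D] [MonoidalCategory D] [SymmetricCategory D]
  (F : C ⥤ D) [F.Additive] [PreservesFiniteColimits F] [F.Braided]
attribute [local instance] Abelian.hasFiniteBiproducts

/-- A right exact functor preserves the cokernel which defines `Symⁿ`. The target is only required
to be preadditive, so that the lemma applies to the embedding of `T` into `Ind T`. -/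
lemma map_symPow_desc {n : ℕ} {X : C} {Z : D} (f : tensorPow n (F.obj X) ⟶ Z)
    (hf : ∀ i : Fin (n - 1), adjSwap (F.obj X) n i ≫ f = f) : ∃ g : F.obj (symPow n X) ⟶ Z,
      F.map (symPowπ n X) ≫ g = (tensorFamIso F n (fun _ => X)).inv ≫ f := by
  have h0 : F.map (biproduct.desc (fun i : Fin (n - 1) => adjSwap X n i - 𝟙 (tensorPow n X))) ≫
      (tensorFamIso F n (fun _ => X)).inv ≫ f = 0 := by
    refine map_hom_eq_zero F (biproduct.ι (fun _ : Fin (n - 1) => tensorPow n X))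
      (fun a ha => biproduct.hom_ext' _ _ (fun i => (ha i).trans comp_zero.symm)) _ (fun i => ?_)
    rw [← F.map_comp_assoc, biproduct.ι_desc, F.map_sub, Preadditive.sub_comp, sub_eq_zero,
      CategoryTheory.Functor.map_id, Category.id_comp,
      ← cancel_epi (tensorFamIso F n (fun _ => X)).hom, ← Category.assoc, tensorFamIso_adjSwap]
    simp [hf]
  obtain ⟨g, hg⟩ := CokernelCofork.IsColimit.desc' (CokernelCofork.mapIsColimit _
    (cokernelIsCokernel (biproduct.desc
      (fun i : Fin (n - 1) => adjSwap X n i - 𝟙 (tensorPow n X)))) F) _ h0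
  exact ⟨g, hg⟩

end

/-! ### A retraction of `F θ` from a splitting of `F Σ` -/

section
variable {C : Type u} [Category.{v} C] [Abelian C] [MonoidalCategory C] [SymmetricCategory C]
  {D : Type w₁} [Category.{w₂} D] [Abelian D] [MonoidalCategory D] [SymmetricCategory D]
  (F : C ⥤ D) [F.Additive] [PreservesFiniteColimits F] [F.Braided]
attribute [local instance] Abelian.hasFiniteBiproducts

/-- The projection of the associated graded object onto the `j`-th piece. -/
def grSymProj (S : ShortComplex C) (n : ℕ) (j : Fin (n + 1)) : grSym S n ⟶ grSymPiece S n j :=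
  biproduct.π (fun j : Fin (n + 1) => grSymPiece S n j) j

lemma grSymι_proj_self (S : ShortComplex C) (n : ℕ) (j : Fin (n + 1)) :
    grSymι S n j ≫ grSymProj S n j = 𝟙 _ :=
  biproduct.ι_π_self _ _

lemma grSymι_proj_ne (S : ShortComplex C) (n : ℕ) {j j' : Fin (n + 1)} (h : j ≠ j') :
    grSymι S n j ≫ grSymProj S n j' = 0 :=
  biproduct.ι_π_ne _ h

variable {S : ShortComplex C}

/-- The components `F V ⟶ F U ⟶ F (U ⊞ W)` and `F V ⟶ F W ⟶ F (U ⊞ W)` of the isomorphism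
given by a splitting. -/
def splitProj (r : F.obj S.X₂ ⟶ F.obj S.X₁) : Bool → (F.obj S.X₂ ⟶ F.obj (S.X₁ ⊞ S.X₃))
  | false => r ≫ F.map biprod.inl
  | true => F.map S.g ≫ F.map biprod.inr

lemma letterToMid_splitProj {r : F.obj S.X₂ ⟶ F.obj S.X₁} (hr : F.map S.f ≫ r = 𝟙 _) (b : Bool) :
    F.map (letterToMid S b) ≫ splitProj F r b = F.map (letterToGr S b) := by
  cases b
  · change F.map S.f ≫ r ≫ F.map biprod.inl = F.map biprod.inl
    rw [reassoc_of% hr]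
  · change F.map (𝟙 _) ≫ F.map S.g ≫ F.map biprod.inr = F.map (S.g ≫ biprod.inr)
    rw [CategoryTheory.Functor.map_id, Category.id_comp, F.map_comp]

lemma letterToMid_splitProj_eq_zero (r : F.obj S.X₂ ⟶ F.obj S.X₁) {b c : Bool} (hb : b = false)
    (hc : c = true) : F.map (letterToMid S b) ≫ splitProj F r c = 0 := by
  subst hb hc
  change F.map S.f ≫ F.map S.g ≫ F.map biprod.inr = 0
  rw [← F.map_comp_assoc, S.zero, F.map_zero, zero_comp]

/-- Otherwise the letters `V` of `w` occur among those of `w'`, and comparing cardinalities gives `w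
= w'`. This is the source of the triangularity in `word_powProj`. -/
lemma exists_of_weight_le {n : ℕ} {w w' : Fin n → Bool} (hw : w ≠ w') (h : weight w' ≤ weight w) :
    ∃ i, w' i = false ∧ w i = true := by
  by_contra! hne
  have hs : Finset.univ.filter (fun i => w i = true) ⊆
      Finset.univ.filter (fun i => w' i = true) := by
    intro i hi
    simp only [Finset.mem_filter, Finset.mem_univ, true_and] at hi ⊢
    by_contra h'
    exact hne i (by simpa using h') hi
  have he := Finset.eq_of_subset_of_card_le hs h
  refine hw (funext fun i => Bool.eq_iff_iff.2 ?_)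
  have := Finset.ext_iff.1 he i
  simpa only [Finset.mem_filter, Finset.mem_univ, true_and] using this

variable [MonoidalPreadditive D] {n : ℕ}

/-- The sum over the words of weight `j` of the projections of `F V ⊗ ⋯ ⊗ F V` onto the
corresponding summands, mapped to `F (Symⁿ (U ⊞ W))`. -/
def powProj (r : F.obj S.X₂ ⟶ F.obj S.X₁) (n j : ℕ) :
    tensorPow n (F.obj S.X₂) ⟶ F.obj (symPow n (S.X₁ ⊞ S.X₃)) :=
  ∑ w : Fin n → Bool, if weight w = j then tensorFamMap n (fun i => splitProj F r (w i)) ≫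
    (tensorFamIso F n (fun _ => S.X₁ ⊞ S.X₃)).hom ≫ F.map (symPowπ n (S.X₁ ⊞ S.X₃)) else 0

/-- A braiding permutes the words and preserves their weight, so it permutes the summands; in the
target it is absorbed by the projection to the symmetric power. -/
lemma adjSwap_powProj (r : F.obj S.X₂ ⟶ F.obj S.X₁) (j : ℕ) (i : Fin (n - 1)) :
    adjSwap (F.obj S.X₂) n i ≫ powProj F r n j = powProj F r n j := by
  obtain ⟨σ, hσ⟩ := adjSwap_naturality (C := D) n i
  unfold powProj
  rw [Preadditive.comp_sum, ← (Equiv.arrowCongr σ.symm (Equiv.refl Bool)).sum_comp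
    (fun w => if weight w = j then _ else 0)]
  refine Finset.sum_congr rfl (fun w _ => ?_)
  have h1 : weight ((Equiv.arrowCongr σ.symm (Equiv.refl Bool)) w) = weight w :=
    weight_comp_perm w σ
  rw [h1]
  split_ifs
  · rw [← Category.assoc, hσ, Category.assoc, ← Category.assoc (adjSwap _ _ _),
      ← tensorFamIso_adjSwap, Category.assoc, ← F.map_comp, adjSwap_symPowπ]
    rfl
  · exact comp_zero

/-- A word `w' ≠ w` of weight `j ≥ weight w` has a letter `V` where `w` has a letter `U`. In that
position the composite is `F U ⟶ F V ⟶ F W`, which is zero. Only the summand of `w` survives. -/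
lemma word_powProj {r : F.obj S.X₂ ⟶ F.obj S.X₁} (hr : F.map S.f ≫ r = 𝟙 _) {j : ℕ}
    (w : Fin n → Bool) (hw : weight w ≤ j) :
    tensorFamMap n (fun i => F.map (letterToMid S (w i))) ≫ powProj F r n j =
      if weight w = j then tensorFamMap n (fun i => F.map (letterToGr S (w i))) ≫
        (tensorFamIso F n (fun _ => S.X₁ ⊞ S.X₃)).hom ≫ F.map (symPowπ n (S.X₁ ⊞ S.X₃))
      else 0 := by
  unfold powProj
  rw [Preadditive.comp_sum, Finset.sum_eq_single w]
  · split_ifs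
    · rw [← Category.assoc, tensorFamMap_comp]
      congr 2
      exact funext fun i => letterToMid_splitProj F hr (w i)
    · exact comp_zero
  · intro w' _ hne
    split_ifs with h
    · obtain ⟨i, h1, h2⟩ := exists_of_weight_le hne (hw.trans h.ge)
      rw [← Category.assoc, tensorFamMap_comp, tensorFamMap_eq_zero _ i
        (letterToMid_splitProj_eq_zero F r h1 h2), zero_comp]
    · exact comp_zero
  · exact fun h => absurd (Finset.mem_univ _) h

/-- The morphism induced by `powProj` on `F (Symⁿ V)` is zero on words of weight less than `j`, so
its restriction to the step `j + 1` factors through the image under `F` of the `j`-th piece. -/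
lemma exists_filtSym_proj {r : F.obj S.X₂ ⟶ F.obj S.X₁} (hr : F.map S.f ≫ r = 𝟙 _) (j : ℕ) :
    ∃ l : F.obj (grSymPiece S n j) ⟶ F.obj (symPow n (S.X₁ ⊞ S.X₃)),
      ∀ w : Fin n → Bool, ∀ h : weight w = j,
        F.map ((filtSym S n (j + 1)).factorThru _ (filtSym_factors_word w (h.trans_lt j.lt_succ_self))
          ≫ grSymPieceπ S n j) ≫ l =
        F.map (tensorFamMap n (fun i => letterToGr S (w i)) ≫ symPowπ n (S.X₁ ⊞ S.X₃)) := by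
  obtain ⟨m, hm⟩ := map_symPow_desc F (powProj F r n j) (adjSwap_powProj F r j)
  have hw : ∀ w : Fin n → Bool, weight w ≤ j →
      F.map (tensorFamMap n (fun i => letterToMid S (w i)) ≫ symPowπ n S.X₂) ≫ m =
        if weight w = j then
          F.map (tensorFamMap n (fun i => letterToGr S (w i)) ≫ symPowπ n (S.X₁ ⊞ S.X₃)) else 0 := by
    intro w hw
    rw [F.map_comp, Category.assoc, hm, ← cancel_epi (tensorFamIso F n _).hom, ← Category.assoc,
      tensorFamIso_naturality, Category.assoc, Iso.hom_inv_id_assoc, word_powProj F hr w hw]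
    split_ifs
    · rw [F.map_comp, ← Category.assoc, ← Category.assoc, tensorFamIso_naturality]
    · exact comp_zero.symm
  have h0 : F.map (Subobject.ofLE (filtSym S n j) (filtSym S n (j + 1))
      (filtSym_mono S n j.le_succ)) ≫ F.map (filtSym S n (j + 1)).arrow ≫ m = 0 := by
    rw [← F.map_comp_assoc, Subobject.ofLE_arrow]
    -- The words of weight less than `j` generate the step `j`, also after `F` is applied.
    refine map_hom_eq_zero F (ι := {w : Fin n → Bool // weight w < j})
      (fun w => (filtSym S n j).factorThru _ (filtSym_factors_word w.1 w.2))
      (fun a ha => filtSym_hom_eq_zero a (fun w hw => ha ⟨w, hw⟩)) _ (fun w => ?_)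
    rw [← F.map_comp_assoc, Subobject.factorThru_arrow, hw _ w.2.le, if_neg w.2.ne]
  obtain ⟨l, hl'⟩ : ∃ l : F.obj (grSymPiece S n j) ⟶ F.obj (symPow n (S.X₁ ⊞ S.X₃)),
      F.map (grSymPieceπ S n j) ≫ l = F.map (filtSym S n (j + 1)).arrow ≫ m := by
    obtain ⟨l, hl⟩ := CokernelCofork.IsColimit.desc' (CokernelCofork.mapIsColimit _
      (cokernelIsCokernel (Subobject.ofLE (filtSym S n j) (filtSym S n (j + 1))
        (filtSym_mono S n j.le_succ))) F) _ h0
    exact ⟨l, hl⟩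
  refine ⟨l, fun w h => ?_⟩
  rw [F.map_comp, Category.assoc, hl', ← F.map_comp_assoc, Subobject.factorThru_arrow, hw w h.le,
    if_pos h]

variable [MonoidalPreadditive C] [RightExactTensor C]

/-- The retraction is the sum over `j` of the morphisms from `exists_filtSym_proj` on the pieces of
the graded object. It is checked on words, where `theta_spec` describes `θ`; only the piece in
degree `weight w` contributes. A splitting of this one sequence suffices. -/
lemma isSplitMono_map_theta (hS : S.ShortExact) {r : F.obj S.X₂ ⟶ F.obj S.X₁} 
    (hr : F.map S.f ≫ r = 𝟙 _) (n : ℕ) :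
    IsSplitMono (F.map (theta hS n)) := by
  choose l hl using fun j => exists_filtSym_proj (n := n) F hr j
  refine ⟨⟨⟨∑ j : Fin (n + 1), F.map (grSymProj S n j) ≫ l j, ?_⟩⟩⟩
  rw [← sub_eq_zero, ← cancel_epi (F.map (symPowπ n (S.X₁ ⊞ S.X₃))), comp_zero]
  refine map_hom_eq_zero F (fun w : Fin n → Bool => tensorFamMap n (fun i => letterToGr S (w i)))
    (fun a ha => grPow_hom_ext hS (fun w => (ha w).trans comp_zero.symm)) _ (fun w => ?_)
  rw [Preadditive.comp_sub, Preadditive.comp_sub, sub_eq_zero, Category.comp_id,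
    ← F.map_comp_assoc, ← F.map_comp_assoc, Category.assoc, theta_spec, ← F.map_comp,
    ← hl _ w rfl, Preadditive.comp_sum, Finset.sum_eq_single ⟨weight w, weight_lt w⟩]
  · rw [← F.map_comp_assoc]
    unfold wordToGr toGr
    rw [Category.assoc, Category.assoc, grSymι_proj_self, Category.comp_id]
  · intro j _ hj
    rw [← F.map_comp_assoc]
    unfold wordToGr toGr
    rw [Category.assoc, Category.assoc, grSymι_proj_ne _ _ hj.symm, comp_zero, comp_zero,
      F.map_zero, zero_comp]
  · exact fun h => absurd (Finset.mem_univ _) h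

end

/-! ### Functors which split all short exact sequences reflect monomorphisms -/

section
variable {T : Type u} [Category.{v} T] [Abelian T] [MonoidalCategory T] [SymmetricCategory T]
  [MonoidalPreadditive T] [RightExactTensor T] [RigidConnected T]
  {D : Type w₁} [Category.{w₂} D] [Abelian D] [MonoidalCategory D] [MonoidalPreadditive D]
  (F : T ⥤ D) [F.Additive] [F.Monoidal]

lemma exists_retraction_of_splitting {S : ShortComplex T} (s : (S.map F).Splitting) :
    ∃ r : F.obj S.X₂ ⟶ F.obj S.X₁, F.map S.f ≫ r = 𝟙 _ :=
  ⟨s.r, s.f_r⟩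

lemma mono_map_of_splitting
    (hF : ∀ S : ShortComplex T, S.ShortExact → Nonempty (S.map F).Splitting)
    {X Y : T} (f : X ⟶ Y) [Mono f] : Mono (F.map f) := by
  obtain ⟨s⟩ := hF (ShortComplex.mk f (cokernel.π f) (cokernel.condition f))
    { exact := ShortComplex.exact_of_g_is_cokernel _ (cokernelIsCokernel f) }
  obtain ⟨r, hr⟩ := exists_retraction_of_splitting F s
  exact (SplitMono.mk r hr).mono

/-- If the coevaluation of `X` is zero, then so is `X`, by a snake relation. If not, it is a
monomorphism by simplicity of the unit, and `F` maps it to a monomorphism from the unit of `D` to `F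
X ⊗ F Y = 0`. -/
lemma isZero_of_isZero_map
    (hF : ∀ S : ShortComplex T, S.ShortExact → Nonempty (S.map F).Splitting)
    (h1 : ¬ IsZero (𝟙_ D)) {X : T} (hX : IsZero (F.obj X)) : IsZero X := by
  obtain ⟨Y, ⟨_⟩⟩ := RigidConnected.exists_dual X
  by_cases h0 : η_ X Y = 0
  · have h2 := ExactPairing.evaluation_coevaluation X Y
    rw [h0, MonoidalPreadditive.zero_whiskerRight, zero_comp] at h2
    rw [IsZero.iff_id_eq_zero, ← cancel_mono (ρ_ X).inv, ← cancel_epi (λ_ X).hom]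
    simp [← h2]
  · have := RigidConnected.mono_of_ne_zero _ h0
    have := mono_map_of_splitting F hF (η_ X Y)
    have h2 : IsZero (F.obj X ⊗ F.obj Y) := by
      rw [IsZero.iff_id_eq_zero, ← id_tensorHom_id, (IsZero.iff_id_eq_zero _).1 hX,
        MonoidalPreadditive.zero_tensor]
    have h3 : IsZero (F.obj (X ⊗ Y)) := h2.of_iso (Functor.Monoidal.μIso F X Y).symm
    exact absurd ((IsZero.of_mono (F.map (η_ X Y)) h3).of_iso (Functor.Monoidal.εIso F)) h1

/-- `F` of the kernel inclusion is a monomorphism, and it is zero because `F f` is a monomorphism.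
So `F` kills the kernel, which is then zero. -/
lemma mono_of_mono_map
    (hF : ∀ S : ShortComplex T, S.ShortExact → Nonempty (S.map F).Splitting)
    (h1 : ¬ IsZero (𝟙_ D)) {X Y : T} (f : X ⟶ Y) [Mono (F.map f)] : Mono f := by
  have := mono_map_of_splitting F hF (kernel.ι f)
  have h : F.map (kernel.ι f) = 0 := by
    rw [← cancel_mono (F.map f), ← F.map_comp, kernel.condition, F.map_zero, zero_comp]
  exact Preadditive.mono_of_isZero_kernel f
    (isZero_of_isZero_map F hF h1 (IsZero.of_mono_eq_zero _ h))

end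

/-- The morphisms `θ` are isomorphisms if there is a tensor functor which splits all short exact
sequences. -/
theorem isIso_theta_of_locallySemisimple {k : Type w} [Field k] {T : Type u} [Category.{v} T]
    [Abelian T] [Linear k T] [MonoidalCategory T] [SymmetricCategory T] [MonoidalPreadditive T]
    [RightExactTensor T] [RigidConnected T] (h : LocallySemisimple.{w₁, w₂} k T)
    {S : ShortComplex T} (hS : S.ShortExact) (n : ℕ) : IsIso (theta hS n) := by
  obtain ⟨D, _, _, _, _, _, _, _, _, h1, F, _, _, _, _, hF⟩ := h
  obtain ⟨r, hr⟩ := exists_retraction_of_splitting F (hF S hS).some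
  have := isSplitMono_map_theta F hS hr n
  have := mono_of_mono_map F hF h1 (theta hS n)
  have := epi_theta hS n
  exact isIso_of_mono_of_epi _

/-! ### Powers of morphisms from the unit object -/

section
variable {C : Type u} [Category.{v} C] [MonoidalCategory C]

lemma isIso_unitTensorPow_id (n : ℕ) : IsIso (unitTensorPow (𝟙 (𝟙_ C)) n) := by
  induction n with
  | zero => exact inferInstanceAs (IsIso (𝟙 (𝟙_ C)))
  | succ n ih => exact inferInstanceAs (IsIso ((λ_ (𝟙_ C)).inv ≫ (unitTensorPow _ n ⊗ₘ 𝟙 (𝟙_ C))))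

lemma unitTensorPow_comp {X Y : C} (α : 𝟙_ C ⟶ X) (f : X ⟶ Y) (n : ℕ) :
    unitTensorPow (α ≫ f) n = unitTensorPow α n ≫ tensorFamMap n (fun _ => f) := by
  induction n with
  | zero => exact (Category.id_comp _).symm
  | succ n ih =>
    change (λ_ (𝟙_ C)).inv ≫ (unitTensorPow (α ≫ f) n ⊗ₘ (α ≫ f)) =
      ((λ_ (𝟙_ C)).inv ≫ (unitTensorPow α n ⊗ₘ α)) ≫ (tensorFamMap n (fun _ => f) ⊗ₘ f)
    rw [Category.assoc, tensorHom_comp_tensorHom, ih]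

lemma unitTensorPow_eq {X : C} (α : 𝟙_ C ⟶ X) (n : ℕ) :
    unitTensorPow α n = unitTensorPow (𝟙 _) n ≫ tensorFamMap n (fun _ => α) := by
  rw [← unitTensorPow_comp, Category.id_comp]

lemma adjSwap_unit [BraidedCategory C] (n i : ℕ) : adjSwap (𝟙_ C) n i = 𝟙 _ := by
  induction n with
  | zero => rfl
  | succ n ih =>
    obtain _ | n := n
    · rfl
    · by_cases hi : i = n
      · have h : (β_ (𝟙_ C) (𝟙_ C)).hom = 𝟙 _ := by
          rw [braiding_tensorUnit_left, unitors_equal, Iso.hom_inv_id]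
        have h' : ∀ P : C, (α_ P (𝟙_ C) (𝟙_ C)).hom ≫ P ◁ (β_ (𝟙_ C) (𝟙_ C)).hom ≫
            (α_ P (𝟙_ C) (𝟙_ C)).inv = 𝟙 _ := fun P => by rw [h]; simp
        rw [hi, adjSwap_last]
        exact h' _
      · rw [adjSwap_of_ne _ hi, ih]
        exact id_whiskerRight _ _

end

section
variable {T : Type u} [Category.{v} T] [Abelian T] [MonoidalCategory T] [SymmetricCategory T]
  [MonoidalPreadditive T] [RightExactTensor T] [RigidConnected T]
attribute [local instance] Abelian.hasFiniteBiproducts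

/-- The `n`-th power of a split monomorphism is not zero in the symmetric power. -/
lemma symPowElement_ne_zero_of_retraction {X : T} (α : 𝟙_ T ⟶ X) (r : X ⟶ 𝟙_ T) (h : α ≫ r = 𝟙 _)
    (n : ℕ) : symPowElement α n ≠ 0 := by
  intro h0
  have := isIso_unitTensorPow_id (C := T) n
  -- The braidings of the factors `𝟙` are trivial, so `r^{⊗ n}` is symmetric. The morphism it
  -- induces on `Symⁿ X` splits the `n`-th power of `α`.
  obtain ⟨g, hg⟩ := symPow_desc (n := n)
      (tensorFamMap n (fun _ => r) ≫ inv (unitTensorPow (𝟙 (𝟙_ T)) n))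
    (fun i => by
      obtain ⟨σ, hσ⟩ := adjSwap_naturality (C := T) n i
      rw [← Category.assoc, hσ, adjSwap_unit, Category.comp_id])
  have h1 : symPowElement α n ≫ g = 𝟙 _ := by
    unfold symPowElement
    rw [Category.assoc, hg, ← Category.assoc, ← unitTensorPow_comp, h, IsIso.hom_inv_id]
  rw [h0, zero_comp] at h1
  exact RigidConnected.id_unit_ne_zero (T := T) h1.symm

/-- If the morphisms `θ` are isomorphisms, then the powers of `α ≠ 0` are not zero. -/
theorem symPowElement_ne_zero_of_isIso_theta
    (h : ∀ (S : ShortComplex T) (hS : S.ShortExact) (n : ℕ), IsIso (theta hS n))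
    {X : T} (n : ℕ) (α : 𝟙_ T ⟶ X) (hα : α ≠ 0) : symPowElement α n ≠ 0 := by
  intro h0
  have := isIso_unitTensorPow_id (C := T) n
  have hS := RigidConnected.shortExact_of_ne_zero α hα
  have := h _ hS n
  have h1 : tensorFamMap n (fun _ => α) ≫ symPowπ n X = 0 := by
    rw [← cancel_epi (unitTensorPow (𝟙 (𝟙_ T)) n), ← Category.assoc, ← unitTensorPow_eq, comp_zero]
    exact h0
  -- The word `U ⋯ U` has weight `0`, and its class is given by `α^{⊗ n}` in `Symⁿ X`.
  have h2 : wordToGr (S := ShortComplex.mk α (cokernel.π α) (cokernel.condition α))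
      (fun _ : Fin n => false) = 0 := by
    refine toGr_eq_zero _ _ _ _ ?_
    have h3 : tensorFamMap n (fun _ => letterToMid (ShortComplex.mk α (cokernel.π α)
      (cokernel.condition α)) false) ≫ symPowπ n X = 0 := h1
    rw [h3]
    exact Subobject.factors_zero
  have h3 := theta_spec hS (fun _ : Fin n => false)
  rw [h2, ← Category.assoc] at h3
  -- Since `θ` is a monomorphism, the word `U ⋯ U` already vanishes in `Symⁿ (gr X)`. There `U = 𝟙`
  -- is a direct summand, a contradiction.
  have h4 : tensorFamMap n (fun _ => (biprod.inl : 𝟙_ T ⟶ 𝟙_ T ⊞ cokernel α)) ≫ symPowπ n _ = 0 :=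
    (cancel_mono (theta hS n)).1 (h3.trans zero_comp.symm)
  refine symPowElement_ne_zero_of_retraction (biprod.inl : 𝟙_ T ⟶ 𝟙_ T ⊞ cokernel α) biprod.fst
    biprod.inl_fst n ?_
  unfold symPowElement
  rw [unitTensorPow_eq, Category.assoc, h4, comp_zero]

end

/-! ### Generalized elements of ind-objects -/

section elements
variable {T : Type u} [Category.{v} T]

/-- The element of an ind-object `A` at `x` which belongs to a morphism `y x ⟶ A`. -/
def indElt {x : T} {A : Ind T} (a : Ind.yoneda.obj x ⟶ A) :
    ((Ind.inclusion T).obj A).obj (op x) :=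
  yonedaEquiv (Ind.yonedaCompInclusion.inv.app x ≫ (Ind.inclusion T).map a)

lemma indElt_comp {x : T} {A B : Ind T} (a : Ind.yoneda.obj x ⟶ A) (f : A ⟶ B) :
    indElt (a ≫ f) = ((Ind.inclusion T).map f).app (op x) (indElt a) := by
  unfold indElt
  rw [Functor.map_comp, ← Category.assoc, yonedaEquiv_comp]

lemma indElt_map_comp {x x' : T} {A : Ind T} (g : x' ⟶ x) (a : Ind.yoneda.obj x ⟶ A) :
    indElt (Ind.yoneda.map g ≫ a) = ((Ind.inclusion T).obj A).map g.op (indElt a) := by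
  unfold indElt
  rw [yonedaEquiv_naturality, Functor.map_comp]
  congr 1
  exact (NatTrans.naturality_assoc Ind.yonedaCompInclusion.inv g _).symm

variable (x : T) (A : Ind T) in
lemma indElt_bijective : Function.Bijective
    (indElt : (Ind.yoneda.obj x ⟶ A) → ((Ind.inclusion T).obj A).obj (op x)) := by
  refine yonedaEquiv.bijective.comp (Function.Bijective.comp
    (g := fun f => Ind.yonedaCompInclusion.inv.app x ≫ f) ?_
    (Ind.inclusion.fullyFaithful.map_bijective _ _))
  exact ((Ind.yonedaCompInclusion.symm.app x).homFromEquiv.symm).bijective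

/-- The morphism `y x ⟶ A` which belongs to an element of an ind-object. -/
def ofElt {x : T} {A : Ind T} (a : ((Ind.inclusion T).obj A).obj (op x)) :
    Ind.yoneda.obj x ⟶ A :=
  (Equiv.ofBijective _ (indElt_bijective x A)).symm a

lemma indElt_ofElt {x : T} {A : Ind T} (a : ((Ind.inclusion T).obj A).obj (op x)) :
    indElt (ofElt a) = a :=
  (Equiv.ofBijective _ (indElt_bijective x A)).apply_symm_apply a

/-- The legs of a presentation of an ind-object. -/
def leg {A : Ind T} (P : IndObjectPresentation ((Ind.inclusion T).obj A)) (i : P.I) :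
    Ind.yoneda.obj (P.F.obj i) ⟶ A :=
  ofElt (gen P i)

lemma map_leg {A : Ind T} (P : IndObjectPresentation ((Ind.inclusion T).obj A)) {i j : P.I}
    (f : i ⟶ j) : Ind.yoneda.map (P.F.map f) ≫ leg P j = leg P i := by
  apply (indElt_bijective _ _).1
  rw [indElt_map_comp, leg, leg, indElt_ofElt, indElt_ofElt, gen_map]

/-- A morphism from an object of `T` to a filtered colimit factors through one of the stages. -/
lemma exists_leg {A : Ind T} (P : IndObjectPresentation ((Ind.inclusion T).obj A)) {x : T}
    (a : Ind.yoneda.obj x ⟶ A) : ∃ (i : P.I) (u : x ⟶ P.F.obj i),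
      a = Ind.yoneda.map u ≫ leg P i := by
  obtain ⟨i, u, h⟩ := gen_surj P x (indElt a)
  refine ⟨i, u, (indElt_bijective _ _).1 ?_⟩
  rw [indElt_map_comp, leg, indElt_ofElt, h]

end elements

/-! ### The tensor product of ind-objects in terms of elements -/

section pairings
variable {T : Type u} [Category.{v} T] [EssentiallySmall.{v} T] [MonoidalCategory T]
open LawfulDayConvolutionMonoidalCategoryStruct

/-- The morphism `y (x ⊗ x') ⟶ A ⊗ B` given by `y x ⟶ A` and `y x' ⟶ B`. -/
def boxHom {x x' : T} {A B : Ind T} (a : Ind.yoneda.obj x ⟶ A) (b : Ind.yoneda.obj x' ⟶ B) :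
    Ind.yoneda.obj (x ⊗ x') ⟶ A ⊗ B :=
  ofElt (pairing (convolutionExtensionUnit Tᵒᵖ (Type v) A B) (indElt a) (indElt b))

lemma indElt_boxHom {x x' : T} {A B : Ind T} (a : Ind.yoneda.obj x ⟶ A)
    (b : Ind.yoneda.obj x' ⟶ B) : indElt (boxHom a b) =
      pairing (convolutionExtensionUnit Tᵒᵖ (Type v) A B) (indElt a) (indElt b) :=
  indElt_ofElt _

lemma map_boxHom {x x' z z' : T} {A B : Ind T} (f : z ⟶ x) (g : z' ⟶ x')
    (a : Ind.yoneda.obj x ⟶ A) (b : Ind.yoneda.obj x' ⟶ B) :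
    Ind.yoneda.map (f ⊗ₘ g) ≫ boxHom a b =
      boxHom (Ind.yoneda.map f ≫ a) (Ind.yoneda.map g ≫ b) := by
  apply (indElt_bijective _ _).1
  rw [indElt_map_comp, indElt_boxHom, indElt_boxHom, indElt_map_comp, indElt_map_comp]
  exact (pairing_map _ f g _ _).symm

lemma boxHom_tensorHom {x x' : T} {A B A' B' : Ind T} (a : Ind.yoneda.obj x ⟶ A)
    (b : Ind.yoneda.obj x' ⟶ B) (f : A ⟶ A') (g : B ⟶ B') :
    boxHom a b ≫ (f ⊗ₘ g) = boxHom (a ≫ f) (b ≫ g) := by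
  apply (indElt_bijective _ _).1
  rw [indElt_comp, indElt_boxHom, indElt_boxHom, indElt_comp, indElt_comp]
  exact ConcreteCategory.congr_hom (convolutionExtensionUnit_comp_ι_map_tensorHom_app Tᵒᵖ (Type v)
    f g (op x) (op x')) ((indElt a, indElt b) :
      ((Ind.inclusion T).obj A).obj (op x) × ((Ind.inclusion T).obj B).obj (op x'))

lemma boxHom_associator {x x' x'' : T} {A B C : Ind T} (a : Ind.yoneda.obj x ⟶ A)
    (b : Ind.yoneda.obj x' ⟶ B) (c : Ind.yoneda.obj x'' ⟶ C) :
    boxHom (boxHom a b) c ≫ (α_ A B C).hom =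
      Ind.yoneda.map (α_ x x' x'').hom ≫ boxHom a (boxHom b c) := by
  apply (indElt_bijective _ _).1
  rw [indElt_comp, indElt_map_comp, indElt_boxHom, indElt_boxHom, indElt_boxHom, indElt_boxHom]
  exact ConcreteCategory.congr_hom (associator_hom_unit_unit (Type v) A B C
    (op x) (op x') (op x''))
    (((indElt a, indElt b), indElt c) : (((Ind.inclusion T).obj A).obj (op x) ×
      ((Ind.inclusion T).obj B).obj (op x')) × ((Ind.inclusion T).obj C).obj (op x''))

variable (T) in
/-- The unit `y 𝟙 ⟶ 𝟙`. -/
def unitLeg : Ind.yoneda.obj (𝟙_ T) ⟶ 𝟙_ (Ind T) :=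
  ofElt (unitUnit Tᵒᵖ (Type v) (Ind T) PUnit.unit)

lemma boxHom_leftUnitor {x : T} {A : Ind T} (a : Ind.yoneda.obj x ⟶ A) :
    boxHom (unitLeg T) a ≫ (λ_ A).hom = Ind.yoneda.map (λ_ x).hom ≫ a := by
  apply (indElt_bijective _ _).1
  rw [indElt_comp, indElt_map_comp, indElt_boxHom, unitLeg, indElt_ofElt]
  exact ConcreteCategory.congr_hom (leftUnitor_hom_unit_app (Type v) A
    (op x)) ((PUnit.unit, indElt a) : PUnit × ((Ind.inclusion T).obj A).obj (op x))

lemma boxHom_rightUnitor {x : T} {A : Ind T} (a : Ind.yoneda.obj x ⟶ A) :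
    boxHom a (unitLeg T) ≫ (ρ_ A).hom = Ind.yoneda.map (ρ_ x).hom ≫ a := by
  apply (indElt_bijective _ _).1
  rw [indElt_comp, indElt_map_comp, indElt_boxHom, unitLeg, indElt_ofElt]
  exact ConcreteCategory.congr_hom (rightUnitor_hom_unit_app (Type v) A
    (op x)) ((indElt a, PUnit.unit) : ((Ind.inclusion T).obj A).obj (op x) × PUnit)

lemma boxHom_braiding [SymmetricCategory T] {x x' : T} {A B : Ind T}
    (a : Ind.yoneda.obj x ⟶ A) (b : Ind.yoneda.obj x' ⟶ B) :
    boxHom a b ≫ (β_ A B).hom = Ind.yoneda.map (β_ x x').hom ≫ boxHom b a := by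
  apply (indElt_bijective _ _).1
  rw [indElt_comp, indElt_map_comp, indElt_boxHom, indElt_boxHom]
  change (((ι Tᵒᵖ (Type v) (Ind T)).map (indBraiding T A B).hom).app _) _ = _
  rw [ι_map_indBraiding]
  have := @DayConvolution.unit_app_braiding_hom_app Tᵒᵖ _ (Type v) _ _ _ _ _
    ((ι Tᵒᵖ (Type v) (Ind T)).obj A) ((ι Tᵒᵖ (Type v) (Ind T)).obj B)
    (convolution _ _ _ A B) (convolution _ _ _ B A) (op x) (op x')
  exact ConcreteCategory.congr_hom this ((indElt a, indElt b) :
      ((Ind.inclusion T).obj A).obj (op x) × ((Ind.inclusion T).obj B).obj (op x'))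

instance isLeftKanExtension_convolution (A B : Ind T) :
    ((ι Tᵒᵖ (Type v) (Ind T)).obj (A ⊗ B)).IsLeftKanExtension
      (convolutionExtensionUnit Tᵒᵖ (Type v) A B) :=
  (isPointwiseLeftKanExtensionConvolutionExtensionUnit A B).isLeftKanExtension

/-- The presheaf underlying `A ⊗ B` is a left Kan extension, so a morphism out of it is determined
by the pairing of elements to which it corresponds. -/
lemma tensor_hom_ext {A B C : Ind T} {f g : A ⊗ B ⟶ C}
    (h : ∀ (x x' : T) (a : Ind.yoneda.obj x ⟶ A) (b : Ind.yoneda.obj x' ⟶ B),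
      boxHom a b ≫ f = boxHom a b ≫ g) : f = g := by
  apply (Ind.inclusion T).map_injective
  apply Functor.hom_ext_of_isLeftKanExtension ((ι Tᵒᵖ (Type v) (Ind T)).obj (A ⊗ B))
    (convolutionExtensionUnit Tᵒᵖ (Type v) A B)
  ext X p
  have := congrArg indElt (h X.1.unop X.2.unop (ofElt p.1) (ofElt p.2))
  rw [indElt_comp, indElt_comp, indElt_boxHom, indElt_ofElt, indElt_ofElt] at this
  exact this

/-- A compatible family on two presentations is the same as a pairing of the two presheaves by
`exists_pairing`, and a pairing factors through the Kan extension. -/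
lemma exists_tensor_desc {A B C : Ind T} (P : IndObjectPresentation ((Ind.inclusion T).obj A))
    (Q : IndObjectPresentation ((Ind.inclusion T).obj B))
    (h : ∀ i j, Ind.yoneda.obj (P.F.obj i ⊗ Q.F.obj j) ⟶ C)
    (hc : ∀ {i i' : P.I} {j j' : Q.I} (f : i ⟶ i') (g : j ⟶ j'),
      Ind.yoneda.map (P.F.map f ⊗ₘ Q.F.map g) ≫ h i' j' = h i j) :
    ∃ φ : A ⊗ B ⟶ C, ∀ i j, boxHom (leg P i) (leg Q j) ≫ φ = h i j := by
  obtain ⟨α, hα⟩ := exists_pairing P Q ((Ind.inclusion T).obj C) (fun i j => indElt (h i j))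
    (fun f g => by rw [← indElt_map_comp, hc])
  refine ⟨Ind.inclusion.fullyFaithful.preimage
    (((ι Tᵒᵖ (Type v) (Ind T)).obj (A ⊗ B)).descOfIsLeftKanExtension
      (convolutionExtensionUnit Tᵒᵖ (Type v) A B) ((Ind.inclusion T).obj C) α), fun i j => ?_⟩
  apply (indElt_bijective _ _).1
  rw [indElt_comp, Ind.inclusion.fullyFaithful.map_preimage, ← hα, indElt_boxHom, leg, leg,
    indElt_ofElt, indElt_ofElt]
  exact ConcreteCategory.congr_hom (((ι Tᵒᵖ (Type v) (Ind T)).obj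
    (A ⊗ B)).descOfIsLeftKanExtension_fac_app
      (convolutionExtensionUnit Tᵒᵖ (Type v) A B) ((Ind.inclusion T).obj C) α
      (op (P.F.obj i), op (Q.F.obj j))) ((gen P i, gen Q j) :
        ((Ind.inclusion T).obj A).obj (op (P.F.obj i)) ×
          ((Ind.inclusion T).obj B).obj (op (Q.F.obj j)))

end pairings

/-! ### The symmetric monoidal embedding of `T` into `Ind T` -/

section monoidalYoneda
variable (T : Type u) [Category.{v} T] [EssentiallySmall.{v} T] [MonoidalCategory T]

/-- A representable ind-object is presented by a constant diagram. -/
def yonedaPresentation (x : T) :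
    IndObjectPresentation ((Ind.inclusion T).obj (Ind.yoneda.obj x)) :=
  (IndObjectPresentation.yoneda x).extend (Ind.yonedaCompInclusion.inv.app x)

variable {T}

lemma leg_yonedaPresentation (x : T) (i : (yonedaPresentation T x).I) :
    leg (yonedaPresentation T x) i = 𝟙 (Ind.yoneda.obj x) := by
  apply (indElt_bijective _ _).1
  rw [leg, indElt_ofElt]
  change yonedaEquiv (𝟙 _ ≫ Ind.yonedaCompInclusion.inv.app x) =
    yonedaEquiv (Ind.yonedaCompInclusion.inv.app x ≫ (Ind.inclusion T).map (𝟙 (Ind.yoneda.obj x)))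
  rw [CategoryTheory.Functor.map_id]
  exact congrArg yonedaEquiv ((Category.id_comp _).trans (Category.comp_id _).symm)

lemma exists_boxHom_desc {x x' : T} {C : Ind T} (h : Ind.yoneda.obj (x ⊗ x') ⟶ C) :
    ∃ φ : Ind.yoneda.obj x ⊗ Ind.yoneda.obj x' ⟶ C, boxHom (𝟙 _) (𝟙 _) ≫ φ = h := by
  obtain ⟨φ, hφ⟩ := exists_tensor_desc (yonedaPresentation T x) (yonedaPresentation T x')
    (fun _ _ => h) (fun f g => by
      refine Eq.trans (congrArg (· ≫ h) ?_) (Category.id_comp h)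
      refine (congrArg _ ?_).trans (CategoryTheory.Functor.map_id _ _)
      exact id_tensorHom_id _ _)
  refine ⟨φ, ?_⟩
  rw [← hφ ⟨PUnit.unit⟩ ⟨PUnit.unit⟩]
  congr 1
  exact (congrArg₂ boxHom (leg_yonedaPresentation x _) (leg_yonedaPresentation x' _)).symm

lemma boxHom_eq {x x' : T} {A B : Ind T} (a : Ind.yoneda.obj x ⟶ A)
    (b : Ind.yoneda.obj x' ⟶ B) : boxHom a b = boxHom (𝟙 _) (𝟙 _) ≫ (a ⊗ₘ b) := by
  rw [boxHom_tensorHom, Category.id_comp, Category.id_comp]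

lemma map_boxHom_id {x x' z z' : T} (f : z ⟶ x) (g : z' ⟶ x') :
    Ind.yoneda.map (f ⊗ₘ g) ≫ boxHom (𝟙 _) (𝟙 _) =
      boxHom (𝟙 _) (𝟙 _) ≫ (Ind.yoneda.map f ⊗ₘ Ind.yoneda.map g) := by
  rw [map_boxHom, Category.comp_id, Category.comp_id, boxHom_eq]

/-- The universal property of `exists_tensor_desc`, applied to constant presentations, produces the
inverse; full faithfulness of the embedding reduces the second identity to naturality. -/
instance isIso_boxHom (x x' : T) :
    IsIso (boxHom (𝟙 (Ind.yoneda.obj x)) (𝟙 (Ind.yoneda.obj x'))) := by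
  obtain ⟨φ, hφ⟩ := exists_boxHom_desc (𝟙 (Ind.yoneda.obj (x ⊗ x')))
  refine ⟨φ, hφ, tensor_hom_ext (fun z z' a b => ?_)⟩
  obtain ⟨f, rfl⟩ := Ind.yoneda.map_surjective a
  obtain ⟨g, rfl⟩ := Ind.yoneda.map_surjective b
  rw [boxHom_eq, ← map_boxHom_id, Category.assoc, Category.assoc, reassoc_of% hφ, Category.comp_id]

open LawfulDayConvolutionMonoidalCategoryStruct in
variable (T) in
/-- The transformation which exhibits the unit of `Ind T` as a unit for Day convolution. -/
def unitTrans : Functor.fromPUnit.{0} (𝟙_ (Type v)) ⟶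
    Functor.fromPUnit.{0} (𝟙_ Tᵒᵖ) ⋙ (ι Tᵒᵖ (Type v) (Ind T)).obj (𝟙_ (Ind T)) :=
  { app := fun _ => unitUnit Tᵒᵖ (Type v) (Ind T)
    naturality := fun _ _ _ => by simp }

open LawfulDayConvolutionMonoidalCategoryStruct in
instance isLeftKanExtension_unitTrans :
    ((ι Tᵒᵖ (Type v) (Ind T)).obj (𝟙_ (Ind T))).IsLeftKanExtension (unitTrans T) :=
  (isPointwiseLeftKanExtensionUnitUnit Tᵒᵖ (Type v) (Ind T)).isLeftKanExtension

open LawfulDayConvolutionMonoidalCategoryStruct in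
lemma exists_unit_desc {C : Ind T} (h : Ind.yoneda.obj (𝟙_ T) ⟶ C) :
    ∃ φ : 𝟙_ (Ind T) ⟶ C, unitLeg T ≫ φ = h := by
  let β : Functor.fromPUnit.{0} (𝟙_ (Type v)) ⟶
      Functor.fromPUnit.{0} (𝟙_ Tᵒᵖ) ⋙ (Ind.inclusion T).obj C :=
    { app := fun _ => TypeCat.ofHom fun _ => indElt h
      naturality := fun _ _ _ => by ext; simp }
  refine ⟨Ind.inclusion.fullyFaithful.preimage
    (((ι Tᵒᵖ (Type v) (Ind T)).obj (𝟙_ (Ind T))).descOfIsLeftKanExtension (unitTrans T)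
      ((Ind.inclusion T).obj C) β), ?_⟩
  apply (indElt_bijective _ _).1
  rw [indElt_comp, Ind.inclusion.fullyFaithful.map_preimage, unitLeg, indElt_ofElt]
  exact ConcreteCategory.congr_hom (((ι Tᵒᵖ (Type v) (Ind T)).obj
    (𝟙_ (Ind T))).descOfIsLeftKanExtension_fac_app (unitTrans T)
      ((Ind.inclusion T).obj C) β ⟨PUnit.unit⟩) PUnit.unit

open LawfulDayConvolutionMonoidalCategoryStruct in
lemma unit_hom_ext {C : Ind T} {f g : 𝟙_ (Ind T) ⟶ C} (h : unitLeg T ≫ f = unitLeg T ≫ g) :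
    f = g := by
  apply (Ind.inclusion T).map_injective
  apply Functor.hom_ext_of_isLeftKanExtension ((ι Tᵒᵖ (Type v) (Ind T)).obj (𝟙_ (Ind T)))
    (unitTrans T)
  ext ⟨⟨⟩⟩ ⟨⟩
  have := congrArg indElt h
  rw [indElt_comp, indElt_comp, unitLeg, indElt_ofElt] at this
  exact this

instance isIso_unitLeg : IsIso (unitLeg T) := by
  obtain ⟨φ, hφ⟩ := exists_unit_desc (𝟙 (Ind.yoneda.obj (𝟙_ T)))
  exact ⟨φ, hφ, unit_hom_ext (by rw [reassoc_of% hφ, Category.comp_id])⟩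

variable (T) in
/-- The oplax monoidal structure of the embedding of `T` into `Ind T`. -/
@[reducible]
def yonedaOplax : (Ind.yoneda (C := T)).OplaxMonoidal where
  η := unitLeg T
  δ x x' := boxHom (𝟙 _) (𝟙 _)
  δ_natural_left f X' := by
    rw [← tensorHom_id, ← tensorHom_id, map_boxHom, boxHom_tensorHom]
    simp
  δ_natural_right X' f := by
    rw [← id_tensorHom, ← id_tensorHom, map_boxHom, boxHom_tensorHom]
    simp
  oplax_associativity X Y Z := by
    rw [← tensorHom_id, ← id_tensorHom, reassoc_of% boxHom_tensorHom, boxHom_tensorHom,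
      Category.id_comp, Category.id_comp, Category.id_comp, Category.id_comp, boxHom_associator]
  oplax_left_unitality X := by
    rw [← tensorHom_id, boxHom_tensorHom, Category.id_comp, Category.id_comp,
      ← cancel_mono (λ_ (Ind.yoneda.obj X)).hom, Category.assoc, boxHom_leftUnitor,
      ← Functor.map_comp_assoc]
    simp
  oplax_right_unitality X := by
    rw [← id_tensorHom, boxHom_tensorHom, Category.id_comp, Category.id_comp,
      ← cancel_mono (ρ_ (Ind.yoneda.obj X)).hom, Category.assoc, boxHom_rightUnitor,
      ← Functor.map_comp_assoc]
    simp

instance yonedaMonoidal : (Ind.yoneda (C := T)).Monoidal :=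
  letI := yonedaOplax T
  have : IsIso (Functor.OplaxMonoidal.η (Ind.yoneda (C := T))) :=
    inferInstanceAs (IsIso (unitLeg T))
  have (x x' : T) : IsIso (Functor.OplaxMonoidal.δ (Ind.yoneda (C := T)) x x') :=
    isIso_boxHom x x'
  Functor.Monoidal.ofOplaxMonoidal _

lemma δ_yoneda (x x' : T) : Functor.OplaxMonoidal.δ (Ind.yoneda (C := T)) x x' =
    boxHom (𝟙 _) (𝟙 _) := rfl

lemma boxHom_eq_δ {x x' : T} {A B : Ind T} (a : Ind.yoneda.obj x ⟶ A)
    (b : Ind.yoneda.obj x' ⟶ B) :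
    boxHom a b = Functor.OplaxMonoidal.δ Ind.yoneda x x' ≫ (a ⊗ₘ b) :=
  boxHom_eq a b

instance yonedaBraided [SymmetricCategory T] : (Ind.yoneda (C := T)).Braided where
  braided X Y := by
    rw [← cancel_epi (Functor.OplaxMonoidal.δ Ind.yoneda X Y), Functor.Monoidal.δ_μ_assoc,
      δ_yoneda, reassoc_of% boxHom_braiding, ← δ_yoneda, Functor.Monoidal.δ_μ, Category.comp_id]

lemma ind_tensor_hom_ext {A B C : Ind T} {f g : A ⊗ B ⟶ C}
    (h : ∀ (x x' : T) (a : Ind.yoneda.obj x ⟶ A) (b : Ind.yoneda.obj x' ⟶ B),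
      (a ⊗ₘ b) ≫ f = (a ⊗ₘ b) ≫ g) : f = g :=
  tensor_hom_ext (fun x x' a b => by
    rw [boxHom_eq_δ, Category.assoc, Category.assoc, h])

end monoidalYoneda

/-! ### The additive structure of `Ind T` -/

section additive
variable {T : Type u} [Category.{v} T] [Abelian T]

variable (T) in
/-- The representable presheaf functor of the ind-category, on `T`. -/
def indRestrictedYoneda : Ind T ⥤ Tᵒᵖ ⥤ₗ Type v :=
  ObjectProperty.lift _ (Ind.inclusion T) (fun A => by
    have e : (Ind.yoneda (C := T)).op ⋙ yoneda.obj A ≅ (Ind.inclusion T).obj A :=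
      NatIso.ofComponents (fun X => Equiv.toIso (Equiv.ofBijective _ (indElt_bijective X.unop A)))
        (fun f => by
          ext a
          exact indElt_map_comp f.unop a)
    have : PreservesFiniteLimits (Ind.yoneda (C := T)).op := preservesFiniteLimits_op _
    have : PreservesFiniteLimits ((Ind.yoneda (C := T)).op ⋙ yoneda.obj A) :=
      comp_preservesFiniteLimits _ _
    exact preservesFiniteLimits_of_natIso e)

attribute [local instance] Abelian.hasFiniteBiproducts

/-- Ind-objects are left exact presheaves of sets. These are equivalent to left exact presheaves of
abelian groups, and the addition of morphisms is transported from there along the fully faithful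
functor. -/
instance indPreadditive : Preadditive (Ind T) :=
  have h : (indRestrictedYoneda T).FullyFaithful :=
    Functor.FullyFaithful.ofCompFaithful (G := ObjectProperty.ι _)
      (Ind.inclusion.fullyFaithful (C := T))
  .ofFullyFaithful ((h.comp
    (AddCommGrpCat.leftExactFunctorForgetEquivalence _).symm.fullyFaithfulFunctor).comp
      (ObjectProperty.fullyFaithfulι _))

instance yoneda_additive : (Ind.yoneda (C := T)).Additive := by
  have := preservesBinaryBiproducts_of_preservesBinaryCoproducts (Ind.yoneda (C := T))
  exact Functor.additive_of_preservesBinaryBiproducts _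

variable [EssentiallySmall.{v} T] [MonoidalCategory T] [SymmetricCategory T] 
  [MonoidalPreadditive T]

lemma whiskerLeft_yoneda_add (x : T) {y z : T} (f g : y ⟶ z) :
    Ind.yoneda.obj x ◁ (Ind.yoneda.map (f + g)) =
      Ind.yoneda.obj x ◁ Ind.yoneda.map f + Ind.yoneda.obj x ◁ Ind.yoneda.map g := by
  rw [← cancel_epi (Functor.OplaxMonoidal.δ Ind.yoneda x y), Preadditive.comp_add,
    Functor.OplaxMonoidal.δ_natural_right, Functor.OplaxMonoidal.δ_natural_right,
    Functor.OplaxMonoidal.δ_natural_right, MonoidalPreadditive.whiskerLeft_add, Functor.map_add,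
    Preadditive.add_comp]

/-- The sum `b + c` is the composite of the diagonal of `x'` and a morphism defined on `x' ⊞ x'`.
The diagonal is the sum of the two inclusions, which are morphisms of `T`, so additivity on
representable objects suffices. -/
lemma tensorHom_yoneda_add {x x' : T} {A B : Ind T} (a : Ind.yoneda.obj x ⟶ A)
    (b c : Ind.yoneda.obj x' ⟶ B) : a ⊗ₘ (b + c) = (a ⊗ₘ b) + (a ⊗ₘ c) := by
  have h : ∀ f : x' ⟶ x' ⊞ x', a ⊗ₘ (Ind.yoneda.map f ≫ Ind.yoneda.map biprod.fst ≫ b +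
        Ind.yoneda.map f ≫ Ind.yoneda.map biprod.snd ≫ c) =
      Ind.yoneda.obj x ◁ (Ind.yoneda.map f) ≫ (a ⊗ₘ (Ind.yoneda.map biprod.fst ≫ b +
        Ind.yoneda.map biprod.snd ≫ c)) := by
    intro f
    rw [← id_tensorHom, tensorHom_comp_tensorHom, Category.id_comp, Preadditive.comp_add]
  have h1 := h (biprod.lift (𝟙 _) (𝟙 _))
  have h2 := h (biprod.lift (𝟙 _) 0)
  have h3 := h (biprod.lift 0 (𝟙 _))
  simp only [← Functor.map_comp_assoc, biprod.lift_fst, biprod.lift_snd, CategoryTheory.Functor.map_id,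
    Functor.map_zero, zero_comp, add_zero, zero_add, Category.id_comp] at h1 h2 h3
  rw [h1, h2, h3, ← Preadditive.add_comp, ← whiskerLeft_yoneda_add]
  congr 3
  apply biprod.hom_ext <;> simp

instance indMonoidalPreadditive : MonoidalPreadditive (Ind T) := by
  -- Morphisms out of a tensor product are tested on representable objects, where
  -- `tensorHom_yoneda_add` applies. The other variable follows from the braiding.
  have hl : ∀ {A B C : Ind T} (f g : B ⟶ C), A ◁ (f + g) = A ◁ f + A ◁ g := by
    intro A B C f g
    apply ind_tensor_hom_ext
    intro x x' a b
    rw [Preadditive.comp_add, ← id_tensorHom, ← id_tensorHom, ← id_tensorHom,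
      tensorHom_comp_tensorHom, tensorHom_comp_tensorHom, tensorHom_comp_tensorHom,
      Preadditive.comp_add, tensorHom_yoneda_add]
  have hr : ∀ {A B C : Ind T} (f g : B ⟶ C), (f + g) ▷ A = f ▷ A + g ▷ A := by
    intro A B C f g
    rw [← cancel_mono (β_ C A).hom, Preadditive.add_comp, BraidedCategory.braiding_naturality_left,
      BraidedCategory.braiding_naturality_left, BraidedCategory.braiding_naturality_left, hl,
      Preadditive.comp_add]
  refine ⟨fun {A B C} => ?_, fun {A B C} => ?_, hl, hr⟩
  · exact add_eq_left.1 ((hl (A := A) 0 0).symm.trans (congrArg (A ◁ ·) (add_zero (0 : B ⟶ C))))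
  · exact add_eq_left.1 ((hr (A := A) 0 0).symm.trans (congrArg (· ▷ A) (add_zero (0 : B ⟶ C))))

end additive

/-! ### The abelian category of additive presheaves -/

section addMod
variable (K : Type v) [Category.{v} K] [Preadditive K]

/-- The property of a presheaf of abelian groups to be additive. -/
def isAdditive : ObjectProperty (Kᵒᵖ ⥤ AddCommGrpCat.{v}) := fun F => F.Additive

instance : (isAdditive K).ContainsZero where
  exists_zero := ⟨_, isZero_zero _, ⟨fun {_ _ _ _} =>
    ((isZero_zero (Kᵒᵖ ⥤ AddCommGrpCat.{v})).obj _).eq_of_src _ _⟩⟩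

/-- The inclusion of a kernel is a monomorphism at each object, so additivity can be tested in the
ambient presheaf. For cokernels the projection plays the same role. -/
instance : (isAdditive K).IsClosedUnderKernels where
  kernels_le := by
    rintro _ ⟨f, k, hk, hX, hY⟩
    have : Functor.Additive _ := hX
    have : Mono k.ι := mono_of_isLimit_fork hk
    refine ⟨fun {U V a b} => ?_⟩
    have : Mono (k.ι.app V) := inferInstance
    change k.pt.map _ = k.pt.map _ + k.pt.map _
    rw [← cancel_mono (k.ι.app V), Preadditive.add_comp]
    erw [NatTrans.naturality, NatTrans.naturality, NatTrans.naturality]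
    rw [← Preadditive.comp_add]
    exact congrArg _ (Functor.map_add _)

instance : (isAdditive K).IsClosedUnderCokernels where
  cokernels_le := by
    rintro _ ⟨f, k, hk, hX, hY⟩
    have : Functor.Additive _ := hY
    have : Epi k.π := epi_of_isColimit_cofork hk
    refine ⟨fun {U V a b} => ?_⟩
    have : Epi (k.π.app U) := inferInstance
    change k.pt.map _ = k.pt.map _ + k.pt.map _
    rw [← cancel_epi (k.π.app U), Preadditive.comp_add]
    erw [← NatTrans.naturality, ← NatTrans.naturality, ← NatTrans.naturality]
    rw [← Preadditive.add_comp]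
    exact congrArg (· ≫ _) (Functor.map_add _)

instance : (isAdditive K).IsClosedUnderFiniteProducts where
  isClosedUnderLimitsOfShape J _ := ⟨by
    rintro X ⟨p⟩
    refine ⟨fun {U V a b} => ?_⟩
    apply (isLimitOfPreserves ((evaluation _ _).obj V) p.isLimit).hom_ext
    intro j
    have : (p.diag.obj j).Additive := p.prop_diag_obj j
    change X.map _ ≫ (p.π.app j).app V = (X.map _ + X.map _) ≫ (p.π.app j).app V
    rw [Preadditive.add_comp]
    erw [NatTrans.naturality, NatTrans.naturality, NatTrans.naturality]
    rw [← Preadditive.comp_add]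
    exact congrArg _ (Functor.map_add _)⟩

/-- The category of additive presheaves of abelian groups on a small preadditive category. The
universe level `u` is a lower bound for the type of objects. -/
def AddMod : Type (max u (v + 1)) :=
  InducedCategory (Kᵒᵖ ⥤ AddCommGrpCat.{v}) (fun M : ULift.{u} (isAdditive K).FullSubcategory =>
    M.down.obj)

instance : Category.{v} (AddMod.{v, u} K) := inferInstanceAs (Category.{v} (InducedCategory _ _))

instance : Preadditive (AddMod.{v, u} K) := inferInstanceAs (Preadditive (InducedCategory _ _))

/-- Forgetting the universe lift. -/
def AddMod.down : AddMod.{v, u} K ⥤ (isAdditive K).FullSubcategory where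
  obj M := ULift.down M
  map f := ObjectProperty.homMk f.hom

instance : (AddMod.down.{v, u} K).Faithful where
  map_injective h := InducedCategory.hom_ext (congrArg (fun f => f.hom) h)

instance : (AddMod.down.{v, u} K).Full where
  map_surjective f := ⟨InducedCategory.homMk f.hom, rfl⟩

instance : (AddMod.down.{v, u} K).EssSurj where
  mem_essImage M := ⟨ULift.up M, ⟨Iso.refl _⟩⟩

instance : (AddMod.down.{v, u} K).IsEquivalence where

instance : Abelian (AddMod.{v, u} K) :=
  have : HasFiniteProducts (AddMod.{v, u} K) := ⟨fun _ =>
    Adjunction.hasLimitsOfShape_of_equivalence (AddMod.down.{v, u} K)⟩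
  abelianOfEquivalence (AddMod.down.{v, u} K)

namespace AddMod
variable {K}

/-- The underlying additive presheaf. -/
abbrev toFunctor (M : AddMod.{v, u} K) : Kᵒᵖ ⥤ AddCommGrpCat.{v} := (ULift.down M).obj

instance (M : AddMod.{v, u} K) : M.toFunctor.Additive := (ULift.down M).property

/-- The group of sections at an object. -/
def at' (M : AddMod.{v, u} K) (x : K) : Type v := M.toFunctor.obj (op x)

instance : CoeFun (AddMod.{v, u} K) (fun _ => K → Type v) := ⟨at'⟩

instance (M : AddMod.{v, u} K) (x : K) : AddCommGroup (M x) :=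
  inferInstanceAs (AddCommGroup (M.toFunctor.obj (op x)))

/-- The restriction along a morphism. -/
def act (M : AddMod.{v, u} K) {x y : K} (f : y ⟶ x) : M x →+ M y := (M.toFunctor.map f.op).hom

@[simp] lemma act_id (M : AddMod.{v, u} K) {x : K} (a : M x) : M.act (𝟙 x) a = a := by
  unfold act
  rw [op_id, M.toFunctor.map_id]
  rfl

lemma act_comp (M : AddMod.{v, u} K) {x y z : K} (f : y ⟶ x) (g : z ⟶ y) (a : M x) :
    M.act (g ≫ f) a = M.act g (M.act f a) := by
  unfold act
  rw [op_comp, M.toFunctor.map_comp]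
  rfl

lemma act_add (M : AddMod.{v, u} K) {x y : K} (f g : y ⟶ x) (a : M x) :
    M.act (f + g) a = M.act f a + M.act g a := by
  unfold act
  rw [op_add, M.toFunctor.map_add]
  rfl

/-- The action of a morphism on sections. -/
def app {M N : AddMod.{v, u} K} (f : M ⟶ N) (x : K) : M x →+ N x := (f.hom.app (op x)).hom

lemma app_act {M N : AddMod.{v, u} K} (f : M ⟶ N) {x y : K} (g : y ⟶ x) (a : M x) :
    app f y (M.act g a) = N.act g (app f x a) :=
  NatTrans.naturality_apply f.hom g.op a

@[simp] lemma app_id (M : AddMod.{v, u} K) {x : K} (a : M x) : app (𝟙 M) x a = a := rfl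

@[simp] lemma app_comp {M N P : AddMod.{v, u} K} (f : M ⟶ N) (g : N ⟶ P) {x : K} (a : M x) :
    app (f ≫ g) x a = app g x (app f x a) := rfl

@[simp] lemma app_add {M N : AddMod.{v, u} K} (f g : M ⟶ N) {x : K} (a : M x) :
    app (f + g) x a = app f x a + app g x a := rfl

lemma hom_ext {M N : AddMod.{v, u} K} {f g : M ⟶ N} (h : ∀ x (a : M x), app f x a = app g x a) :
    f = g := by
  apply InducedCategory.hom_ext
  ext x a
  exact h x.unop a

/-- Construction of morphisms. -/
def homMk {M N : AddMod.{v, u} K} (φ : ∀ x, M x →+ N x)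
    (h : ∀ {x y : K} (g : y ⟶ x) (a : M x), φ y (M.act g a) = N.act g (φ x a)) : M ⟶ N :=
  InducedCategory.homMk
    { app := fun x => AddCommGrpCat.ofHom (φ x.unop)
      naturality := fun x y g => by
        ext a
        exact h g.unop a }

@[simp] lemma app_homMk {M N : AddMod.{v, u} K} (φ : ∀ x, M x →+ N x)
    (h : ∀ {x y : K} (g : y ⟶ x) (a : M x), φ y (M.act g a) = N.act g (φ x a)) {x : K} (a : M x) :
    app (homMk φ h) x a = φ x a := rfl

/-- Construction of additive presheaves. -/
def mk (M : K → Type v) [∀ x, AddCommGroup (M x)] (act : ∀ {x y : K}, (y ⟶ x) → (M x →+ M y))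
    (act_id : ∀ {x : K} (a : M x), act (𝟙 x) a = a)
    (act_comp : ∀ {x y z : K} (f : y ⟶ x) (g : z ⟶ y) (a : M x), act (g ≫ f) a = act g (act f a))
    (act_add : ∀ {x y : K} (f g : y ⟶ x) (a : M x), act (f + g) a = act f a + act g a) :
    AddMod.{v, u} K :=
  ULift.up
    { obj :=
        { obj := fun x => AddCommGrpCat.of (M x.unop)
          map := fun f => AddCommGrpCat.ofHom (act f.unop)
          map_id := fun x => by ext a; exact act_id a
          map_comp := fun f g => by ext a; exact act_comp f.unop g.unop a }
      property := ⟨fun {x y f g} => by ext a; exact act_add f.unop g.unop a⟩ }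

end AddMod
end addMod

/-! ### Day convolution of additive presheaves by generators and relations -/

namespace AddMod
section tensor
variable {K : Type v} [Category.{v} K] [Preadditive K] [MonoidalCategory K]
  {M N P Q R : AddMod.{v, u} K}

/-- The formal generators of the sections of `M ⊗ N` at `z`. -/
def Gen (M N : AddMod.{v, u} K) (z : K) : Type v := Σ x y : K, (z ⟶ x ⊗ y) × M x × N y

/-- The formal generator `(a ⊗ b) ∘ f`. -/
abbrev gen {x y z : K} (f : z ⟶ x ⊗ y) (a : M x) (b : N y) : FreeAbelianGroup (Gen M N z) :=
  FreeAbelianGroup.of ⟨x, y, f, a, b⟩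

/-- The relations among the generators of `M ⊗ N`. -/
inductive Rel (M N : AddMod.{v, u} K) (z : K) : FreeAbelianGroup (Gen M N z) → Prop
  | add_left {x y : K} (f : z ⟶ x ⊗ y) (a a' : M x) (b : N y) :
    Rel M N z (gen f (a + a') b - (gen f a b + gen f a' b))
  | add_right {x y : K} (f : z ⟶ x ⊗ y) (a : M x) (b b' : N y) :
    Rel M N z (gen f a (b + b') - (gen f a b + gen f a b'))
  | add_hom {x y : K} (f g : z ⟶ x ⊗ y) (a : M x) (b : N y) :
    Rel M N z (gen (f + g) a b - (gen f a b + gen g a b))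
  | act {x y x' y' : K} (f : z ⟶ x ⊗ y) (u : x ⟶ x') (w : y ⟶ y') (a : M x') (b : N y') :
    Rel M N z (gen (f ≫ (u ⊗ₘ w)) a b - gen f (M.act u a) (N.act w b))

/-- The sections of `M ⊗ N` at `z`. -/
def TensorAt (M N : AddMod.{v, u} K) (z : K) : Type v :=
  FreeAbelianGroup (Gen M N z) ⧸ AddSubgroup.closure (Set.ofPred (Rel M N z))

instance (z : K) : AddCommGroup (TensorAt M N z) :=
  inferInstanceAs (AddCommGroup (FreeAbelianGroup (Gen M N z) ⧸ _))

/-- The class of a generator. -/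
def pureAt {x y z : K} (f : z ⟶ x ⊗ y) (a : M x) (b : N y) : TensorAt M N z :=
  QuotientAddGroup.mk (gen f a b)

lemma mk_eq_of_rel {z : K} {p q : FreeAbelianGroup (Gen M N z)} (h : Rel M N z (p - q)) :
    (QuotientAddGroup.mk p : TensorAt M N z) = QuotientAddGroup.mk q :=
  QuotientAddGroup.eq_iff_sub_mem.2 (AddSubgroup.subset_closure h)

lemma pureAt_add_left {x y z : K} (f : z ⟶ x ⊗ y) (a a' : M x) (b : N y) :
    pureAt f (a + a') b = pureAt f a b + pureAt f a' b := mk_eq_of_rel (.add_left f a a' b)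

lemma pureAt_add_right {x y z : K} (f : z ⟶ x ⊗ y) (a : M x) (b b' : N y) :
    pureAt f a (b + b') = pureAt f a b + pureAt f a b' := mk_eq_of_rel (.add_right f a b b')

lemma pureAt_add_hom {x y z : K} (f g : z ⟶ x ⊗ y) (a : M x) (b : N y) :
    pureAt (f + g) a b = pureAt f a b + pureAt g a b := mk_eq_of_rel (.add_hom f g a b)

lemma pureAt_act {x y x' y' z : K} (f : z ⟶ x ⊗ y) (u : x ⟶ x') (w : y ⟶ y') (a : M x')
    (b : N y') : pureAt (f ≫ (u ⊗ₘ w)) a b = pureAt f (M.act u a) (N.act w b) :=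
  mk_eq_of_rel (.act f u w a b)

lemma tensorAt_induction {z : K} {p : TensorAt M N z → Prop} (s : TensorAt M N z)
    (h : ∀ {x y : K} (f : z ⟶ x ⊗ y) (a : M x) (b : N y), p (pureAt f a b))
    (h0 : p 0) (hneg : ∀ s, p s → p (-s)) (hadd : ∀ s t, p s → p t → p (s + t)) : p s := by
  obtain ⟨s, rfl⟩ := QuotientAddGroup.mk_surjective s
  induction s using FreeAbelianGroup.induction_on with
  | zero => exact h0
  | of x => exact h _ _ _
  | neg x hx => exact hneg _ hx
  | add x y hx hy => exact hadd _ _ hx hy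

lemma tensorAt_hom_ext {z : K} {G : Type*} [AddCommGroup G] {F F' : TensorAt M N z →+ G}
    (h : ∀ {x y : K} (f : z ⟶ x ⊗ y) (a : M x) (b : N y), F (pureAt f a b) = F' (pureAt f a b)) :
    F = F' := by
  ext s
  induction s using tensorAt_induction with
  | h f a b => exact h f a b
  | h0 => rw [map_zero, map_zero]
  | hneg s h => rw [map_neg, map_neg, h]
  | hadd s t h h' => rw [map_add, map_add, h, h']

lemma exists_liftAt {z : K} {G : Type*} [AddCommGroup G]
    (φ : ∀ {x y : K}, (z ⟶ x ⊗ y) → M x → N y → G)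
    (h1 : ∀ {x y : K} (f : z ⟶ x ⊗ y) (a a' : M x) (b : N y), φ f (a + a') b = φ f a b + φ f a' b)
    (h2 : ∀ {x y : K} (f : z ⟶ x ⊗ y) (a : M x) (b b' : N y), φ f a (b + b') = φ f a b + φ f a b')
    (h3 : ∀ {x y : K} (f g : z ⟶ x ⊗ y) (a : M x) (b : N y), φ (f + g) a b = φ f a b + φ g a b)
    (h4 : ∀ {x y x' y' : K} (f : z ⟶ x ⊗ y) (u : x ⟶ x') (w : y ⟶ y') (a : M x') (b : N y'),
      φ (f ≫ (u ⊗ₘ w)) a b = φ f (M.act u a) (N.act w b)) :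
    ∃ F : TensorAt M N z →+ G, ∀ {x y : K} (f : z ⟶ x ⊗ y) (a : M x) (b : N y),
      F (pureAt f a b) = φ f a b := by
  let F : FreeAbelianGroup (Gen M N z) →+ G :=
    FreeAbelianGroup.lift (fun g : Gen M N z => φ g.2.2.1 g.2.2.2.1 g.2.2.2.2)
  have hF : ∀ {x y : K} (f : z ⟶ x ⊗ y) (a : M x) (b : N y), F (gen f a b) = φ f a b :=
    fun f a b => FreeAbelianGroup.lift_apply_of _ _
  refine ⟨QuotientAddGroup.lift _ F ?_, hF⟩
  rw [AddSubgroup.closure_le]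
  rintro _ (⟨f, a, a', b⟩ | ⟨f, a, b, b'⟩ | ⟨f, g, a, b⟩ | ⟨f, u, w, a, b⟩)
  · change F _ = 0
    rw [map_sub, map_add, hF, hF, hF, h1, sub_self]
  · change F _ = 0
    rw [map_sub, map_add, hF, hF, hF, h2, sub_self]
  · change F _ = 0
    rw [map_sub, map_add, hF, hF, hF, h3, sub_self]
  · change F _ = 0
    rw [map_sub, hF, hF, h4, sub_self]

/-- Homomorphisms out of the sections of `M ⊗ N`. -/
def liftAt {z : K} {G : Type*} [AddCommGroup G]
    (φ : ∀ {x y : K}, (z ⟶ x ⊗ y) → M x → N y → G)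
    (h1 : ∀ {x y : K} (f : z ⟶ x ⊗ y) (a a' : M x) (b : N y), φ f (a + a') b = φ f a b + φ f a' b)
    (h2 : ∀ {x y : K} (f : z ⟶ x ⊗ y) (a : M x) (b b' : N y), φ f a (b + b') = φ f a b + φ f a b')
    (h3 : ∀ {x y : K} (f g : z ⟶ x ⊗ y) (a : M x) (b : N y), φ (f + g) a b = φ f a b + φ g a b)
    (h4 : ∀ {x y x' y' : K} (f : z ⟶ x ⊗ y) (u : x ⟶ x') (w : y ⟶ y') (a : M x') (b : N y'),
      φ (f ≫ (u ⊗ₘ w)) a b = φ f (M.act u a) (N.act w b)) : TensorAt M N z →+ G :=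
  Classical.choose (exists_liftAt φ h1 h2 h3 h4)

lemma liftAt_pureAt {z : K} {G : Type*} [AddCommGroup G]
    (φ : ∀ {x y : K}, (z ⟶ x ⊗ y) → M x → N y → G) (h1) (h2) (h3) (h4) {x y : K}
    (f : z ⟶ x ⊗ y) (a : M x) (b : N y) :
    liftAt φ h1 h2 h3 h4 (pureAt f a b) = φ f a b :=
  Classical.choose_spec (exists_liftAt φ h1 h2 h3 h4) f a b

/-- The restriction maps of `M ⊗ N`. -/
def tensorAct {z z' : K} (g : z' ⟶ z) : TensorAt M N z →+ TensorAt M N z' :=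
  liftAt (fun f a b => pureAt (g ≫ f) a b)
    (fun f => pureAt_add_left _) (fun f => pureAt_add_right _)
    (fun f f' a b => by rw [Preadditive.comp_add, pureAt_add_hom])
    (fun f u w a b => by rw [← Category.assoc, pureAt_act])

lemma tensorAct_pureAt {z z' : K} (g : z' ⟶ z) {x y : K} (f : z ⟶ x ⊗ y) (a : M x) (b : N y) :
    tensorAct g (pureAt f a b) = pureAt (g ≫ f) a b :=
  liftAt_pureAt _ _ _ _ _ _ _ _

lemma tensorAct_id (z : K) : tensorAct (𝟙 z) = AddMonoidHom.id (TensorAt M N z) :=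
  tensorAt_hom_ext (fun f a b => by rw [tensorAct_pureAt, Category.id_comp]; rfl)

lemma tensorAct_comp {x y z : K} (f : y ⟶ x) (g : z ⟶ y) :
    tensorAct (M := M) (N := N) (g ≫ f) = (tensorAct g).comp (tensorAct f) :=
  tensorAt_hom_ext (fun h a b => by
    rw [AddMonoidHom.comp_apply, tensorAct_pureAt, tensorAct_pureAt, tensorAct_pureAt,
      Category.assoc])

lemma tensorAct_add {x y : K} (f g : y ⟶ x) :
    tensorAct (M := M) (N := N) (f + g) = tensorAct f + tensorAct g :=
  tensorAt_hom_ext (fun h a b => by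
    rw [AddMonoidHom.add_apply, tensorAct_pureAt, tensorAct_pureAt, tensorAct_pureAt,
      Preadditive.add_comp, pureAt_add_hom])

/-- The tensor product of additive presheaves (Day convolution). -/
def tensorObj' (M N : AddMod.{v, u} K) : AddMod.{v, u} K :=
  mk (TensorAt M N) tensorAct (fun s => DFunLike.congr_fun (tensorAct_id _) s)
    (fun f g s => DFunLike.congr_fun (tensorAct_comp f g) s)
    (fun f g s => DFunLike.congr_fun (tensorAct_add f g) s)

/-- The section `a ⊗ b` of `M ⊗ N`. -/
def tmul {x y : K} (a : M x) (b : N y) : tensorObj' M N (x ⊗ y) :=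
  pureAt (M := M) (N := N) (𝟙 _) a b

lemma act_tmul_eq {x y z : K} (f : z ⟶ x ⊗ y) (a : M x) (b : N y) :
    (tensorObj' M N).act f (tmul a b) = pureAt (M := M) (N := N) f a b := by
  refine (tensorAct_pureAt f (𝟙 (x ⊗ y)) a b).trans ?_
  rw [Category.comp_id]

lemma tmul_add_left {x y : K} (a a' : M x) (b : N y) :
    (tmul (a + a') b : tensorObj' M N _) = tmul a b + tmul a' b := pureAt_add_left _ _ _ _

lemma tmul_add_right {x y : K} (a : M x) (b b' : N y) :
    (tmul a (b + b') : tensorObj' M N _) = tmul a b + tmul a b' := pureAt_add_right _ _ _ _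

lemma tmul_act {x y x' y' : K} (u : x' ⟶ x) (w : y' ⟶ y) (a : M x) (b : N y) :
    (tmul (M.act u a) (N.act w b) : tensorObj' M N _) =
      (tensorObj' M N).act (u ⊗ₘ w) (tmul a b) := by
  rw [act_tmul_eq]
  refine (pureAt_act _ _ _ _ _).symm.trans ?_
  rw [Category.id_comp]

/-- Bilinear pairings of additive presheaves. -/
structure Bilin (M N P : AddMod.{v, u} K) where
  /-- the value -/
  toFun : ∀ {x y : K}, M x → N y → P (x ⊗ y)
  add_left : ∀ {x y : K} (a a' : M x) (b : N y), toFun (a + a') b = toFun a b + toFun a' b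
  add_right : ∀ {x y : K} (a : M x) (b b' : N y), toFun a (b + b') = toFun a b + toFun a b'
  act : ∀ {x y x' y' : K} (u : x' ⟶ x) (w : y' ⟶ y) (a : M x) (b : N y),
    toFun (M.act u a) (N.act w b) = P.act (u ⊗ₘ w) (toFun a b)

lemma Bilin.act_left (φ : Bilin M N P) {x y x' : K} (u : x' ⟶ x) (a : M x) (b : N y) :
    φ.toFun (M.act u a) b = P.act (u ▷ y) (φ.toFun a b) := by
  rw [← tensorHom_id, ← φ.act, act_id]

lemma Bilin.act_right (φ : Bilin M N P) {x y y' : K} (w : y' ⟶ y) (a : M x) (b : N y) :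
    φ.toFun a (N.act w b) = P.act (x ◁ w) (φ.toFun a b) := by
  rw [← id_tensorHom, ← φ.act, act_id]

lemma Bilin.zero_left (φ : Bilin M N P) {x y : K} (b : N y) : φ.toFun (0 : M x) b = 0 := by
  have := φ.add_left (0 : M x) 0 b
  rwa [add_zero, left_eq_add] at this

lemma Bilin.zero_right (φ : Bilin M N P) {x y : K} (a : M x) : φ.toFun a (0 : N y) = 0 := by
  have := φ.add_right a (0 : N y) 0
  rwa [add_zero, left_eq_add] at this

/-- The universal bilinear pairing. -/
@[simps] def tmulBilin (M N : AddMod.{v, u} K) : Bilin M N (tensorObj' M N) where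
  toFun := tmul
  add_left := tmul_add_left
  add_right := tmul_add_right
  act := tmul_act

/-- The composite of a bilinear pairing and a morphism. -/
@[simps] def Bilin.comp (φ : Bilin M N P) (f : P ⟶ Q) : Bilin M N Q where
  toFun a b := app f _ (φ.toFun a b)
  add_left a a' b := by rw [φ.add_left, map_add]
  add_right a b b' := by rw [φ.add_right, map_add]
  act u w a b := by rw [φ.act, app_act]

/-- The maps on sections of `Bilin.desc`. -/
def Bilin.descAt (φ : Bilin M N P) (z : K) : TensorAt M N z →+ P z :=
  liftAt (fun f a b => P.act f (φ.toFun a b))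
    (fun f a a' b => by rw [φ.add_left, map_add])
    (fun f a b b' => by rw [φ.add_right, map_add])
    (fun f g a b => P.act_add _ _ _)
    (fun f u w a b => by rw [φ.act, act_comp])

lemma Bilin.descAt_pureAt (φ : Bilin M N P) {x y z : K} (f : z ⟶ x ⊗ y) (a : M x) (b : N y) :
    φ.descAt z (pureAt f a b) = P.act f (φ.toFun a b) :=
  liftAt_pureAt _ _ _ _ _ _ _ _

lemma Bilin.descAt_tensorAct (φ : Bilin M N P) {z z' : K} (g : z' ⟶ z) :
    (φ.descAt z').comp (tensorAct g) = (P.act g).comp (φ.descAt z) :=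
  tensorAt_hom_ext (fun f a b => by
    rw [AddMonoidHom.comp_apply, AddMonoidHom.comp_apply, tensorAct_pureAt, φ.descAt_pureAt,
      φ.descAt_pureAt, act_comp])

/-- The morphism which belongs to a bilinear pairing. -/
def Bilin.desc (φ : Bilin M N P) : tensorObj' M N ⟶ P :=
  homMk φ.descAt (fun g s => DFunLike.congr_fun (φ.descAt_tensorAct g) s)

@[simp] lemma Bilin.desc_tmul (φ : Bilin M N P) {x y : K} (a : M x) (b : N y) :
    app φ.desc (x ⊗ y) (tmul a b) = φ.toFun a b := by
  refine (φ.descAt_pureAt _ _ _).trans ?_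
  rw [act_id]

/-- The sections of `M ⊗ N` are generated, as groups, by the restrictions of the sections `a ⊗ b`.
-/
lemma tensor_ext {f g : tensorObj' M N ⟶ P}
    (h : ∀ {x y : K} (a : M x) (b : N y), app f _ (tmul a b) = app g _ (tmul a b)) : f = g := by
  apply hom_ext
  intro z
  refine DFunLike.congr_fun (tensorAt_hom_ext (F := app f z) (F' := app g z) (fun k a b => ?_))
  rw [← act_tmul_eq]
  refine (app_act f k _).trans (Eq.trans ?_ (app_act g k _).symm)
  rw [h]

end tensor
end AddMod

/-! ### The monoidal structure on additive presheaves -/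

namespace AddMod
section
variable {K : Type v} [Category.{v} K] [Preadditive K]

@[simp] lemma act_act (M : AddMod.{v, u} K) {x y z : K} (f : y ⟶ x) (g : z ⟶ y) (a : M x) :
    M.act g (M.act f a) = M.act (g ≫ f) a := (M.act_comp f g a).symm

variable [MonoidalCategory K] [MonoidalPreadditive K] {M N P Q R : AddMod.{v, u} K}

/-- The translate `y ↦ M (y ⊗ z)`. -/
def shiftRight (z : K) (M : AddMod.{v, u} K) : AddMod.{v, u} K :=
  mk (fun y => M (y ⊗ z)) (fun f => M.act (f ▷ z))
    (fun a => by rw [id_whiskerRight, act_id])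
    (fun f g a => by rw [comp_whiskerRight, act_comp])
    (fun f g a => by rw [MonoidalPreadditive.add_whiskerRight, act_add])

/-- The translate `y ↦ M (z ⊗ y)`. -/
def shiftLeft (z : K) (M : AddMod.{v, u} K) : AddMod.{v, u} K :=
  mk (fun y => M (z ⊗ y)) (fun f => M.act (z ◁ f))
    (fun a => by rw [whiskerLeft_id, act_id])
    (fun f g a => by rw [whiskerLeft_comp, act_comp])
    (fun f g a => by rw [MonoidalPreadditive.whiskerLeft_add, act_add])

/-- A bilinear pairing with its second argument fixed. -/
def Bilin.fixRight (φ : Bilin M N P) {z : K} (b : N z) : M ⟶ shiftRight z P :=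
  homMk (fun _ => AddMonoidHom.mk' (fun a => φ.toFun a b) (fun a a' => φ.add_left a a' b))
    (fun g a => φ.act_left g a b)

/-- A bilinear pairing with its first argument fixed. -/
def Bilin.fixLeft (φ : Bilin M N P) {z : K} (a : M z) : N ⟶ shiftLeft z P :=
  homMk (fun _ => AddMonoidHom.mk' (fun b => φ.toFun a b) (fun b b' => φ.add_right a b b'))
    (fun g b => φ.act_right g a b)

/-- For a fixed section `c` of `P` at `z`, the rule `s ↦ f (s ⊗ c)` is a morphism from `M ⊗ N` to
the translate of `Q` by `z`, to which `tensor_ext` applies. The translates serve to treat iterated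
tensor products one variable at a time. -/
lemma ext_left₃ {f g : tensorObj' (tensorObj' M N) P ⟶ Q}
    (h : ∀ {x y z : K} (a : M x) (b : N y) (c : P z),
      app f _ (tmul (tmul a b) c) = app g _ (tmul (tmul a b) c)) : f = g :=
  tensor_ext (fun s c => DFunLike.congr_fun (congrArg (app · _) (tensor_ext
    (f := (tmulBilin _ _ |>.comp f).fixRight c) (g := (tmulBilin _ _ |>.comp g).fixRight c)
    (fun a b => h a b c))) s)

lemma ext_right₃ {f g : tensorObj' M (tensorObj' N P) ⟶ Q}
    (h : ∀ {x y z : K} (a : M x) (b : N y) (c : P z),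
      app f _ (tmul a (tmul b c)) = app g _ (tmul a (tmul b c))) : f = g :=
  tensor_ext (fun a s => DFunLike.congr_fun (congrArg (app · _) (tensor_ext
    (f := (tmulBilin _ _ |>.comp f).fixLeft a) (g := (tmulBilin _ _ |>.comp g).fixLeft a)
    (fun b c => h a b c))) s)

lemma ext_left₄ {f g : tensorObj' (tensorObj' (tensorObj' M N) P) Q ⟶ R}
    (h : ∀ {x y z w : K} (a : M x) (b : N y) (c : P z) (d : Q w),
      app f _ (tmul (tmul (tmul a b) c) d) = app g _ (tmul (tmul (tmul a b) c) d)) : f = g :=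
  tensor_ext (fun s d => DFunLike.congr_fun (congrArg (app · _) (ext_left₃
    (f := (tmulBilin _ _ |>.comp f).fixRight d) (g := (tmulBilin _ _ |>.comp g).fixRight d)
    (fun a b c => h a b c d))) s)

/-- The tensor product of two morphisms. -/
def tensorHom' (f : M ⟶ N) (g : P ⟶ Q) : tensorObj' M P ⟶ tensorObj' N Q :=
  Bilin.desc
    { toFun := fun a b => tmul (app f _ a) (app g _ b)
      add_left := fun a a' b => by rw [map_add, tmul_add_left]
      add_right := fun a b b' => by rw [map_add, tmul_add_right]
      act := fun u w a b => by rw [app_act, app_act, tmul_act] }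

@[simp] lemma app_tensorHom' (f : M ⟶ N) (g : P ⟶ Q) {x y : K} (a : M x) (b : P y) :
    app (tensorHom' f g) _ (tmul a b) = tmul (app f _ a) (app g _ b) := Bilin.desc_tmul _ a b

lemma tmul_act_left {x y x' : K} (u : x' ⟶ x) (a : M x) (b : N y) :
    (tmul (M.act u a) b : tensorObj' M N _) = (tensorObj' M N).act (u ▷ y) (tmul a b) :=
  (tmulBilin M N).act_left u a b

lemma tmul_act_right {x y y' : K} (u : y' ⟶ y) (a : M x) (b : N y) :
    (tmul a (N.act u b) : tensorObj' M N _) = (tensorObj' M N).act (x ◁ u) (tmul a b) :=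
  (tmulBilin M N).act_right u a b

/-- The partial associator. -/
def assocFix (M N : AddMod.{v, u} K) {z : K} (c : P z) :
    tensorObj' M N ⟶ shiftRight z (tensorObj' M (tensorObj' N P)) :=
  Bilin.desc
    { toFun := fun {x y} a b => (tensorObj' M (tensorObj' N P)).act (α_ x y z).hom
        (tmul a (tmul b c))
      add_left := fun a a' b => by rw [tmul_add_left]; exact map_add _ _ _
      add_right := fun a b b' => by rw [tmul_add_left, tmul_add_right]; exact map_add _ _ _
      act := fun {x y x' y'} u w a b => by
        refine Eq.trans ?_ (act_act (tensorObj' M (tensorObj' N P)) _ ((u ⊗ₘ w) ▷ z) _).symm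
        rw [tmul_act_left w b c, tmul_act, act_act]
        congr 2
        simp [MonoidalCategory.tensorHom_def] }

/-- The partial inverse associator. -/
def assocInvFix {x : K} (a : M x) (N P : AddMod.{v, u} K) :
    tensorObj' N P ⟶ shiftLeft x (tensorObj' (tensorObj' M N) P) :=
  Bilin.desc
    { toFun := fun {y z} b c => (tensorObj' (tensorObj' M N) P).act (α_ x y z).inv
        (tmul (tmul a b) c)
      add_left := fun a a' b => by rw [tmul_add_right, tmul_add_left]; exact map_add _ _ _
      add_right := fun a b b' => by rw [tmul_add_right]; exact map_add _ _ _
      act := fun {y z y' z'} u w b c => by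
        refine Eq.trans ?_ (act_act (tensorObj' (tensorObj' M N) P) _ (x ◁ (u ⊗ₘ w)) _).symm
        rw [tmul_act_right u a b, tmul_act, act_act]
        congr 2
        simp [MonoidalCategory.tensorHom_def] }

lemma app_assocFix {x y z : K} (a : M x) (b : N y) (c : P z) :
    app (assocFix M N c) (x ⊗ y) (tmul a b) =
      (tensorObj' M (tensorObj' N P)).act (α_ x y z).hom (tmul a (tmul b c)) :=
  Bilin.desc_tmul _ a b

lemma app_assocInvFix {x y z : K} (a : M x) (b : N y) (c : P z) :
    app (assocInvFix a N P) (y ⊗ z) (tmul b c) =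
      (tensorObj' (tensorObj' M N) P).act (α_ x y z).inv (tmul (tmul a b) c) :=
  Bilin.desc_tmul _ b c

/-- A morphism of shifts. -/
def shiftRightMap {z z' : K} (w : z' ⟶ z) (M : AddMod.{v, u} K) :
    shiftRight z M ⟶ shiftRight z' M :=
  homMk (fun y => M.act (y ◁ w)) (fun {x y} g a => by
    refine (act_act M (g ▷ z) (y ◁ w) _).trans (Eq.trans ?_ (act_act M (x ◁ w) (g ▷ z') _).symm)
    rw [whisker_exchange])

/-- A morphism of shifts. -/
def shiftLeftMap {z z' : K} (w : z' ⟶ z) (M : AddMod.{v, u} K) :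
    shiftLeft z M ⟶ shiftLeft z' M :=
  homMk (fun y => M.act (w ▷ y)) (fun {x y} g a => by
    refine (act_act M (z ◁ g) (w ▷ y) _).trans (Eq.trans ?_ (act_act M (w ▷ x) (z' ◁ g) _).symm)
    rw [whisker_exchange])

/-- With `assocFix_act`, this makes `(s, c) ↦ assocFix c s` a bilinear pairing on `M ⊗ N` and `P`,
from which the associator is obtained. -/
lemma assocFix_add {z : K} (c c' : P z) :
    assocFix M N (c + c') = assocFix M N c + assocFix M N c' :=
  tensor_ext (fun a b => by
    rw [app_add, app_assocFix, app_assocFix, app_assocFix, tmul_add_right, tmul_add_right]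
    exact map_add _ _ _)

lemma assocFix_act {z z' : K} (w : z' ⟶ z) (c : P z) :
    assocFix M N (P.act w c) = assocFix M N c ≫ shiftRightMap w _ :=
  tensor_ext (fun {x y} a b => by
    rw [app_comp, app_assocFix, app_assocFix, tmul_act_right, tmul_act_right, act_act]
    refine Eq.trans ?_ (act_act (tensorObj' M (tensorObj' N P)) (α_ x y z).hom
      ((x ⊗ y) ◁ w) _).symm
    simp
    rfl)

lemma assocInvFix_add {x : K} (a a' : M x) :
    assocInvFix (a + a') N P = assocInvFix a N P + assocInvFix a' N P :=
  tensor_ext (fun b c => by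
    rw [app_add, app_assocInvFix, app_assocInvFix, app_assocInvFix, tmul_add_left, tmul_add_left]
    exact map_add _ _ _)

lemma assocInvFix_act {x x' : K} (w : x' ⟶ x) (a : M x) :
    assocInvFix (M.act w a) N P = assocInvFix a N P ≫ shiftLeftMap w _ :=
  tensor_ext (fun {y z} b c => by
    rw [app_comp, app_assocInvFix, app_assocInvFix, tmul_act_left, tmul_act_left, act_act]
    refine Eq.trans ?_ (act_act (tensorObj' (tensorObj' M N) P) (α_ x y z).inv
      (w ▷ (y ⊗ z)) _).symm
    simp
    rfl)

/-- The associator, as a morphism. -/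
def assocHom (M N P : AddMod.{v, u} K) :
    tensorObj' (tensorObj' M N) P ⟶ tensorObj' M (tensorObj' N P) :=
  Bilin.desc
    { toFun := fun {_ _} s c => app (assocFix M N c) _ s
      add_left := fun a a' b => map_add _ _ _
      add_right := fun a b b' => by rw [assocFix_add]; rfl
      act := fun {x y x' y'} u w s c => by
        rw [app_act, assocFix_act]
        refine (act_act (tensorObj' M (tensorObj' N P)) (x ◁ w) (u ▷ y') _).trans ?_
        rw [MonoidalCategory.tensorHom_def]
        rfl }

/-- The inverse associator, as a morphism. -/
def assocInv (M N P : AddMod.{v, u} K) :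
    tensorObj' M (tensorObj' N P) ⟶ tensorObj' (tensorObj' M N) P :=
  Bilin.desc
    { toFun := fun {_ _} a s => app (assocInvFix a N P) _ s
      add_left := fun a a' b => by rw [assocInvFix_add]; rfl
      add_right := fun a b b' => map_add _ _ _
      act := fun {x y x' y'} u w a s => by
        rw [app_act, assocInvFix_act]
        refine (act_act (tensorObj' (tensorObj' M N) P) (u ▷ y) (x' ◁ w) _).trans ?_
        rw [MonoidalCategory.tensorHom_def']
        rfl }

@[simp] lemma app_assocHom {x y z : K} (a : M x) (b : N y) (c : P z) :
    app (assocHom M N P) _ (tmul (tmul a b) c) =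
      (tensorObj' M (tensorObj' N P)).act (α_ x y z).hom (tmul a (tmul b c)) :=
  (Bilin.desc_tmul _ _ c).trans (app_assocFix a b c)

@[simp] lemma app_assocInv {x y z : K} (a : M x) (b : N y) (c : P z) :
    app (assocInv M N P) _ (tmul a (tmul b c)) =
      (tensorObj' (tensorObj' M N) P).act (α_ x y z).inv (tmul (tmul a b) c) :=
  (Bilin.desc_tmul _ _ _).trans (app_assocInvFix a b c)

/-- The representable additive presheaf. -/
def rep (x : K) : AddMod.{v, u} K :=
  mk (fun y => y ⟶ x) (fun f => AddMonoidHom.mk' (fun g => f ≫ g) (Preadditive.comp_add _ _ _ f))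
    (fun a => Category.id_comp a) (fun f g a => Category.assoc g f a)
    (fun f g a => Preadditive.add_comp _ _ _ f g a)

/-- A morphism to `x`, as a section of the presheaf which is represented by `x`. -/
def toRep {x y : K} (f : y ⟶ x) : rep.{v, u} x y := f

/-- A section of the presheaf which is represented by `x`, as a morphism to `x`. -/
def ofRep {x y : K} (f : rep.{v, u} x y) : y ⟶ x := f

lemma act_rep {x y z : K} (g : z ⟶ y) (f : rep.{v, u} x y) :
    (rep x).act g f = toRep (g ≫ ofRep f) := rfl

lemma toRep_ofRep {x y : K} (a : rep.{v, u} x y) : toRep (ofRep a) = a := rfl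
@[simp] lemma ofRep_act {x y z : K} (g : z ⟶ y) (f : rep.{v, u} x y) :
    ofRep ((rep x).act g f) = g ≫ ofRep f := rfl

@[simp] lemma ofRep_toRep {x y : K} (f : y ⟶ x) : ofRep (toRep.{v, u} f) = f := rfl

/-- The left unitor, as a morphism. -/
def leftHom (M : AddMod.{v, u} K) : tensorObj' (rep (𝟙_ K)) M ⟶ M :=
  Bilin.desc
    { toFun := fun {x y} f a => M.act (ofRep f ▷ y ≫ (λ_ y).hom) a
      add_left := fun {x y} f f' a => by
        rw [← act_add, ← Preadditive.add_comp, ← MonoidalPreadditive.add_whiskerRight]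
        rfl
      add_right := fun f a a' => map_add _ _ _
      act := fun {x y x' y'} u w f a => by
        rw [act_act, act_act]
        congr 2
        simp [MonoidalCategory.tensorHom_def, whisker_exchange_assoc] }

/-- The right unitor, as a morphism. -/
def rightHom (M : AddMod.{v, u} K) : tensorObj' M (rep (𝟙_ K)) ⟶ M :=
  Bilin.desc
    { toFun := fun {x y} a f => M.act (x ◁ ofRep f ≫ (ρ_ x).hom) a
      add_right := fun {x y} a f f' => by
        rw [← act_add, ← Preadditive.add_comp, ← MonoidalPreadditive.whiskerLeft_add]
        rfl
      add_left := fun a a' f => map_add _ _ _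
      act := fun {x y x' y'} w u a f => by
        rw [act_act, act_act]
        congr 2
        simp [tensorHom_def', ← whisker_exchange_assoc] }

@[simp] lemma app_leftHom {x y : K} (f : rep (𝟙_ K) x) (a : M y) :
    app (leftHom M) _ (tmul f a) = M.act (ofRep f ▷ y ≫ (λ_ y).hom) a := Bilin.desc_tmul _ _ _

@[simp] lemma app_rightHom {x y : K} (a : M x) (f : rep (𝟙_ K) y) :
    app (rightHom M) _ (tmul a f) = M.act (x ◁ ofRep f ≫ (ρ_ x).hom) a := Bilin.desc_tmul _ _ _

/-- The inverse left unitor, as a morphism. -/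
def leftInv (M : AddMod.{v, u} K) : M ⟶ tensorObj' (rep (𝟙_ K)) M :=
  homMk (fun y => AddMonoidHom.mk' (fun a => (tensorObj' (rep (𝟙_ K)) M).act (λ_ y).inv
      (tmul (toRep (𝟙 _)) a)) (fun a a' => by rw [tmul_add_right]; exact map_add _ _ _))
    (fun {x y} g a => by
      refine (congrArg _ (tmul_act_right g _ _)).trans ?_
      refine (act_act _ _ _ _).trans (Eq.trans ?_ (act_act _ _ _ _).symm)
      simp)

/-- The inverse right unitor, as a morphism. -/
def rightInv (M : AddMod.{v, u} K) : M ⟶ tensorObj' M (rep (𝟙_ K)) :=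
  homMk (fun y => AddMonoidHom.mk' (fun a => (tensorObj' M (rep (𝟙_ K))).act (ρ_ y).inv
      (tmul a (toRep (𝟙 _)))) (fun a a' => by rw [tmul_add_left]; exact map_add _ _ _))
    (fun {x y} g a => by
      refine (congrArg _ (tmul_act_left g _ _)).trans ?_
      refine (act_act _ _ _ _).trans (Eq.trans ?_ (act_act _ _ _ _).symm)
      simp)

lemma app_leftInv {y : K} (a : M y) : app (leftInv M) y a =
    (tensorObj' (rep (𝟙_ K)) M).act (λ_ y).inv (tmul (toRep (𝟙 _)) a) := rfl

lemma app_rightInv {y : K} (a : M y) : app (rightInv M) y a =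
    (tensorObj' M (rep (𝟙_ K))).act (ρ_ y).inv (tmul a (toRep (𝟙 _))) := rfl

lemma rep_eq_act {x y : K} (f : rep.{v, u} x y) : f = (rep x).act (ofRep f) (toRep (𝟙 x)) :=
  (Category.comp_id (ofRep f)).symm

instance : MonoidalCategoryStruct (AddMod.{v, u} K) where
  tensorObj := tensorObj'
  tensorHom f g := tensorHom' f g
  whiskerLeft X _ _ g := tensorHom' (𝟙 X) g
  whiskerRight f Y := tensorHom' f (𝟙 Y)
  tensorUnit := rep (𝟙_ K)
  associator M N P :=
    { hom := assocHom M N P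
      inv := assocInv M N P
      hom_inv_id := ext_left₃ (fun a b c => by simp [app_act])
      inv_hom_id := ext_right₃ (fun a b c => by simp [app_act]) }
  leftUnitor M :=
    { hom := leftHom M
      inv := leftInv M
      hom_inv_id := tensor_ext (fun f a => by
        rw [app_comp, app_leftHom, app_act, app_leftInv, act_act, rep_eq_act f, tmul_act_left]
        simp)
      inv_hom_id := hom_ext (fun x a => by
        rw [app_comp, app_leftInv, app_act, app_leftHom, act_act]
        refine Eq.trans ?_ (act_id M a)
        congr 2
        change (λ_ x).inv ≫ 𝟙 _ ▷ _ ≫ _ = _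
        simp) }
  rightUnitor M :=
    { hom := rightHom M
      inv := rightInv M
      hom_inv_id := tensor_ext (fun a f => by
        rw [app_comp, app_rightHom, app_act, app_rightInv, act_act, rep_eq_act f, tmul_act_right]
        simp)
      inv_hom_id := hom_ext (fun x a => by
        rw [app_comp, app_rightInv, app_act, app_rightHom, act_act]
        refine Eq.trans ?_ (act_id M a)
        congr 2
        change (ρ_ x).inv ≫ _ ◁ 𝟙 _ ≫ _ = _
        simp) }

instance : MonoidalCategory (AddMod.{v, u} K) := MonoidalCategory.ofTensorHom
  (id_tensorHom_id := fun _ _ => tensor_ext (fun a b => app_tensorHom' _ _ a b))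
  (id_tensorHom := fun _ _ _ _ => rfl)
  (tensorHom_id := fun _ _ => rfl)
  (tensorHom_comp_tensorHom := fun _ _ _ _ => tensor_ext (fun a b => by
    change app (tensorHom' _ _ ≫ tensorHom' _ _) _ _ = app (tensorHom' _ _) _ _
    simp))
  (associator_naturality := fun _ _ _ => ext_left₃ (fun a b c => by
    change app (tensorHom' (tensorHom' _ _) _ ≫ assocHom _ _ _) _ _ =
      app (assocHom _ _ _ ≫ tensorHom' _ (tensorHom' _ _)) _ _
    simp [app_act]))
  (leftUnitor_naturality := fun f => tensor_ext (fun a b => by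
    change app (tensorHom' (𝟙 (rep (𝟙_ K))) f ≫ leftHom _) _ _ = app (leftHom _ ≫ f) _ _
    simp [app_act]))
  (rightUnitor_naturality := fun f => tensor_ext (fun a b => by
    change app (tensorHom' f (𝟙 (rep (𝟙_ K))) ≫ rightHom _) _ _ = app (rightHom _ ≫ f) _ _
    simp [app_act]))
  (pentagon := fun M N P Q => ext_left₄ (fun a b c d => by
    change app (tensorHom' (assocHom M N P) (𝟙 Q) ≫ assocHom M (tensorObj' N P) Q ≫
      tensorHom' (𝟙 M) (assocHom N P Q)) _ _ =
      app (assocHom (tensorObj' M N) P Q ≫ assocHom M N (tensorObj' P Q)) _ _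
    simp [app_act, tmul_act_left, tmul_act_right]))
  (triangle := fun M N => ext_left₃ (fun a f b => by
    change app (assocHom M (rep (𝟙_ K)) N ≫ tensorHom' (𝟙 M) (leftHom N)) _ _ =
      app (tensorHom' (rightHom M) (𝟙 N)) _ _
    simp [app_act, tmul_act_left, tmul_act_right]))

end
end AddMod

/-! ### Internal homs, symmetry and the monoidal Yoneda embedding -/

namespace AddMod
section
variable {K : Type v} [Category.{v} K] [Preadditive K] [MonoidalCategory K] [MonoidalPreadditive K]
  {M N P Q R : AddMod.{v, u} K}

/-- The section `a ⊗ b` of `M ⊗ N`. -/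
def tm {x y : K} (a : M x) (b : N y) : (M ⊗ N) (x ⊗ y) := tmul a b

lemma tm_ext {f g : M ⊗ N ⟶ P}
    (h : ∀ {x y : K} (a : M x) (b : N y), app f _ (tm a b) = app g _ (tm a b)) : f = g :=
  tensor_ext h

lemma tm_ext₃ {f g : (M ⊗ N) ⊗ P ⟶ Q}
    (h : ∀ {x y z : K} (a : M x) (b : N y) (c : P z),
      app f _ (tm (tm a b) c) = app g _ (tm (tm a b) c)) : f = g :=
  ext_left₃ h

@[simp] lemma app_whiskerLeft_tm (M : AddMod.{v, u} K) (g : P ⟶ Q) {x y : K} (a : M x) (b : P y) :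
    app (M ◁ g) _ (tm a b) = tm a (app g _ b) := app_tensorHom' _ g a b

@[simp] lemma app_whiskerRight_tm (f : M ⟶ N) (P : AddMod.{v, u} K) {x y : K} (a : M x) (b : P y) :
    app (f ▷ P) _ (tm a b) = tm (app f _ a) b := app_tensorHom' f _ a b

@[simp] lemma app_associator_tm {x y z : K} (a : M x) (b : N y) (c : P z) :
    app (α_ M N P).hom _ (tm (tm a b) c) = (M ⊗ N ⊗ P).act (α_ x y z).hom (tm a (tm b c)) :=
  app_assocHom a b c

@[simp] lemma app_leftUnitor_tm {x y : K} (f : rep (𝟙_ K) x) (a : M y) :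
    app (λ_ M).hom _ (tm f a) = M.act (ofRep f ▷ y ≫ (λ_ y).hom) a := app_leftHom _ _

@[simp] lemma app_rightUnitor_tm {x y : K} (a : M x) (f : rep (𝟙_ K) y) :
    app (ρ_ M).hom _ (tm a f) = M.act (x ◁ ofRep f ≫ (ρ_ x).hom) a := app_rightHom _ _

lemma tm_act {x y x' y' : K} (u : x' ⟶ x) (w : y' ⟶ y) (a : M x) (b : N y) :
    tm (M.act u a) (N.act w b) = (M ⊗ N).act (u ⊗ₘ w) (tm a b) := tmul_act u w a b

lemma tm_act_left {x y x' : K} (u : x' ⟶ x) (a : M x) (b : N y) :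
    tm (M.act u a) b = (M ⊗ N).act (u ▷ y) (tm a b) := tmul_act_left u a b

lemma tm_act_right {x y y' : K} (u : y' ⟶ y) (a : M x) (b : N y) :
    tm a (N.act u b) = (M ⊗ N).act (x ◁ u) (tm a b) := tmul_act_right u a b

lemma tm_add_left {x y : K} (a a' : M x) (b : N y) :
    tm (a + a') b = tm a b + tm a' b := tmul_add_left _ _ _

lemma tm_add_right {x y : K} (a : M x) (b b' : N y) :
    tm a (b + b') = tm a b + tm a b' := tmul_add_right _ _ _

instance : MonoidalPreadditive (AddMod.{v, u} K) where
  whiskerLeft_zero {M N P} := tm_ext (fun {x y} a b => by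
    rw [app_whiskerLeft_tm]
    exact (tmulBilin M P).zero_right a)
  zero_whiskerRight {M N P} := tm_ext (fun {x y} a b => by
    rw [app_whiskerRight_tm]
    exact (tmulBilin P M).zero_left b)
  whiskerLeft_add f g := tm_ext (fun a b => by simp [tm_add_right])
  add_whiskerRight f g := tm_ext (fun a b => by simp [tm_add_left])

/-- The internal hom object. -/
def ihom (N P : AddMod.{v, u} K) : AddMod.{v, u} K :=
  mk (fun z => N ⟶ shiftLeft z P)
    (fun f => AddMonoidHom.mk' (fun g => g ≫ shiftLeftMap f P) (fun _ _ => Preadditive.add_comp ..))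
    (fun {x} a => hom_ext fun y b =>
      (congrArg (fun f => P.act f (app a y b)) (id_whiskerRight x y)).trans (P.act_id _))
    (fun f g a => hom_ext fun y b =>
      (congrArg (fun f => P.act f (app a y b)) (comp_whiskerRight g f y)).trans (P.act_comp _ _ _))
    (fun f g a => hom_ext fun y b =>
      (congrArg (fun f => P.act f (app a y b)) (MonoidalPreadditive.add_whiskerRight f g)).trans
        (P.act_add _ _ _))

/-- A section of the internal hom object, as a morphism. -/
def ofIhom {z : K} (s : ihom N P z) : N ⟶ shiftLeft z P := s

lemma ofIhom_act {z z' : K} (s : ihom N P z) (f : z' ⟶ z) :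
    ofIhom ((ihom N P).act f s) = ofIhom s ≫ shiftLeftMap f P := rfl

/-- Morphisms out of a tensor product. -/
def ihomEquiv (M N P : AddMod.{v, u} K) : (M ⊗ N ⟶ P) ≃ (M ⟶ ihom N P) where
  toFun f := homMk (fun x => AddMonoidHom.mk' (fun a => ((tmulBilin M N).comp f).fixLeft a)
      (fun a a' => hom_ext fun y b => ((tmulBilin M N).comp f).add_left a a' b))
    (fun g a => hom_ext fun y b => ((tmulBilin M N).comp f).act_left g a b)
  invFun g := Bilin.desc
    { toFun := fun {x y} a b => app (ofIhom (app g x a)) y b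
      add_left := fun a a' b => by rw [map_add]; rfl
      add_right := fun a b b' => map_add _ _ _
      act := fun {x y x' y'} u w a b => by
        rw [app_act, app_act, ofIhom_act]
        refine (act_act P (u ▷ y) (x' ◁ w) _).trans ?_
        rw [tensorHom_def']
        rfl }
  left_inv f := tensor_ext fun a b => Bilin.desc_tmul _ _ _
  right_inv g := hom_ext fun x a => hom_ext (N := shiftLeft x P) fun y b => Bilin.desc_tmul _ _ _

variable [SymmetricCategory K]

/-- The braiding, as a morphism. -/
def braidHom (M N : AddMod.{v, u} K) : M ⊗ N ⟶ N ⊗ M :=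
  Bilin.desc (M := M) (N := N) (P := N ⊗ M)
    { toFun := fun {x y} a b => (N ⊗ M).act (β_ x y).hom (tm b a)
      add_left := fun a a' b => by rw [tm_add_right, map_add]
      add_right := fun a b b' => by rw [tm_add_left, map_add]
      act := fun u w a b => by rw [tm_act, act_act, act_act]; simp }

@[simp] lemma app_braidHom {x y : K} (a : M x) (b : N y) :
    app (braidHom M N) _ (tm a b) = (N ⊗ M).act (β_ x y).hom (tm b a) := Bilin.desc_tmul _ a b

lemma braid_braid (M N : AddMod.{v, u} K) : braidHom M N ≫ braidHom N M = 𝟙 _ :=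
  tm_ext (fun a b => by simp [app_act])

instance : BraidedCategory (AddMod.{v, u} K) where
  braiding M N := ⟨braidHom M N, braidHom N M, braid_braid M N, braid_braid N M⟩
  braiding_naturality_right X Y Z f := tm_ext (fun a b => by simp [app_act])
  braiding_naturality_left f Z := tm_ext (fun a b => by simp [app_act])
  hexagon_forward X Y Z := tm_ext₃ (fun a b c => by
    simp [app_act, tm_act_left, tm_act_right])
  hexagon_reverse X Y Z := by
    -- The extensionality lemma concerns tensors bracketed to the left, whereas the source here is
    -- bracketed to the right.
    rw [← cancel_epi (α_ X Y Z).hom]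
    refine tm_ext₃ (fun {x y z} a b c => ?_)
    have h' {x y z : K} (a : Z x) (b : X y) (c : Y z) :
        app (α_ Z X Y).inv _ (tm a (tm b c)) = ((Z ⊗ X) ⊗ Y).act (α_ x y z).inv (tm (tm a b) c) :=
      app_assocInv a b c
    have h'' {x y z : K} (a : X x) (b : Z y) (c : Y z) :
        app (α_ X Z Y).inv _ (tm a (tm b c)) = ((X ⊗ Z) ⊗ Y).act (α_ x y z).inv (tm (tm a b) c) :=
      app_assocInv a b c
    simp [app_act, tm_act_left, tm_act_right, h', h'']

lemma app_braiding_tm {x y : K} (a : M x) (b : N y) :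
    app (β_ M N).hom _ (tm a b) = (N ⊗ M).act (β_ x y).hom (tm b a) := app_braidHom a b

instance : SymmetricCategory (AddMod.{v, u} K) where
  symmetry M N := braid_braid M N

/-- `- ⊗ Q` is left adjoint to the internal hom out of `Q`, hence preserves all colimits. The
braiding transfers this to `Q ⊗ -`. -/
instance : RightExactTensor (AddMod.{v, u} K) := by
  have h (Q : AddMod.{v, u} K) : PreservesFiniteColimits (tensorRight Q) := by
    have he : ∀ (M' M P : AddMod.{v, u} K) (f : M' ⟶ M) (g : M ⊗ Q ⟶ P),
        ihomEquiv M' Q P (f ▷ Q ≫ g) = f ≫ ihomEquiv M Q P g := fun M' M P f g =>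
      hom_ext fun x a => hom_ext (N := shiftLeft x P) fun y b =>
        congrArg (app g _) (app_whiskerRight_tm f Q a b)
    have adj := Adjunction.adjunctionOfEquivRight (F := tensorRight Q)
      (G_obj := ihom Q) (fun M P => ihomEquiv M Q P) he
    have := adj.leftAdjoint_preservesColimits
    exact ⟨fun _ _ _ => inferInstance⟩
  exact ⟨fun Q => have := h Q; preservesFiniteColimits_of_natIso
    (BraidedCategory.tensorLeftIsoTensorRight Q).symm, h⟩

variable (K) in
/-- The Yoneda embedding. -/
@[reducible] def yon : K ⥤ AddMod.{v, u} K where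
  obj := rep
  map f := homMk (fun _ => AddMonoidHom.mk' (fun g => toRep (ofRep g ≫ f))
    (fun _ _ => Preadditive.add_comp _ _ _ _ _ _)) (fun _ _ => Category.assoc _ _ _)
  map_id _ := hom_ext fun _ a => Category.comp_id (ofRep a)
  map_comp f g := hom_ext fun _ a => (Category.assoc (ofRep a) f g).symm

instance : (yon.{v, u} K).Additive where
  map_add {_ _ f g} := hom_ext fun _ a => Preadditive.comp_add _ _ _ (ofRep a) f g

/-- The tensorator of the Yoneda embedding, as a morphism. -/
def yonμHom (x y : K) : rep x ⊗ rep y ⟶ rep.{v, u} (x ⊗ y) :=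
  Bilin.desc (M := rep x) (N := rep y) (P := rep (x ⊗ y))
    { toFun := fun a b => toRep (ofRep a ⊗ₘ ofRep b)
      add_left := fun a a' b =>
        (show (ofRep a + ofRep a') ⊗ₘ ofRep b = _ from MonoidalPreadditive.add_tensor _ _ _)
      add_right := fun a b b' =>
        (show ofRep a ⊗ₘ (ofRep b + ofRep b') = _ from MonoidalPreadditive.tensor_add _ _ _)
      act := fun u w a b =>
        (show (u ≫ ofRep a) ⊗ₘ (w ≫ ofRep b) = (u ⊗ₘ w) ≫ (ofRep a ⊗ₘ ofRep b) by simp) }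

lemma app_yonμHom {x y z w : K} (a : rep x z) (b : rep y w) :
    app (yonμHom x y) _ (tm a b) = toRep (ofRep a ⊗ₘ ofRep b) := Bilin.desc_tmul _ _ _

/-- The inverse tensorator of the Yoneda embedding, as a morphism. -/
def yonμInv (x y : K) : rep.{v, u} (x ⊗ y) ⟶ rep x ⊗ rep y :=
  homMk (fun _ => AddMonoidHom.mk' (fun f => (rep x ⊗ rep y).act (ofRep f)
      (tm (toRep (𝟙 x)) (toRep (𝟙 y)))) (fun f g => act_add _ (ofRep f) (ofRep g) _))
    (fun g a => act_comp _ (ofRep a) g _)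

lemma app_yonμInv {x y z : K} (a : rep (x ⊗ y) z) : app (yonμInv x y) _ a =
    (rep x ⊗ rep y).act (ofRep a) (tm (toRep (𝟙 x)) (toRep (𝟙 y))) := rfl

/-- The tensorator of the Yoneda embedding. -/
def yonμ (x y : K) : rep x ⊗ rep y ≅ rep.{v, u} (x ⊗ y) where
  hom := yonμHom x y
  inv := yonμInv x y
  hom_inv_id := tm_ext (M := rep x) (N := rep y) (fun a b => by
    rw [app_comp, app_yonμHom, app_yonμInv, app_id, ofRep_toRep, ← tm_act, ← rep_eq_act,
      ← rep_eq_act])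
  inv_hom_id := hom_ext fun z f => by
    rw [app_comp, app_yonμInv, app_act, app_yonμHom, act_rep]
    simp [toRep_ofRep]

@[simp] lemma app_yonμ {x y z w : K} (a : rep x z) (b : rep y w) :
    app (yonμ x y).hom _ (tm a b) = toRep (ofRep a ⊗ₘ ofRep b) := app_yonμHom a b

lemma toRep_congr {x y : K} {f g : y ⟶ x} (h : f = g) : toRep.{v, u} f = toRep g := h ▸ rfl

instance : (yon.{v, u} K).Monoidal := Functor.CoreMonoidal.toMonoidal
  { εIso := Iso.refl _
    μIso := yonμ
    μIso_hom_natural_left := fun {x x'} f y => tm_ext (M := rep x) (N := rep y) (fun a b => by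
      rw [app_comp, app_comp]
      refine (congrArg _ (app_whiskerRight_tm _ _ a b)).trans ?_
      refine (app_yonμ _ _).trans ((congrArg _ (app_yonμ a b)).trans ?_).symm
      exact toRep_congr (show (ofRep a ⊗ₘ ofRep b) ≫ f ▷ y = (ofRep a ≫ f) ⊗ₘ ofRep b by
        simp [MonoidalCategory.tensorHom_def']))
    μIso_hom_natural_right := fun {x x'} y f => tm_ext (M := rep y) (N := rep x) (fun a b => by
      rw [app_comp, app_comp]
      refine (congrArg _ (app_whiskerLeft_tm _ _ a b)).trans ?_
      refine (app_yonμ _ _).trans ((congrArg _ (app_yonμ a b)).trans ?_).symm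
      exact toRep_congr (show (ofRep a ⊗ₘ ofRep b) ≫ y ◁ f = ofRep a ⊗ₘ (ofRep b ≫ f) by
        simp [MonoidalCategory.tensorHom_def]))
    associativity := fun x y z => tm_ext₃ (M := rep x) (N := rep y) (P := rep z) (fun a b c => by
      rw [app_comp, app_comp, app_comp, app_comp, app_associator_tm, app_act, app_act]
      refine (congrArg _ (congrArg _ (app_whiskerRight_tm _ _ (tm a b) c))).trans ?_
      refine Eq.trans ?_ (congrArg _ (congrArg _ (app_whiskerLeft_tm _ _ a (tm b c)))).symm
      rw [app_yonμ, app_yonμ, app_yonμ b c, app_yonμ]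
      exact toRep_congr (show ((ofRep a ⊗ₘ ofRep b) ⊗ₘ ofRep c) ≫ (α_ x y z).hom =
        (α_ _ _ _).hom ≫ (ofRep a ⊗ₘ (ofRep b ⊗ₘ ofRep c)) by simp))
    left_unitality := fun x => tm_ext (M := rep (𝟙_ K)) (N := rep x) (fun a b => by
      refine (app_leftUnitor_tm a b).trans ?_
      rw [app_comp, app_comp]
      refine Eq.trans ?_ (congrArg _ (congrArg _ (app_whiskerRight_tm _ _ a b))).symm
      refine Eq.trans ?_ (congrArg _ (app_yonμ _ _)).symm
      exact toRep_congr (show (ofRep a ▷ _ ≫ (λ_ _).hom) ≫ ofRep b =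
        (ofRep a ⊗ₘ ofRep b) ≫ (λ_ _).hom by simp [MonoidalCategory.tensorHom_def]))
    right_unitality := fun x => tm_ext (M := rep x) (N := rep (𝟙_ K)) (fun a b => by
      refine (app_rightUnitor_tm a b).trans ?_
      rw [app_comp, app_comp]
      refine Eq.trans ?_ (congrArg _ (congrArg _ (app_whiskerLeft_tm _ _ a b))).symm
      refine Eq.trans ?_ (congrArg _ (app_yonμ _ _)).symm
      exact toRep_congr (show (_ ◁ ofRep b ≫ (ρ_ _).hom) ≫ ofRep a =
        (ofRep a ⊗ₘ ofRep b) ≫ (ρ_ _).hom by simp [MonoidalCategory.tensorHom_def'])) }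

instance : (yon.{v, u} K).Braided where
  braided x y := by
    change (yonμ x y).hom ≫ _ = (β_ _ _).hom ≫ (yonμ y x).hom
    refine tm_ext (M := rep x) (N := rep y) (fun a b => ?_)
    rw [app_comp, app_comp, app_braiding_tm, app_act, app_yonμ, app_yonμ]
    exact toRep_congr (show (ofRep a ⊗ₘ ofRep b) ≫ (β_ x y).hom =
      (β_ _ _).hom ≫ (ofRep b ⊗ₘ ofRep a) by simp)

lemma yon_obj_isZero {x : K} (h : IsZero ((yon.{v, u} K).obj x)) : IsZero x := by
  rw [IsZero.iff_id_eq_zero] at h ⊢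
  exact (congrArg (fun f : rep x ⟶ rep x => ofRep (app f x (toRep (𝟙 x)))) h)

end
end AddMod

/-! ### The symmetric monoidal category of free modules over a commutative algebra -/

section kleisli
open MonObj
variable {D : Type u} [Category.{v} D] [MonoidalCategory D]

/-- The Kleisli category of the monad `A ⊗ -` (the category of free `A`-modules). -/
structure Kl (A : D) where
  /-- the underlying object -/
  of : D

namespace Kl
variable {A : D}

/-- Morphisms of the Kleisli category. -/
@[ext] structure Hom (X Y : Kl A) where
  /-- the underlying morphism -/
  val : X.of ⟶ A ⊗ Y.of

variable [MonObj A]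

instance : Category (Kl A) where
  Hom := Hom
  id X := ⟨(λ_ X.of).inv ≫ η[A] ▷ X.of⟩
  comp {X Y Z} f g := ⟨f.val ≫ A ◁ g.val ≫ (α_ A A Z.of).inv ≫ μ[A] ▷ Z.of⟩
  id_comp {X Y} f := by
    ext
    dsimp only
    rw [Category.assoc, ← whisker_exchange_assoc, associator_inv_naturality_left_assoc,
      ← comp_whiskerRight, MonObj.one_mul]
    simp
  comp_id {X Y} f := by
    ext
    dsimp only
    rw [whiskerLeft_comp_assoc, associator_inv_naturality_middle_assoc, ← comp_whiskerRight,
      MonObj.mul_one]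
    simp
  assoc {X Y Z W} f g h := by
    ext
    dsimp only
    simp only [Category.assoc, whiskerLeft_comp]
    rw [associator_inv_naturality_middle_assoc, ← comp_whiskerRight, ← whisker_exchange_assoc,
      associator_inv_naturality_left_assoc, ← comp_whiskerRight, MonObj.mul_assoc]
    simp

@[ext] lemma hom_ext {X Y : Kl A} {f g : X ⟶ Y} (h : f.val = g.val) : f = g := Hom.ext h

lemma id_val (X : Kl A) : (𝟙 X : X ⟶ X).val = (λ_ X.of).inv ≫ η[A] ▷ X.of := rfl

lemma comp_val {X Y Z : Kl A} (f : X ⟶ Y) (g : Y ⟶ Z) :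
    (f ≫ g).val = f.val ≫ A ◁ g.val ≫ (α_ A A Z.of).inv ≫ μ[A] ▷ Z.of := rfl

/-- The morphism of free modules which is induced by a morphism. -/
def ofHom {X Y : D} (f : X ⟶ Y) : (Kl.mk X : Kl A) ⟶ Kl.mk Y :=
  ⟨f ≫ (λ_ Y).inv ≫ η[A] ▷ Y⟩

lemma ofHom_val {X Y : D} (f : X ⟶ Y) :
    (ofHom f : (Kl.mk X : Kl A) ⟶ Kl.mk Y).val = f ≫ (λ_ Y).inv ≫ η[A] ▷ Y := rfl

lemma ofHom_comp_val {X Y : D} {Z : Kl A} (f : X ⟶ Y) (g : Kl.mk Y ⟶ Z) :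
    (ofHom f ≫ g).val = f ≫ g.val := by
  rw [comp_val, ofHom_val, Category.assoc]
  exact congrArg (f ≫ ·) (congrArg Hom.val (Category.id_comp g))

lemma comp_ofHom_val {X : Kl A} {Y Z : D} (f : X ⟶ Kl.mk Y) (g : Y ⟶ Z) :
    (f ≫ ofHom g).val = f.val ≫ A ◁ g := by
  have h := congrArg Hom.val (Category.comp_id (f ≫ ofHom g))
  rw [comp_val, ofHom_val, whiskerLeft_comp_assoc, ← Category.assoc f.val]
  refine Eq.trans ?_ (Category.comp_id _)
  rw [Category.assoc, Category.assoc]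
  congr 2
  rw [whiskerLeft_comp_assoc, associator_inv_naturality_middle_assoc, ← comp_whiskerRight,
    MonObj.mul_one]
  simp

/-- The free module functor. -/
@[reducible] def free (A : D) [MonObj A] : D ⥤ Kl A where
  obj X := ⟨X⟩
  map f := ofHom f
  map_id X := by
    ext
    rw [ofHom_val, Category.id_comp]
    rfl
  map_comp f g := by
    ext
    rw [ofHom_comp_val, ofHom_val, ofHom_val, Category.assoc]

/-- Isomorphisms of free modules. -/
@[simps] def ofIso {X Y : D} (e : X ≅ Y) : (Kl.mk X : Kl A) ≅ Kl.mk Y where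
  hom := ofHom e.hom
  inv := ofHom e.inv
  hom_inv_id := by
    rw [← (free A).map_comp, e.hom_inv_id]
    exact (free A).map_id _
  inv_hom_id := by
    rw [← (free A).map_comp, e.inv_hom_id]
    exact (free A).map_id _

section preadditive
variable [Preadditive D] [MonoidalPreadditive D]

/-- The underlying morphism, as an equivalence. -/
def homEquiv (X Y : Kl A) : (X ⟶ Y) ≃ (X.of ⟶ A ⊗ Y.of) where
  toFun f := f.val
  invFun f := ⟨f⟩

instance (X Y : Kl A) : AddCommGroup (X ⟶ Y) := (homEquiv X Y).addCommGroup

lemma add_val {X Y : Kl A} (f g : X ⟶ Y) : (f + g).val = f.val + g.val := rfl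

instance : Preadditive (Kl A) where
  add_comp _ _ _ f f' g := by
    ext
    simp [add_val, comp_val]
  comp_add _ _ _ f g g' := by
    ext
    simp [add_val, comp_val]

instance : (free A).Additive where
  map_add {X Y f g} := by
    ext
    rw [ofHom_val, add_val, ofHom_val, ofHom_val, Preadditive.add_comp]

end preadditive

section tensor
variable [SymmetricCategory D]

/-- The tensor product of morphisms of free modules. -/
def tensorMap {X Y X' Y' : Kl A} (f : X ⟶ Y) (g : X' ⟶ Y') :
    (Kl.mk (X.of ⊗ X'.of) : Kl A) ⟶ Kl.mk (Y.of ⊗ Y'.of) :=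
  ⟨(f.val ⊗ₘ g.val) ≫ tensorμ A Y.of A Y'.of ≫ μ[A] ▷ (Y.of ⊗ Y'.of)⟩

lemma tensorMap_val {X Y X' Y' : Kl A} (f : X ⟶ Y) (g : X' ⟶ Y') : (tensorMap f g).val =
    (f.val ⊗ₘ g.val) ≫ tensorμ A Y.of A Y'.of ≫ μ[A] ▷ (Y.of ⊗ Y'.of) := rfl

/-- The product of two copies of the unit of `A` is the unit; this gives compatibility of
`tensorMap` with morphisms induced from `D`, and with identities. -/
lemma unit_tensorμ (X Y : D) :
    (((λ_ X).inv ≫ η[A] ▷ X) ⊗ₘ ((λ_ Y).inv ≫ η[A] ▷ Y)) ≫ tensorμ A X A Y ≫ μ[A] ▷ (X ⊗ Y) =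
      (λ_ (X ⊗ Y)).inv ≫ η[A] ▷ (X ⊗ Y) := by
  rw [← tensorHom_comp_tensorHom, ← tensorHom_id, ← tensorHom_id, Category.assoc,
    tensorμ_natural_assoc, id_tensorHom_id, ← tensorHom_id, ← tensorHom_id,
    tensorHom_comp_tensorHom, Category.comp_id]
  have h1 : (η[A] ⊗ₘ η[A]) ≫ μ[A] = (λ_ _).hom ≫ η[A] := by
    rw [tensorHom_def', Category.assoc, MonObj.one_mul, leftUnitor_naturality]
  rw [h1, ← Category.id_comp (𝟙 (X ⊗ Y)), ← tensorHom_comp_tensorHom, Category.id_comp,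
    ← cancel_epi ((λ_ X).hom ⊗ₘ (λ_ Y).hom), tensorHom_id, tensorHom_id]
  have h2 := leftUnitor_monoidal X Y
  rw [tensorHom_comp_tensorHom_assoc, Iso.hom_inv_id, Iso.hom_inv_id, id_tensorHom_id,
    Category.id_comp, h2]
  simp

lemma tensorMap_ofHom {X Y X' Y' : D} (f : X ⟶ Y) (g : X' ⟶ Y') :
    tensorMap (ofHom f : (Kl.mk X : Kl A) ⟶ Kl.mk Y) (ofHom g) = ofHom (f ⊗ₘ g) := by
  ext
  rw [tensorMap_val, ofHom_val, ofHom_val, ofHom_val, ← tensorHom_comp_tensorHom, Category.assoc,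
    unit_tensorμ]

lemma tensorMap_id (X Y : Kl A) : tensorMap (𝟙 X) (𝟙 Y) = 𝟙 (Kl.mk (X.of ⊗ Y.of)) := by
  have h := tensorMap_ofHom (A := A) (𝟙 X.of) (𝟙 Y.of)
  rw [id_tensorHom_id] at h
  exact ((congrArg₂ tensorMap ((free A).map_id X.of) ((free A).map_id Y.of)).symm.trans h).trans
    ((free A).map_id _)

/-- Both sides multiply four factors `A`, with the two middle ones exchanged. Commutativity of `A`
makes the products agree, and this is why the tensor product of morphisms of free modules respects
composition. -/
lemma mul_tensorμ [IsCommMonObj A] (Y Z : D) :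
    tensorμ A (A ⊗ Y) A (A ⊗ Z) ≫ (A ⊗ A) ◁ (tensorμ A Y A Z ≫ μ[A] ▷ (Y ⊗ Z)) ≫
        μ[A] ▷ (A ⊗ Y ⊗ Z) ≫ (α_ A A (Y ⊗ Z)).inv ≫ μ[A] ▷ (Y ⊗ Z) =
      (((α_ A A Y).inv ≫ μ[A] ▷ Y) ⊗ₘ ((α_ A A Z).inv ≫ μ[A] ▷ Z)) ≫ tensorμ A Y A Z ≫
        μ[A] ▷ (Y ⊗ Z) := by
  have h1 := associator_monoidal A A Y A A Z
  have h2 : (A ⊗ A) ◁ (μ[A] ▷ (Y ⊗ Z)) ≫ μ[A] ▷ (A ⊗ Y ⊗ Z) ≫ (α_ A A (Y ⊗ Z)).inv =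
      (α_ (A ⊗ A) (A ⊗ A) (Y ⊗ Z)).inv ≫ (μ[A] ⊗ₘ μ[A]) ▷ (Y ⊗ Z) := by
    rw [associator_inv_naturality_left, associator_inv_naturality_middle_assoc,
      ← comp_whiskerRight, tensorHom_def']
  rw [← cancel_epi ((α_ A A Y).hom ⊗ₘ (α_ A A Z).hom), tensorHom_comp_tensorHom_assoc,
    Iso.hom_inv_id_assoc, Iso.hom_inv_id_assoc, whiskerLeft_comp, Category.assoc,
    reassoc_of% h2, ← reassoc_of% h1, Iso.hom_inv_id_assoc, ← comp_whiskerRight,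
    ← comp_whiskerRight, MonObj.mul_mul_mul_comm, ← tensorHom_id, ← tensorHom_id,
    ← tensorHom_id μ[A] Z, tensorμ_natural_assoc, id_tensorHom_id, tensorHom_id, tensorHom_id,
    comp_whiskerRight]

lemma tensorMap_comp [IsCommMonObj A] {X Y Z X' Y' Z' : Kl A} (f : X ⟶ Y) (f' : X' ⟶ Y')
    (g : Y ⟶ Z) (g' : Y' ⟶ Z') :
    tensorMap f f' ≫ tensorMap g g' = tensorMap (f ≫ g) (f' ≫ g') := by
  ext
  have h := mul_tensorμ (A := A) Z.of Z'.of
  have h3 : tensorμ A Y.of A Y'.of ≫ (A ⊗ A) ◁ (g.val ⊗ₘ g'.val) =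
      (A ◁ g.val ⊗ₘ A ◁ g'.val) ≫ tensorμ A (A ⊗ Z.of) A (A ⊗ Z'.of) := by
    simpa using (tensorμ_natural (𝟙 A) g.val (𝟙 A) g'.val).symm
  rw [tensorMap_val, comp_val, comp_val, comp_val, tensorMap_val, tensorMap_val, Category.assoc,
    Category.assoc, ← whisker_exchange_assoc, whiskerLeft_comp, Category.assoc,
    reassoc_of% h3, h, tensorHom_comp_tensorHom_assoc,
    tensorHom_comp_tensorHom_assoc, Category.assoc, Category.assoc]

/-- Associativity of the interchange `tensorμ` combined with that of the multiplication of `A`. -/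
lemma assoc_tensorμ (X Y Z : D) :
    (tensorμ A X A Y ≫ μ[A] ▷ (X ⊗ Y)) ▷ (A ⊗ Z) ≫ tensorμ A (X ⊗ Y) A Z ≫
        μ[A] ▷ ((X ⊗ Y) ⊗ Z) ≫ A ◁ (α_ X Y Z).hom =
      (α_ _ _ _).hom ≫ (A ⊗ X) ◁ (tensorμ A Y A Z ≫ μ[A] ▷ (Y ⊗ Z)) ≫ tensorμ A X A (Y ⊗ Z) ≫
        μ[A] ▷ (X ⊗ Y ⊗ Z) := by
  have h := tensor_associativity A X A Y A Z
  have h1 : (μ[A] ▷ (X ⊗ Y)) ▷ (A ⊗ Z) ≫ tensorμ A (X ⊗ Y) A Z =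
      tensorμ (A ⊗ A) (X ⊗ Y) A Z ≫ (μ[A] ▷ A) ▷ _ := by
    have := tensorμ_natural_left μ[A] (𝟙 (X ⊗ Y)) A Z
    rwa [tensorHom_id, id_whiskerRight, tensorHom_id] at this
  have h2 : (A ⊗ X) ◁ (μ[A] ▷ (Y ⊗ Z)) ≫ tensorμ A X A (Y ⊗ Z) =
      tensorμ A X (A ⊗ A) (Y ⊗ Z) ≫ (A ◁ μ[A]) ▷ _ := by
    have := tensorμ_natural_right A X μ[A] (𝟙 (Y ⊗ Z))
    rwa [tensorHom_id, whiskerLeft_id, tensorHom_id] at this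
  rw [comp_whiskerRight, Category.assoc, reassoc_of% h1, whiskerLeft_comp, Category.assoc,
    reassoc_of% h2, ← reassoc_of% h, ← comp_whiskerRight_assoc, MonObj.mul_assoc,
    ← whisker_exchange, tensorHom_def', comp_whiskerRight, comp_whiskerRight, Category.assoc]

lemma tensorMap_assoc {X X' Y Y' Z Z' : Kl A} (f : X ⟶ X') (g : Y ⟶ Y') (h : Z ⟶ Z') :
    tensorMap (tensorMap f g) h ≫ ofHom (α_ X'.of Y'.of Z'.of).hom =
      ofHom (α_ X.of Y.of Z.of).hom ≫ tensorMap f (tensorMap g h) := by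
  ext
  have key := assoc_tensorμ (A := A) X'.of Y'.of Z'.of
  rw [comp_ofHom_val, ofHom_comp_val, tensorMap_val, tensorMap_val, tensorMap_val, tensorMap_val,
    Category.assoc, Category.assoc, ← Category.comp_id h.val, ← tensorHom_comp_tensorHom,
    tensorHom_id, Category.assoc, key, ← Category.comp_id f.val, ← tensorHom_comp_tensorHom,
    id_tensorHom, Category.comp_id, Category.comp_id, Category.assoc,
    associator_naturality_assoc]

lemma tensorMap_leftUnitor {X Y : Kl A} (f : X ⟶ Y) :
    tensorMap (𝟙 (Kl.mk (𝟙_ D))) f ≫ ofHom (λ_ Y.of).hom = ofHom (λ_ X.of).hom ≫ f := by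
  ext
  have h := tensor_left_unitality A Y.of
  have h1 : (η[A] ▷ 𝟙_ D) ▷ (A ⊗ Y.of) ≫ tensorμ A (𝟙_ D) A Y.of =
      tensorμ (𝟙_ D) (𝟙_ D) A Y.of ≫ (η[A] ▷ A) ▷ _ := by
    have := tensorμ_natural_left η[A] (𝟙 (𝟙_ D)) A Y.of
    rwa [tensorHom_id, id_whiskerRight, tensorHom_id] at this
  rw [comp_ofHom_val, ofHom_comp_val, tensorMap_val, id_val, tensorHom_def', Category.assoc,
    Category.assoc, comp_whiskerRight, Category.assoc, Category.assoc, reassoc_of% h1,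
    ← comp_whiskerRight_assoc, MonObj.one_mul, ← leftUnitor_naturality, h,
    MonoidalCategory.tensorHom_def]

lemma tensorMap_rightUnitor {X Y : Kl A} (f : X ⟶ Y) :
    tensorMap f (𝟙 (Kl.mk (𝟙_ D))) ≫ ofHom (ρ_ Y.of).hom = ofHom (ρ_ X.of).hom ≫ f := by
  ext
  have h := tensor_right_unitality A Y.of
  have h1 : (A ⊗ Y.of) ◁ (η[A] ▷ 𝟙_ D) ≫ tensorμ A Y.of A (𝟙_ D) =
      tensorμ A Y.of (𝟙_ D) (𝟙_ D) ≫ (A ◁ η[A]) ▷ _ := by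
    have := tensorμ_natural_right A Y.of η[A] (𝟙 (𝟙_ D))
    rwa [tensorHom_id, whiskerLeft_id, tensorHom_id] at this
  rw [comp_ofHom_val, ofHom_comp_val, tensorMap_val, id_val, MonoidalCategory.tensorHom_def,
    Category.assoc, Category.assoc, whiskerLeft_comp, Category.assoc, Category.assoc, reassoc_of% h1,
    ← comp_whiskerRight_assoc, MonObj.mul_one, ← rightUnitor_naturality, h,
    MonoidalCategory.tensorHom_def]

lemma tensorμ_braiding (X Y Z W : D) : tensorμ X Y Z W ≫ ((β_ X Z).hom ⊗ₘ (β_ Y W).hom) =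
    (β_ (X ⊗ Y) (Z ⊗ W)).hom ≫ tensorμ Z W X Y := by
  simp [tensorμ, SymmetricCategory.braiding_swap_eq_inv_braiding X W,
      MonoidalCategory.tensorHom_def]

/-- Exchanging the two free modules also exchanges their factors `A`; the exchange is invisible
after multiplication because `A` is commutative. -/
lemma tensorMap_braiding [IsCommMonObj A] {X Y X' Y' : Kl A} (f : X ⟶ Y) (f' : X' ⟶ Y') :
    tensorMap f f' ≫ ofHom (β_ Y.of Y'.of).hom = ofHom (β_ X.of X'.of).hom ≫ tensorMap f' f := by
  ext
  have h := tensorμ_braiding A Y.of A Y'.of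
  rw [comp_ofHom_val, ofHom_comp_val, tensorMap_val, tensorMap_val, Category.assoc,
    Category.assoc, ← BraidedCategory.braiding_naturality_assoc, ← reassoc_of% h,
    tensorHom_def' (β_ A A).hom, Category.assoc, ← comp_whiskerRight, IsCommMonObj.mul_comm,
    whisker_exchange]

variable [IsCommMonObj A]

instance : MonoidalCategoryStruct (Kl A) where
  tensorObj X Y := ⟨X.of ⊗ Y.of⟩
  tensorHom f g := tensorMap f g
  whiskerLeft X _ _ g := tensorMap (𝟙 X) g
  whiskerRight f Y := tensorMap f (𝟙 Y)
  tensorUnit := ⟨𝟙_ D⟩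
  associator X Y Z := ofIso (α_ X.of Y.of Z.of)
  leftUnitor X := ofIso (λ_ X.of)
  rightUnitor X := ofIso (ρ_ X.of)

lemma tensorMap_id_ofHom (X : Kl A) {Y Y' : D} (g : Y ⟶ Y') :
    tensorMap (𝟙 X) (ofHom g) = ofHom (X.of ◁ g) := by
  have h := tensorMap_ofHom (A := A) (𝟙 X.of) g
  rw [id_tensorHom] at h
  exact (congrArg (tensorMap · _) ((free A).map_id X.of)).symm.trans h

lemma tensorMap_ofHom_id (X : Kl A) {Y Y' : D} (g : Y ⟶ Y') :
    tensorMap (ofHom g) (𝟙 X) = ofHom (g ▷ X.of) := by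
  have h := tensorMap_ofHom (A := A) g (𝟙 X.of)
  rw [tensorHom_id] at h
  exact (congrArg (tensorMap _ ·) ((free A).map_id X.of)).symm.trans h

lemma ofHom_comp {X Y Z : D} (f : X ⟶ Y) (g : Y ⟶ Z) :
    (ofHom f ≫ ofHom g : (Kl.mk X : Kl A) ⟶ _) = ofHom (f ≫ g) := ((free A).map_comp f g).symm

instance : MonoidalCategory (Kl A) := MonoidalCategory.ofTensorHom
  (id_tensorHom_id := tensorMap_id)
  (id_tensorHom := fun _ _ _ _ => rfl)
  (tensorHom_id := fun _ _ => rfl)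
  (tensorHom_comp_tensorHom := tensorMap_comp)
  (associator_naturality := tensorMap_assoc)
  (leftUnitor_naturality := tensorMap_leftUnitor)
  (rightUnitor_naturality := tensorMap_rightUnitor)
  (pentagon := fun W X Y Z => by
    have h := congrArg (ofHom (A := A)) (pentagon W.of X.of Y.of Z.of)
    rw [← ofHom_comp, ← ofHom_comp, ← ofHom_comp, ← tensorMap_id_ofHom,
      ← tensorMap_ofHom_id] at h
    exact h)
  (triangle := fun X Y => by
    have h := congrArg (ofHom (A := A)) (triangle X.of Y.of)
    rw [← ofHom_comp, ← tensorMap_id_ofHom, ← tensorMap_ofHom_id] at h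
    exact h)

instance : BraidedCategory (Kl A) where
  braiding X Y := ofIso (β_ X.of Y.of)
  braiding_naturality_right X _ _ f := tensorMap_braiding (𝟙 X) f
  braiding_naturality_left f X := tensorMap_braiding f (𝟙 X)
  hexagon_forward X Y Z := by
    have h := congrArg (ofHom (A := A)) (BraidedCategory.hexagon_forward X.of Y.of Z.of)
    rw [← ofHom_comp, ← ofHom_comp, ← ofHom_comp, ← ofHom_comp, ← tensorMap_id_ofHom,
      ← tensorMap_ofHom_id] at h
    exact h
  hexagon_reverse X Y Z := by
    have h := congrArg (ofHom (A := A)) (BraidedCategory.hexagon_reverse X.of Y.of Z.of)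
    rw [← ofHom_comp, ← ofHom_comp, ← ofHom_comp, ← ofHom_comp, ← tensorMap_id_ofHom,
      ← tensorMap_ofHom_id] at h
    exact h

instance : SymmetricCategory (Kl A) where
  symmetry X Y := by
    have h := congrArg (ofHom (A := A)) (SymmetricCategory.symmetry X.of Y.of)
    rw [← ofHom_comp] at h
    exact h.trans ((free A).map_id _)

instance : (free A).Monoidal := Functor.CoreMonoidal.toMonoidal
  { εIso := Iso.refl _
    μIso _ _ := Iso.refl _
    μIso_hom_natural_left f X := (Category.comp_id _).trans
      ((tensorMap_ofHom_id ⟨X⟩ f).trans (Category.id_comp _).symm)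
    μIso_hom_natural_right X f := (Category.comp_id _).trans
      ((tensorMap_id_ofHom ⟨X⟩ f).trans (Category.id_comp _).symm)
    associativity X Y Z := by
      change tensorMap (𝟙 _) (𝟙 _) ≫ 𝟙 _ ≫ ofHom _ = ofHom _ ≫ tensorMap (𝟙 _) (𝟙 _) ≫ 𝟙 _
      rw [tensorMap_id, tensorMap_id]
      erw [Category.id_comp, Category.id_comp, Category.comp_id, Category.comp_id]
    left_unitality X := by
      change ofHom _ = tensorMap (𝟙 _) (𝟙 _) ≫ 𝟙 _ ≫ ofHom _
      rw [tensorMap_id]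
      erw [Category.id_comp, Category.id_comp]
    right_unitality X := by
      change ofHom _ = tensorMap (𝟙 _) (𝟙 _) ≫ 𝟙 _ ≫ ofHom _
      rw [tensorMap_id]
      erw [Category.id_comp, Category.id_comp] }

instance : (free A).Braided where
  braided _ _ := (Category.id_comp _).trans (Category.comp_id _).symm

instance [Preadditive D] [MonoidalPreadditive D] : MonoidalPreadditive (Kl A) where
  whiskerLeft_zero {X Y Z} := by
    ext
    change ((𝟙 X : X ⟶ X).val ⊗ₘ 0) ≫ _ = 0
    simp
  zero_whiskerRight {X Y Z} := by
    ext
    change (0 ⊗ₘ (𝟙 X : X ⟶ X).val) ≫ _ = 0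
    simp
  whiskerLeft_add {X Y Z} f g := by
    ext
    change ((𝟙 X : X ⟶ X).val ⊗ₘ (f.val + g.val)) ≫ _ =
      ((𝟙 X : X ⟶ X).val ⊗ₘ f.val) ≫ _ + ((𝟙 X : X ⟶ X).val ⊗ₘ g.val) ≫ _
    rw [MonoidalPreadditive.tensor_add, Preadditive.add_comp]
  add_whiskerRight {X Y Z} f g := by
    ext
    change ((f.val + g.val) ⊗ₘ (𝟙 X : X ⟶ X).val) ≫ _ =
      (f.val ⊗ₘ (𝟙 X : X ⟶ X).val) ≫ _ + (g.val ⊗ₘ (𝟙 X : X ⟶ X).val) ≫ _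
    rw [MonoidalPreadditive.add_tensor, Preadditive.add_comp]

end tensor
end Kl
end kleisli

/-! ### Linear structures defined by scalars on the unit object -/

section linear
open Functor.LaxMonoidal Functor.OplaxMonoidal
variable {k : Type w} [CommRing k] {C : Type u} [Category.{v} C] [Preadditive C]
  [MonoidalCategory C] [MonoidalPreadditive C]

/-- The action of an endomorphism of the unit on an object. -/
def scal (a : 𝟙_ C ⟶ 𝟙_ C) (X : C) : X ⟶ X := (λ_ X).inv ≫ a ▷ X ≫ (λ_ X).hom

/-- The scalar acts on the tensor factor `𝟙` and `f` on the other, so the exchange law applies. Thus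
`End 𝟙` acts on all objects by natural endomorphisms of the identity functor. -/
lemma scal_naturality (a : 𝟙_ C ⟶ 𝟙_ C) {X Y : C} (f : X ⟶ Y) :
    scal a X ≫ f = f ≫ scal a Y := by
  unfold scal
  rw [Category.assoc, Category.assoc, ← leftUnitor_naturality, ← whisker_exchange_assoc,
    leftUnitor_inv_naturality_assoc]

lemma scal_id (X : C) : scal (𝟙 (𝟙_ C)) X = 𝟙 X := by simp [scal]

lemma scal_comp (a b : 𝟙_ C ⟶ 𝟙_ C) (X : C) : scal (a ≫ b) X = scal a X ≫ scal b X := by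
  simp [scal]

lemma scal_add (a b : 𝟙_ C ⟶ 𝟙_ C) (X : C) : scal (a + b) X = scal a X + scal b X := by
  simp [scal]

lemma scal_zero (X : C) : scal (0 : 𝟙_ C ⟶ 𝟙_ C) X = 0 := by simp [scal]

lemma scal_whiskerRight (a : 𝟙_ C ⟶ 𝟙_ C) (X Y : C) : scal a X ▷ Y = scal a (X ⊗ Y) := by
  simp [scal]

lemma whiskerLeft_scal [BraidedCategory C] (a : 𝟙_ C ⟶ 𝟙_ C) (X Y : C) :
    X ◁ scal a Y = scal a (X ⊗ Y) := by
  rw [← cancel_mono (β_ X Y).hom, BraidedCategory.braiding_naturality_right, scal_whiskerRight,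
    scal_naturality]

/-- The `k`-linear structure which belongs to a homomorphism from `k` to the endomorphisms of the
unit. -/
@[reducible] def linearOfUnit (r : k →+* End (𝟙_ C)) : Linear k C where
  homModule X Y :=
    { smul := fun c f => scal (r c) X ≫ f
      one_smul := fun f => by
        change scal (r 1) X ≫ f = f
        rw [map_one, End.one_def, scal_id, Category.id_comp]
      mul_smul := fun c d f => by
        change scal (r (c * d)) X ≫ f = scal (r c) X ≫ scal (r d) X ≫ f
        rw [mul_comm, map_mul, End.mul_def, scal_comp, Category.assoc]
      smul_zero := fun c => comp_zero
      smul_add := fun c f g => Preadditive.comp_add _ _ _ _ _ _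
      add_smul := fun c d f => by
        change scal (r (c + d)) X ≫ f = scal (r c) X ≫ f + scal (r d) X ≫ f
        rw [map_add, scal_add, Preadditive.add_comp]
      zero_smul := fun f => by
        change scal (r 0) X ≫ f = 0
        rw [map_zero, scal_zero, zero_comp] }
  smul_comp X Y Z c f g := Category.assoc _ _ _
  comp_smul X Y Z f c g := by
    change f ≫ scal (r c) Y ≫ g = scal (r c) X ≫ f ≫ g
    rw [← Category.assoc, ← Category.assoc, scal_naturality]

lemma monoidalLinear_linearOfUnit [BraidedCategory C] (r : k →+* End (𝟙_ C)) :
    letI := linearOfUnit r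
    MonoidalLinear k C := by
  let _ := linearOfUnit r
  refine ⟨fun X Y Z c f => ?_, fun c Y Z f X => ?_⟩
  · change X ◁ (scal (r c) Y ≫ f) = scal (r c) (X ⊗ Y) ≫ X ◁ f
    rw [whiskerLeft_comp, whiskerLeft_scal]
  · change (scal (r c) Y ≫ f) ▷ X = scal (r c) (Y ⊗ X) ≫ f ▷ X
    rw [comp_whiskerRight, scal_whiskerRight]

variable {T : Type w₁} [Category.{w₂} T] [Preadditive T] [Linear k T] [MonoidalCategory T]
  [MonoidalPreadditive T] [MonoidalLinear k T]

/-- The scalars on the unit of the target of a monoidal functor. -/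
def unitScalars (F : T ⥤ C) [F.Monoidal] [F.Additive] : k →+* End (𝟙_ C) where
  toFun c := ε F ≫ F.map (c • 𝟙 (𝟙_ T)) ≫ η F
  map_one' := by
    rw [one_smul, F.map_id, Category.id_comp]
    exact Functor.Monoidal.ε_η F
  map_mul' c d := by
    rw [End.mul_def]
    simp only [Category.assoc, Functor.Monoidal.η_ε_assoc, ← F.map_comp_assoc]
    rw [Linear.smul_comp, Category.id_comp, ← mul_smul, mul_comm]
  map_zero' := by simp
  map_add' c d := by
    rw [add_smul, F.map_add, Preadditive.add_comp, Preadditive.comp_add]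

/-- A scalar multiple of `𝟙 X` is the action of the scalar on the unit, tensored with `X`. A
monoidal functor carries this action to the action of the transported scalar. -/
lemma linear_unitScalars (F : T ⥤ C) [F.Monoidal] [F.Additive] :
    letI : Linear k C := linearOfUnit (unitScalars F)
    F.Linear k := by
  let _ : Linear k C := linearOfUnit (unitScalars F)
  rw [Functor.linear_iff]
  intro X c
  have h : c • 𝟙 X = scal (c • 𝟙 (𝟙_ T)) X := by simp [scal]
  rw [h]
  refine Eq.trans ?_ (Category.comp_id (scal (unitScalars F c) (F.obj X))).symm
  change _ = (λ_ _).inv ≫ (ε F ≫ F.map (c • 𝟙 (𝟙_ T)) ≫ η F) ▷ F.obj X ≫ (λ_ _).hom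
  simp only [scal, Functor.map_comp, Functor.Monoidal.map_leftUnitor_inv,
    Functor.Monoidal.map_whiskerRight, Functor.Monoidal.map_leftUnitor, comp_whiskerRight,
    Category.assoc, Functor.Monoidal.μ_δ_assoc]

end linear

/-! ### Additive presheaves on an essentially small monoidal category -/

section smallModel
open Monoidal
variable (E : Type w₁) [Category.{w₂} E] [EssentiallySmall.{v} E] [Preadditive E]
  [MonoidalCategory E] [SymmetricCategory E] [MonoidalPreadditive E]

/-- A small symmetric monoidal category which is equivalent to `E`. -/
abbrev SmallMonoidal : Type v := Transported (equivSmallModel.{v} E)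

instance : Preadditive (SmallMonoidal.{w₁, w₂, v} E) :=
  .ofFullyFaithful (equivalenceTransported (equivSmallModel.{v} E)).fullyFaithfulInverse

instance : (equivalenceTransported (equivSmallModel.{v} E)).inverse.Additive :=
  (equivalenceTransported (equivSmallModel.{v} E)).fullyFaithfulInverse.additive_ofFullyFaithful

instance : (equivalenceTransported (equivSmallModel.{v} E)).functor.Additive :=
  have : (equivalenceTransported (equivSmallModel.{v} E)).symm.functor.Additive :=
    inferInstanceAs (equivalenceTransported (equivSmallModel.{v} E)).inverse.Additive
  (equivalenceTransported (equivSmallModel.{v} E)).symm.inverse_additive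

instance : MonoidalPreadditive (SmallMonoidal.{w₁, w₂, v} E) :=
  monoidalPreadditive_of_faithful (equivalenceTransported (equivSmallModel.{v} E)).inverse

/-- The embedding of an essentially small category into its category of additive presheaves. -/
@[reducible] def toAddMod : E ⥤ AddMod.{v, u} (SmallMonoidal.{w₁, w₂, v} E) :=
  (equivalenceTransported (equivSmallModel.{v} E)).functor ⋙ AddMod.yon _

lemma toAddMod_obj_isZero {X : E} (h : IsZero ((toAddMod.{w₁, w₂, v, u} E).obj X)) : IsZero X := by
  have h1 := AddMod.yon_obj_isZero h
  rw [IsZero.iff_id_eq_zero] at h1 ⊢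
  apply (equivalenceTransported (equivSmallModel.{v} E)).functor.map_injective
  rw [CategoryTheory.Functor.map_id, h1, Functor.map_zero]

end smallModel

/-! ### The tensor functor defined by an algebra over which all sequences split -/

section
variable {T : Type u} [Category.{v} T] [EssentiallySmall.{v} T] [Abelian T]
  [MonoidalCategory T] [SymmetricCategory T] [MonoidalPreadditive T]

/-- The free modules on objects of `T`. -/
def isFreeOn (A : CommMon (Ind T)) : ObjectProperty (Kl A.X) := fun M =>
  ∃ x : T, Nonempty (M.of ≅ Ind.yoneda.obj x)

instance (A : CommMon (Ind T)) : (isFreeOn A).IsMonoidal where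
  prop_unit := ⟨𝟙_ T, ⟨Functor.Monoidal.εIso Ind.yoneda⟩⟩
  prop_tensor := by
    rintro _ _ ⟨x, ⟨e⟩⟩ ⟨y, ⟨f⟩⟩
    exact ⟨x ⊗ y, ⟨(e ⊗ᵢ f) ≪≫ Functor.Monoidal.μIso Ind.yoneda x y⟩⟩

/-- The category of free modules on objects of `T`. -/
abbrev FreeOn (A : CommMon (Ind T)) := (isFreeOn A).FullSubcategory

/-- Each object is isomorphic to the free module on an object of a small model of `T`. -/
instance (A : CommMon (Ind T)) : EssentiallySmall.{v} (FreeOn A) := by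
  let F : SmallModel.{v} T → FreeOn A := fun s =>
    ⟨⟨Ind.yoneda.obj ((equivSmallModel T).inverse.obj s)⟩, _, ⟨Iso.refl _⟩⟩
  have : (inducedFunctor F).EssSurj := ⟨fun M => by
    obtain ⟨x, ⟨e⟩⟩ := M.property
    exact ⟨(equivSmallModel T).functor.obj x, ⟨(isFreeOn A).isoMk (Kl.ofIso
      (Ind.yoneda.mapIso ((equivSmallModel T).unitIso.symm.app x) ≪≫ e.symm))⟩⟩⟩
  have : (inducedFunctor F).IsEquivalence := {}
  have h := (inducedFunctor F).asEquivalence.symm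
  exact .mk' h

/-- The functor `X ↦ A ⊗ X`. -/
@[reducible] def toFree (A : CommMon (Ind T)) : T ⥤ Kl A.X := Ind.yoneda ⋙ Kl.free A.X

/-- The functor `X ↦ A ⊗ X` to the category of free modules on objects of `T`. -/
@[reducible] def toFreeOn (A : CommMon (Ind T)) : T ⥤ FreeOn A :=
  (isFreeOn A).lift (toFree A) (fun x => ⟨x, ⟨Iso.refl _⟩⟩)

instance (A : CommMon (Ind T)) : (toFreeOn A).Additive where
  map_add {X Y f g} := by
    apply (isFreeOn A).hom_ext
    exact (toFree A).map_add

open Functor in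
instance (A : CommMon (Ind T)) : (toFreeOn A).Monoidal := CoreMonoidal.toMonoidal
  { εIso := (isFreeOn A).isoMk (Monoidal.εIso (toFree A))
    μIso X Y := (isFreeOn A).isoMk (Monoidal.μIso (toFree A) X Y)
    μIso_hom_natural_left f X := (isFreeOn A).hom_ext (LaxMonoidal.μ_natural_left (toFree A) f X)
    μIso_hom_natural_right X f := (isFreeOn A).hom_ext (LaxMonoidal.μ_natural_right (toFree A) X f)
    associativity X Y Z := (isFreeOn A).hom_ext (LaxMonoidal.associativity (toFree A) X Y Z)
    left_unitality X := (isFreeOn A).hom_ext (LaxMonoidal.left_unitality (toFree A) X)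
    right_unitality X := (isFreeOn A).hom_ext (LaxMonoidal.right_unitality (toFree A) X) }

open Functor in
instance (A : CommMon (Ind T)) : (toFreeOn A).Braided where
  braided X Y := (isFreeOn A).hom_ext (LaxBraided.braided (F := toFree A) X Y)

lemma toFree_map_comp_val {A : CommMon (Ind T)} {X Y : T} {Z : Kl A.X} (f : X ⟶ Y)
    (g : (toFree A).obj Y ⟶ Z) : ((toFree A).map f ≫ g).val = Ind.yoneda.map f ≫ g.val :=
  Kl.ofHom_comp_val _ _

/-- The image of a splitting under a second functor. -/
def splittingComp {C₁ C₂ C₃ : Type*} [Category* C₁] [Category* C₂] [Category* C₃] [Preadditive C₁]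
    [Preadditive C₂] [Preadditive C₃] (F : C₁ ⥤ C₂) (G : C₂ ⥤ C₃) [F.Additive] [G.Additive]
    {S : ShortComplex C₁} (s : (S.map F).Splitting) : (S.map (F ⋙ G)).Splitting := s.map G

lemma isZero_of_one_eq_zero {D : Type*} [Category* D] [Preadditive D] [MonoidalCategory D]
    [MonoidalPreadditive D] (A : D) [MonObj A] (h : MonObj.one (X := A) = 0) : IsZero A := by
  rw [IsZero.iff_id_eq_zero, ← cancel_epi (λ_ A).hom, Category.comp_id, ← MonObj.one_mul, h]
  simp

open MonObj in
/-- A short exact sequence which splits over `A` splits in the category of free modules. -/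
lemma SplitsOver.nonempty_splitting {A : CommMon (Ind T)} {S : ShortComplex T}
    (hS : S.ShortExact) (h : SplitsOver A S) : Nonempty (S.map (toFreeOn A)).Splitting := by
  have : Epi S.g := hS.epi_g
  have hg := (CokernelCofork.mapIsColimit _ hS.gIsCokernel (Ind.yoneda (C := T)))
  have : Epi (Ind.yoneda.map S.g) := inferInstance
  obtain ⟨r, hr⟩ : ∃ r : A.X ⊗ Ind.yoneda.obj S.X₂ ⟶ A.X ⊗ Ind.yoneda.obj S.X₁,
      A.X ◁ Ind.yoneda.map S.f ≫ r = 𝟙 _ := by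
    obtain ⟨⟨r, hr⟩⟩ := h
    exact ⟨r.hom, congrArg Mod.Hom.hom hr⟩
  -- A Kleisli morphism is the restriction of an `A`-linear one along the unit of `A`.
  let r' : (toFree A).obj S.X₂ ⟶ (toFree A).obj S.X₁ :=
    ⟨(λ_ (Ind.yoneda.obj S.X₂)).inv ≫ η[A.X] ▷ Ind.yoneda.obj S.X₂ ≫ r⟩
  have h1 : (toFree A).map S.f ≫ r' = 𝟙 _ := by
    ext
    rw [toFree_map_comp_val, Kl.id_val]
    dsimp only [r']
    rw [leftUnitor_inv_naturality_assoc, whisker_exchange_assoc, hr, Category.comp_id]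
    rfl
  have h2 : Ind.yoneda.map S.f ≫ (𝟙 ((toFree A).obj S.X₂) - r' ≫ (toFree A).map S.f).val = 0 := by
    rw [← toFree_map_comp_val, Preadditive.comp_sub,
      ← Category.assoc ((toFree A).map S.f) r', h1, Category.id_comp, Category.comp_id, sub_self]
    rfl
  -- The idempotent complementary to the retraction vanishes on `U`. The embedding into `Ind T`
  -- preserves the cokernel `g`, so the idempotent factors through `W`; the factor is the section.
  obtain ⟨s, hs⟩ : ∃ s : Ind.yoneda.obj S.X₃ ⟶ A.X ⊗ Ind.yoneda.obj S.X₂,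
      Ind.yoneda.map S.g ≫ s = (𝟙 ((toFree A).obj S.X₂) - r' ≫ (toFree A).map S.f).val :=
    ⟨hg.desc (CokernelCofork.ofπ _ h2), hg.fac (CokernelCofork.ofπ _ h2) WalkingParallelPair.one⟩
  let s' : (toFree A).obj S.X₃ ⟶ (toFree A).obj S.X₂ := ⟨s⟩
  have h3 : (toFree A).map S.g ≫ s' = 𝟙 _ - r' ≫ (toFree A).map S.f := by
    ext
    rw [toFree_map_comp_val, ← hs]
  have h4 : s' ≫ (toFree A).map S.g = 𝟙 _ := by
    ext
    rw [← cancel_epi (Ind.yoneda.map S.g), ← toFree_map_comp_val, ← toFree_map_comp_val]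
    rw [← Category.assoc, h3, Preadditive.sub_comp, Category.assoc, ← Functor.map_comp, S.zero,
      Functor.map_zero, comp_zero, sub_zero, Category.comp_id, Category.id_comp]
  exact ⟨{
    r := ObjectProperty.homMk r'
    s := ObjectProperty.homMk s'
    f_r := (isFreeOn A).hom_ext h1
    s_g := (isFreeOn A).hom_ext h4
    id := (isFreeOn A).hom_ext (show r' ≫ (toFree A).map S.f + (toFree A).map S.g ≫ s' = 𝟙 _ by
      rw [h3, add_sub_cancel]) }⟩

/-- A non-zero algebra over which every short exact sequence splits gives a tensor functor which
splits all short exact sequences. -/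
lemma locallySemisimple_of_splitsOver {k : Type w} [Field k] [Linear k T] [MonoidalLinear k T]
    (A : CommMon (Ind T)) (hA : ¬ IsZero A.X)
    (h : ∀ S : ShortComplex T, S.ShortExact → SplitsOver A S) :
    LocallySemisimple.{max u (v + 1), v} k T := by
  -- Presheaves on the small category of free modules supply an abelian target without a tensor
  -- product of arbitrary `A`-modules.
  let F : T ⥤ AddMod.{v, u} (SmallMonoidal (FreeOn A)) := toFreeOn A ⋙ toAddMod (FreeOn A)
  -- The scalars are those which `F` transports from the unit of `T`, which makes `F` linear.
  let _ : Linear k (AddMod.{v, u} (SmallMonoidal (FreeOn A))) := linearOfUnit (unitScalars F)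
  have hF : ∀ S : ShortComplex T, S.ShortExact → Nonempty (S.map F).Splitting := fun S hS => by
    obtain ⟨s⟩ := (h S hS).nonempty_splitting hS
    exact ⟨splittingComp (toFreeOn A) (toAddMod (FreeOn A)) s⟩
  refine ⟨AddMod.{v, u} (SmallMonoidal (FreeOn A)), inferInstance, inferInstance, inferInstance,
    inferInstance, inferInstance, inferInstance, monoidalLinear_linearOfUnit _, inferInstance,
    fun h0 => hA ?_, F, inferInstance, linear_unitScalars F, ?_, inferInstance, hF⟩
  -- If the unit of the target is zero, then so is the free module on `𝟙`. Its identity is given by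
  -- the unit of `A`, so `A` is zero.
  · have h1 : IsZero ((toFreeOn A).obj (𝟙_ T)) :=
      toAddMod_obj_isZero _ (h0.of_iso (Functor.Monoidal.εIso F).symm)
    have h2 := congrArg (fun f => f.hom.val) ((IsZero.iff_id_eq_zero _).1 h1)
    have h3 : (λ_ _).inv ≫ MonObj.one (X := A.X) ▷ Ind.yoneda.obj (𝟙_ T) = 0 := h2
    have h4 : MonObj.one (X := A.X) ▷ Ind.yoneda.obj (𝟙_ T) = 0 := by
      rw [← cancel_epi (λ_ _).inv, h3, comp_zero]
    apply isZero_of_one_eq_zero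
    rw [← cancel_epi (ρ_ _).hom, ← rightUnitor_naturality, comp_zero,
      ← cancel_epi (𝟙_ (Ind T) ◁ (Functor.Monoidal.εIso (Ind.yoneda (C := T))).inv),
      whisker_exchange_assoc, h4, zero_comp, comp_zero]
  -- Right exactness is tested on short exact sequences, and their images are split exact.
  · refine ((Functor.preservesFiniteColimits_tfae F).out 0 3).1 (fun S hS => ?_)
    obtain ⟨s⟩ := hF S hS
    exact ⟨s.shortExact.exact, s.shortExact.epi_g⟩

end

/-! ### Powers of a morphism to a commutative algebra -/

section
variable {D : Type u} [Category.{v} D] [MonoidalCategory D]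
open MonObj

/-- The `n`-fold product of a morphism `ρ : Z ⟶ A` to a monoid. -/
def powMul {A Z : D} [MonObj A] (ρ : Z ⟶ A) : (n : ℕ) → (tensorPow n Z ⟶ A)
  | 0 => one
  | n + 1 => (powMul ρ n ⊗ₘ ρ) ≫ mul

lemma unitTensorPow_powMul {A Z : D} [MonObj A] (ρ : Z ⟶ A) (β : 𝟙_ D ⟶ Z) (h : β ≫ ρ = one)
    (n : ℕ) : unitTensorPow β n ≫ powMul ρ n = one := by
  induction n with
  | zero => exact Category.id_comp _
  | succ n ih =>
    change ((λ_ (𝟙_ D)).inv ≫ (unitTensorPow β n ⊗ₘ β)) ≫ (powMul ρ n ⊗ₘ ρ) ≫ mul = one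
    rw [Category.assoc, tensorHom_comp_tensorHom_assoc, ih, h, MonoidalCategory.tensorHom_def',
      Category.assoc, one_mul, leftUnitor_naturality, Iso.inv_hom_id_assoc]

variable [BraidedCategory D]

/-- By associativity the last two factors `ρ` are multiplied first, and their product is
commutative. -/
lemma swap_mul {A P Z : D} [MonObj A] [IsCommMonObj A] (p : P ⟶ A) (ρ : Z ⟶ A) :
    ((α_ P Z Z).hom ≫ P ◁ (β_ Z Z).hom ≫ (α_ P Z Z).inv) ≫ (((p ⊗ₘ ρ) ≫ mul) ⊗ₘ ρ) ≫ mul =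
      (((p ⊗ₘ ρ) ≫ mul) ⊗ₘ ρ) ≫ mul := by
  have h : (((p ⊗ₘ ρ) ≫ mul) ⊗ₘ ρ) = ((p ⊗ₘ ρ) ⊗ₘ ρ) ≫ mul ▷ A := by
    rw [← tensorHom_id, tensorHom_comp_tensorHom, Category.comp_id]
  have h2 := swap_naturality p ρ ρ
  simp only [Category.assoc] at h2 ⊢
  rw [h, Category.assoc, MonObj.mul_assoc, reassoc_of% h2, Iso.inv_hom_id_assoc,
    ← whiskerLeft_comp_assoc, IsCommMonObj.mul_comm]

lemma adjSwap_powMul {A Z : D} [MonObj A] [IsCommMonObj A] (ρ : Z ⟶ A) (n i : ℕ) :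
    adjSwap Z n i ≫ powMul ρ n = powMul ρ n := by
  induction n with
  | zero => exact Category.id_comp _
  | succ n ih =>
    obtain _ | n := n
    · exact Category.id_comp _
    · by_cases hi : i = n
      · rw [hi, adjSwap_last]
        exact swap_mul (powMul ρ n) ρ
      · rw [adjSwap_of_ne _ hi]
        change adjSwap Z (n + 1) i ▷ Z ≫ (powMul ρ (n + 1) ⊗ₘ ρ) ≫ mul =
          (powMul ρ (n + 1) ⊗ₘ ρ) ≫ mul
        rw [← tensorHom_id, tensorHom_comp_tensorHom_assoc, ih, Category.id_comp]

end

section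
variable {C : Type u} [Category.{v} C] [MonoidalCategory C] {D : Type w₁} [Category.{w₂} D]
  [MonoidalCategory D] (F : C ⥤ D) [F.Monoidal]

lemma unitTensorPow_tensorFamIso {X : C} (α : 𝟙_ C ⟶ X) (n : ℕ) :
    unitTensorPow (Functor.LaxMonoidal.ε F ≫ F.map α) n ≫ (tensorFamIso F n (fun _ => X)).hom =
      Functor.LaxMonoidal.ε F ≫ F.map (unitTensorPow α n) := by
  induction n with
  | zero =>
    exact (Category.id_comp _).trans ((Category.comp_id _).symm.trans
      (congrArg (Functor.LaxMonoidal.ε F ≫ ·) (F.map_id (𝟙_ C)).symm))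
  | succ n ih =>
    change ((λ_ (𝟙_ D)).inv ≫ (unitTensorPow (Functor.LaxMonoidal.ε F ≫ F.map α) n ⊗ₘ
      (Functor.LaxMonoidal.ε F ≫ F.map α))) ≫ (tensorFamIso F n (fun _ => X)).hom ▷ F.obj X ≫
        Functor.LaxMonoidal.μ F _ _ =
      Functor.LaxMonoidal.ε F ≫ F.map ((λ_ (𝟙_ C)).inv ≫ (unitTensorPow α n ⊗ₘ α))
    rw [← tensorHom_id, Category.assoc, tensorHom_comp_tensorHom_assoc, ih, Category.comp_id,
      ← tensorHom_comp_tensorHom_assoc, Functor.LaxMonoidal.μ_natural, F.map_comp]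
    have h : (λ_ (𝟙_ D)).inv ≫ (Functor.LaxMonoidal.ε F ⊗ₘ Functor.LaxMonoidal.ε F) ≫
        Functor.LaxMonoidal.μ F _ _ = Functor.LaxMonoidal.ε F ≫ F.map (λ_ (𝟙_ C)).inv := by
      rw [MonoidalCategory.tensorHom_def', Category.assoc, ← leftUnitor_inv_naturality_assoc,
        Functor.LaxMonoidal.left_unitality_inv]
    rw [reassoc_of% h]

end

section
variable {T : Type u} [Category.{v} T] [EssentiallySmall.{v} T] [Abelian T] [MonoidalCategory T]
  [SymmetricCategory T] [MonoidalPreadditive T] [RightExactTensor T] [RigidConnected T]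
open MonObj

lemma SplitsOver.exists_retraction {A : CommMon (Ind T)} {S : ShortComplex T} (h : SplitsOver A S) :
    ∃ r : A.X ⊗ Ind.yoneda.obj S.X₂ ⟶ A.X ⊗ Ind.yoneda.obj S.X₁,
      A.X ◁ Ind.yoneda.map S.f ≫ r = 𝟙 _ := by
  obtain ⟨⟨r, hr⟩⟩ := h
  exact ⟨r.hom, congrArg Mod.Hom.hom hr⟩

/-- The powers of `α ≠ 0` are not zero if all short exact sequences split over non-zero
commutative algebras. -/
theorem symPowElement_ne_zero_of_splitsOver
    (h : ∀ S : ShortComplex T, S.ShortExact → ∃ A : CommMon (Ind T), ¬ IsZero A.X ∧ SplitsOver A S)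
    {X : T} (n : ℕ) (α : 𝟙_ T ⟶ X) (hα : α ≠ 0) : symPowElement α n ≠ 0 := by
  intro h0
  obtain ⟨A, hA, hS⟩ := h _ (RigidConnected.shortExact_of_ne_zero α hα)
  obtain ⟨r, hr⟩ : ∃ r : A.X ⊗ Ind.yoneda.obj X ⟶ A.X ⊗ Ind.yoneda.obj (𝟙_ T),
      A.X ◁ Ind.yoneda.map α ≫ r = 𝟙 _ := hS.exists_retraction
  let y : T ⥤ Ind T := Ind.yoneda
  -- `ρ` is the retraction of `A ⊗ α`, restricted along the unit of `A` and followed by `A ⊗ 𝟙 ≅ A`;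
  -- it sends `α` to `1`.
  obtain ⟨ρ, hρ⟩ : ∃ ρ : y.obj X ⟶ A.X, (Functor.LaxMonoidal.ε y ≫ y.map α) ≫ ρ = one := by
    refine ⟨(λ_ _).inv ≫ one (X := A.X) ▷ _ ≫ r ≫ A.X ◁ Functor.OplaxMonoidal.η y ≫ (ρ_ _).hom, ?_⟩
    rw [leftUnitor_inv_naturality_assoc, whisker_exchange_assoc, whiskerLeft_comp_assoc,
      reassoc_of% hr, ← whiskerLeft_comp_assoc, Functor.Monoidal.ε_η, whiskerLeft_id,
      Category.id_comp, rightUnitor_naturality, ← unitors_equal, Iso.inv_hom_id_assoc]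
  -- The `n`-fold product of `ρ` is symmetric and descends to `Symⁿ X`, where it sends `αⁿ` to `1`.
  -- If `αⁿ = 0`, then `1 = 0` in `A`.
  obtain ⟨g, hg⟩ := map_symPow_desc y (powMul ρ n) (fun i => adjSwap_powMul ρ n i)
  refine hA (isZero_of_one_eq_zero A.X ?_)
  rw [← unitTensorPow_powMul ρ _ hρ n, ← Iso.hom_inv_id_assoc (tensorFamIso y n _) (powMul ρ n), ← hg,
    ← Category.assoc, unitTensorPow_tensorFamIso, Category.assoc, ← Functor.map_comp_assoc]
  have : unitTensorPow α n ≫ symPowπ n X = 0 := h0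
  rw [this, Functor.map_zero, zero_comp, comp_zero]

end

/-! ### Symmetric powers built one factor at a time -/

section
variable {C : Type u} [Category.{v} C] [MonoidalCategory C] [BraidedCategory C]

/-- The braiding of the last two factors. -/
def rightSwap (P X : C) : (P ⊗ X) ⊗ X ⟶ (P ⊗ X) ⊗ X :=
  (α_ P X X).hom ≫ P ◁ (β_ X X).hom ≫ (α_ P X X).inv

lemma rightSwap_naturality {P Q X Y : C} (p : P ⟶ Q) (a : X ⟶ Y) :
    rightSwap P X ≫ ((p ⊗ₘ a) ⊗ₘ a) = ((p ⊗ₘ a) ⊗ₘ a) ≫ rightSwap Q Y :=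
  swap_naturality p a a

lemma rightSwap_whiskerRight {P Q : C} (p : P ⟶ Q) (X : C) :
    rightSwap P X ≫ p ▷ X ▷ X = p ▷ X ▷ X ≫ rightSwap Q X := by
  simpa using rightSwap_naturality p (𝟙 X)

lemma whiskerLeft_rightSwap (R P X : C) :
    R ◁ rightSwap P X ≫ (α_ R (P ⊗ X) X).inv ≫ (α_ R P X).inv ▷ X =
      (α_ R (P ⊗ X) X).inv ≫ (α_ R P X).inv ▷ X ≫ rightSwap (R ⊗ P) X := by
  unfold rightSwap
  simp only [MonoidalCategory.whiskerLeft_comp, Category.assoc]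
  have h : (α_ R (P ⊗ X) X).inv ≫ (α_ R P X).inv ▷ X ≫ (α_ (R ⊗ P) X X).hom =
      R ◁ (α_ P X X).hom ≫ (α_ R P (X ⊗ X)).inv := by monoidal
  rw [reassoc_of% h, ← associator_inv_naturality_right_assoc]
  monoidal

end

section
variable {C : Type u} [Category.{v} C] [Abelian C] [MonoidalCategory C] [SymmetricCategory C]
  [MonoidalPreadditive C] [RightExactTensor C]

attribute [local instance] Abelian.hasFiniteBiproducts

lemma whiskerLeft_symPow_desc {n : ℕ} {X Y Z : C} (f : Y ⊗ tensorPow n X ⟶ Z)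
    (hf : ∀ i : Fin (n - 1), Y ◁ adjSwap X n i ≫ f = f) :
    ∃ g : Y ⊗ symPow n X ⟶ Z, Y ◁ symPowπ n X ≫ g = f := by
  have h0 : Y ◁ (biproduct.desc (fun i : Fin (n - 1) => adjSwap X n i - 𝟙 (tensorPow n X))) ≫
      f = 0 := by
    refine map_hom_eq_zero (tensorLeft Y) (biproduct.ι (fun _ : Fin (n - 1) => tensorPow n X))
      (fun a ha => biproduct.hom_ext' _ _ (fun i => (ha i).trans comp_zero.symm)) _ (fun i => ?_)
    change Y ◁ _ ≫ _ = 0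
    have h : Y ◁ (adjSwap X n i - 𝟙 _) = Y ◁ adjSwap X n i - 𝟙 _ :=
      ((tensorLeft Y).map_sub).trans (congrArg (_ - ·) ((tensorLeft Y).map_id _))
    rw [← whiskerLeft_comp_assoc, biproduct.ι_desc, h, Preadditive.sub_comp, hf, Category.id_comp,
      sub_self]
  obtain ⟨g, hg⟩ := CokernelCofork.IsColimit.desc' (CokernelCofork.mapIsColimit _
    (cokernelIsCokernel (biproduct.desc
      (fun i : Fin (n - 1) => adjSwap X n i - 𝟙 (tensorPow n X)))) (tensorLeft Y)) f h0
  exact ⟨g, hg⟩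

lemma symPowπ_whiskerRight_desc {n : ℕ} {X Y Z : C} (f : tensorPow n X ⊗ Y ⟶ Z)
    (hf : ∀ i : Fin (n - 1), adjSwap X n i ▷ Y ≫ f = f) :
    ∃ g : symPow n X ⊗ Y ⟶ Z, symPowπ n X ▷ Y ≫ g = f := by
  obtain ⟨g, hg⟩ := whiskerLeft_symPow_desc ((β_ Y _).hom ≫ f) (fun i => by
    rw [BraidedCategory.braiding_naturality_right_assoc, hf])
  refine ⟨(β_ _ _).hom ≫ g, ?_⟩
  rw [BraidedCategory.braiding_naturality_left_assoc, hg, SymmetricCategory.symmetry_assoc]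

/-- The relations of `Symⁿ X`, tensored with `X`, are among those of `Symⁿ⁺¹ X`. -/
lemma exists_symSnoc (n : ℕ) (X : C) : ∃ s : symPow n X ⊗ X ⟶ symPow (n + 1) X,
    symPowπ n X ▷ X ≫ s = symPowπ (n + 1) X :=
  symPowπ_whiskerRight_desc _ (fun i => by
    obtain _ | n := n
    · exact i.elim0
    · have h := adjSwap_symPowπ (n + 2) X ⟨i, by have := i.2; omega⟩
      rwa [adjSwap_of_ne X (by have := i.2; dsimp at this ⊢; omega)] at h)

/-- The multiplication `Symⁿ X ⊗ X ⟶ Symⁿ⁺¹ X`. -/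
def symSnoc (n : ℕ) (X : C) : symPow n X ⊗ X ⟶ symPow (n + 1) X :=
  Classical.choose (exists_symSnoc n X)

variable (n : ℕ) (X : C)

/-- The projection onto `Symⁿ⁺¹ X`. -/
def symPowπ₁ : tensorPow n X ⊗ X ⟶ symPow (n + 1) X := symPowπ (n + 1) X

/-- The projection onto `Symⁿ⁺² X`. -/
def symPowπ₂ : (tensorPow n X ⊗ X) ⊗ X ⟶ symPow (n + 2) X := symPowπ (n + 2) X

instance epi_symPowπ₁ : Epi (symPowπ₁ n X) := inferInstanceAs (Epi (symPowπ (n + 1) X))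

lemma symPowπ_symSnoc : symPowπ n X ▷ X ≫ symSnoc n X = symPowπ₁ n X :=
  Classical.choose_spec (exists_symSnoc n X)

lemma symPowπ₁_symSnoc : symPowπ₁ n X ▷ X ≫ symSnoc (n + 1) X = symPowπ₂ n X :=
  symPowπ_symSnoc (n + 1) X

lemma rightSwap_symPowπ₂ : rightSwap (tensorPow n X) X ≫ symPowπ₂ n X = symPowπ₂ n X := by
  have h := adjSwap_symPowπ (n + 2) X ⟨n, by omega⟩
  rw [adjSwap_last] at h
  exact h

variable {n X}

lemma whiskerLeft_symPowπ₂_desc {Y Z : C} (f : Y ⊗ ((tensorPow n X ⊗ X) ⊗ X) ⟶ Z)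
    (h1 : Y ◁ rightSwap _ X ≫ f = f)
    (h2 : ∀ a : tensorPow n X ⊗ X ⟶ tensorPow n X ⊗ X, a ≫ symPowπ₁ n X = symPowπ₁ n X →
      Y ◁ a ▷ X ≫ f = f) : ∃ g : Y ⊗ symPow (n + 2) X ⟶ Z, Y ◁ symPowπ₂ n X ≫ g = f :=
  whiskerLeft_symPow_desc (n := n + 2) (X := X) f (fun i => by
    by_cases hi : (i : ℕ) = n
    · rw [hi, adjSwap_last]
      exact h1
    · rw [adjSwap_of_ne X hi]
      exact h2 _ (adjSwap_symPowπ (n + 1) X ⟨i, by have := i.2; omega⟩))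

variable (n X)

instance epi_symSnoc : Epi (symSnoc n X) := by
  have : Epi (symPowπ n X ▷ X ≫ symSnoc n X) := by
    rw [symPowπ_symSnoc]
    infer_instance
  exact epi_of_epi (symPowπ n X ▷ X) _

/-- The unit `𝟙 ⟶ Sym⁰ X`. -/
def symNil : 𝟙_ C ⟶ symPow 0 X := symPowπ 0 X

instance isIso_symNil : IsIso (symNil X) := by
  have : Epi (symNil X) := inferInstanceAs (Epi (symPowπ 0 X))
  obtain ⟨g, hg⟩ : ∃ g : symPow 0 X ⟶ 𝟙_ C, symNil X ≫ g = 𝟙 _ :=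
    symPow_desc (n := 0) (X := X) (𝟙 (tensorPow 0 X)) (fun i => i.elim0)
  have : IsSplitMono (symNil X) := ⟨⟨⟨g, hg⟩⟩⟩
  exact isIso_of_epi_of_isSplitMono _

instance isIso_symSnoc_zero : IsIso (symSnoc 0 X) := by
  obtain ⟨g, hg⟩ : ∃ g : symPow 1 X ⟶ symPow 0 X ⊗ X, symPowπ₁ 0 X ≫ g = symPowπ 0 X ▷ X :=
    symPow_desc (n := 1) (X := X) (symPowπ 0 X ▷ X) (fun i => i.elim0)
  have : Epi (symPowπ 0 X ▷ X) := epi_whiskerRight _ _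
  have : IsSplitMono (symSnoc 0 X) := ⟨⟨⟨g, by
    rw [← cancel_epi (symPowπ 0 X ▷ X), ← Category.assoc, symPowπ_symSnoc, Category.comp_id, hg]⟩⟩⟩
  exact isIso_of_epi_of_isSplitMono _

lemma rightSwap_symSnoc : rightSwap (symPow n X) X ≫
    symSnoc n X ▷ X ≫ symSnoc (n + 1) X = symSnoc n X ▷ X ≫ symSnoc (n + 1) X := by
  have : Epi (symPowπ n X ▷ X) := epi_whiskerRight _ _
  have : Epi (symPowπ n X ▷ X ▷ X) := epi_whiskerRight _ _
  rw [← cancel_epi (symPowπ n X ▷ X ▷ X), ← Category.assoc, ← rightSwap_whiskerRight,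
    Category.assoc, ← comp_whiskerRight_assoc, symPowπ_symSnoc, symPowπ₁_symSnoc,
    rightSwap_symPowπ₂]

variable {n X}

/-- `Symⁿ⁺² X` is the quotient of `Symⁿ⁺¹ X ⊗ X` by the one relation that the last two factors
commute: all other relations hold already in `Symⁿ⁺¹ X`. Tensoring with `Y` preserves this by right
exactness. It allows the product to be defined by recursion. -/
lemma whiskerLeft_symSnoc_desc {Y Z : C} (f : Y ⊗ (symPow (n + 1) X ⊗ X) ⟶ Z)
    (hf : Y ◁ (rightSwap _ X) ≫ Y ◁ symSnoc n X ▷ X ≫ f = Y ◁ symSnoc n X ▷ X ≫ f) :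
    ∃ g : Y ⊗ symPow (n + 2) X ⟶ Z, Y ◁ symSnoc (n + 1) X ≫ g = f := by
  have h : symPowπ₁ n X ▷ X = symPowπ n X ▷ X ▷ X ≫ symSnoc n X ▷ X := by
    rw [← symPowπ_symSnoc, comp_whiskerRight]
  obtain ⟨g, hg⟩ := whiskerLeft_symPowπ₂_desc (n := n) (X := X) (Y ◁ (symPowπ₁ n X ▷ X) ≫ f)
    (by
      rw [h, MonoidalCategory.whiskerLeft_comp, Category.assoc, ← whiskerLeft_comp_assoc,
        rightSwap_whiskerRight, whiskerLeft_comp_assoc, hf])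
    (fun a ha => by rw [← whiskerLeft_comp_assoc, ← comp_whiskerRight, ha])
  refine ⟨g, ?_⟩
  have : Epi (symPowπ₁ n X ▷ X) := epi_whiskerRight _ _
  have : Epi (Y ◁ (symPowπ₁ n X ▷ X)) := epi_whiskerLeft _ _
  rw [← cancel_epi (Y ◁ (symPowπ₁ n X ▷ X)), ← hg, ← whiskerLeft_comp_assoc, symPowπ₁_symSnoc]

end

/-! ### The multiplication of the symmetric algebra -/

section
variable {C : Type u} [Category.{v} C] [Abelian C] [MonoidalCategory C] [SymmetricCategory C]
  [MonoidalPreadditive C] [RightExactTensor C]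

lemma exists_symMap {X Y : C} (n : ℕ) (f : X ⟶ Y) : ∃ g : symPow n X ⟶ symPow n Y,
    symPowπ n X ≫ g = tensorFamMap n (fun _ => f) ≫ symPowπ n Y :=
  symPow_desc _ (fun i => by
    obtain ⟨σ, hσ⟩ := adjSwap_naturality (C := C) n i
    rw [← Category.assoc, hσ, Category.assoc, adjSwap_symPowπ])

/-- The action of a morphism on symmetric powers. -/
def symMap {X Y : C} (n : ℕ) (f : X ⟶ Y) : symPow n X ⟶ symPow n Y :=
  Classical.choose (exists_symMap n f)

lemma symPowπ_symMap {X Y : C} (n : ℕ) (f : X ⟶ Y) :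
    symPowπ n X ≫ symMap n f = tensorFamMap n (fun _ => f) ≫ symPowπ n Y :=
  Classical.choose_spec (exists_symMap n f)

lemma symMap_id (n : ℕ) (X : C) : symMap n (𝟙 X) = 𝟙 _ := by
  rw [← cancel_epi (symPowπ n X), symPowπ_symMap, tensorFamMap_id, Category.id_comp,
    Category.comp_id]

lemma symMap_comp {X Y Z : C} (n : ℕ) (f : X ⟶ Y) (g : Y ⟶ Z) :
    symMap n (f ≫ g) = symMap n f ≫ symMap n g := by
  rw [← cancel_epi (symPowπ n X), symPowπ_symMap, ← Category.assoc, symPowπ_symMap, Category.assoc,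
    symPowπ_symMap, ← Category.assoc, tensorFamMap_comp]

lemma symNil_symMap {X Y : C} (f : X ⟶ Y) : symNil X ≫ symMap 0 f = symNil Y :=
  (symPowπ_symMap 0 f).trans (Category.id_comp _)

lemma symSnoc_symMap {X Y : C} (n : ℕ) (f : X ⟶ Y) :
    symSnoc n X ≫ symMap (n + 1) f = (symMap n f ⊗ₘ f) ≫ symSnoc n Y := by
  have : Epi (symPowπ n X ▷ X) := epi_whiskerRight _ _
  have h : symPowπ₁ n X ≫ symMap (n + 1) f = (tensorFamMap n (fun _ => f) ⊗ₘ f) ≫ symPowπ₁ n Y :=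
    symPowπ_symMap (n + 1) f
  rw [← cancel_epi (symPowπ n X ▷ X), ← Category.assoc, symPowπ_symSnoc, h, ← symPowπ_symSnoc,
    ← tensorHom_id, ← tensorHom_id, tensorHom_comp_tensorHom_assoc, tensorHom_comp_tensorHom_assoc,
    symPowπ_symMap, Category.id_comp, Category.comp_id]

/-- The rule `x · (y · t) = (x · y) · t` defines the next product, since two appended factors may be
exchanged in the target (`rightSwap_symSnoc`). The hypothesis on `b` lets both appended factors be
seen. -/
lemma symMul_step {n m p : ℕ} {X : C} (a : symPow n X ⊗ symPow m X ⟶ symPow p X)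
    (b : symPow n X ⊗ symPow (m + 1) X ⟶ symPow (p + 1) X)
    (hab : symPow n X ◁ symSnoc m X ≫ b = (α_ _ _ _).inv ≫ a ▷ X ≫ symSnoc p X) :
    ∃ c : symPow n X ⊗ symPow (m + 2) X ⟶ symPow (p + 2) X,
      symPow n X ◁ symSnoc (m + 1) X ≫ c = (α_ _ _ _).inv ≫ b ▷ X ≫ symSnoc (p + 1) X := by
  refine whiskerLeft_symSnoc_desc _ ?_
  have h : symPow n X ◁ symSnoc m X ▷ X ≫ (α_ _ _ _).inv ≫ b ▷ X ≫ symSnoc (p + 1) X =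
      (α_ _ _ _).inv ≫ (α_ _ _ _).inv ▷ X ≫ a ▷ X ▷ X ≫ symSnoc p X ▷ X ≫ symSnoc (p + 1) X := by
    rw [associator_inv_naturality_middle_assoc, ← comp_whiskerRight_assoc, hab]
    simp
  rw [h, reassoc_of% whiskerLeft_rightSwap, ← Category.assoc (rightSwap _ _),
    rightSwap_whiskerRight, Category.assoc, rightSwap_symSnoc]

/-- Recursion on `m` by `symMul_step`. The degree `p` is a variable subject to `n + m = p`, so that
associativity and commutativity can be stated without transport between degrees. -/
lemma exists_symMul (n : ℕ) (X : C) :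
    ∃ μ : ∀ m p : ℕ, n + m = p → (symPow n X ⊗ symPow m X ⟶ symPow p X),
      (∀ h : n + 0 = n, symPow n X ◁ symNil X ≫ μ 0 n h = (ρ_ _).hom) ∧
      ∀ (m p : ℕ) (h : n + m = p) (h' : n + (m + 1) = p + 1),
        symPow n X ◁ symSnoc m X ≫ μ (m + 1) (p + 1) h' =
          (α_ _ _ _).inv ≫ μ m p h ▷ X ≫ symSnoc p X := by
  classical
  -- The default value `0` is never used: `hbase` proves, along the recursion, that the required
  -- extension exists.
  let next : ∀ m : ℕ, (symPow n X ⊗ symPow m X ⟶ symPow (n + m) X) →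
      (symPow n X ⊗ symPow (m + 1) X ⟶ symPow (n + m + 1) X) := fun m a =>
    if h : ∃ b, symPow n X ◁ symSnoc m X ≫ b = (α_ _ _ _).inv ≫ a ▷ X ≫ symSnoc (n + m) X then
      h.choose else 0
  have hnext : ∀ m a, (∃ b, symPow n X ◁ symSnoc m X ≫ b =
      (α_ _ _ _).inv ≫ a ▷ X ≫ symSnoc (n + m) X) →
      symPow n X ◁ symSnoc m X ≫ next m a = (α_ _ _ _).inv ≫ a ▷ X ≫ symSnoc (n + m) X := by
    intro m a h
    dsimp only [next]
    rw [dif_pos h]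
    exact h.choose_spec
  let base : ∀ m : ℕ, symPow n X ⊗ symPow m X ⟶ symPow (n + m) X := fun m =>
    Nat.rec (motive := fun m => symPow n X ⊗ symPow m X ⟶ symPow (n + m) X)
      (symPow n X ◁ inv (symNil X) ≫ (ρ_ _).hom) next m
  have hbase : ∀ m, symPow n X ◁ symSnoc m X ≫ next m (base m) =
      (α_ _ _ _).inv ≫ base m ▷ X ≫ symSnoc (n + m) X := by
    intro m
    refine hnext m _ ?_
    induction m with
    -- In degree one there is no relation to check, as `Sym⁰ X ⊗ X ≅ Sym¹ X`.
    | zero => exact ⟨inv (symPow n X ◁ symSnoc 0 X) ≫ (α_ _ _ _).inv ≫ base 0 ▷ X ≫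
        symSnoc (n + 0) X, IsIso.hom_inv_id_assoc _ _⟩
    | succ m ih => exact symMul_step (base m) (next m (base m)) (hnext m _ ih)
  refine ⟨fun m p h => base m ≫ eqToHom (by rw [h]), fun h => ?_, fun m p h h' => ?_⟩
  · change symPow n X ◁ symNil X ≫ (symPow n X ◁ inv (symNil X) ≫ (ρ_ _).hom) ≫ 𝟙 _ = _
    rw [Category.comp_id, ← whiskerLeft_comp_assoc, IsIso.hom_inv_id, whiskerLeft_id,
      Category.id_comp]
  · subst h
    refine (congrArg (_ ≫ ·) (Category.comp_id _)).trans ((hbase m).trans ?_)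
    simp

/-- The multiplication `Symⁿ X ⊗ Symᵐ X ⟶ Symᵖ X` for `n + m = p`. -/
def symMul (X : C) {n m p : ℕ} (h : n + m = p) : symPow n X ⊗ symPow m X ⟶ symPow p X :=
  Classical.choose (exists_symMul n X) m p h

lemma symNil_symMul (X : C) {n : ℕ} (h : n + 0 = n) :
    symPow n X ◁ symNil X ≫ symMul X h = (ρ_ _).hom :=
  (Classical.choose_spec (exists_symMul n X)).1 h

lemma symSnoc_symMul (X : C) {n m p : ℕ} (h : n + m = p) (h' : n + (m + 1) = p + 1) :
    symPow n X ◁ symSnoc m X ≫ symMul X h' = (α_ _ _ _).inv ≫ symMul X h ▷ X ≫ symSnoc p X :=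
  (Classical.choose_spec (exists_symMul n X)).2 m p h h'

instance epi_whiskerLeft_symSnoc (Y X : C) (n : ℕ) : Epi (Y ◁ symSnoc n X) := epi_whiskerLeft _ _

lemma symMul_naturality {X Y : C} (f : X ⟶ Y) {n m p : ℕ} (h : n + m = p) :
    (symMap n f ⊗ₘ symMap m f) ≫ symMul Y h = symMul X h ≫ symMap p f := by
  induction m generalizing p with
  | zero =>
    obtain rfl : n = p := h
    rw [← cancel_epi (symPow n X ◁ symNil X), ← Category.assoc, ← Category.assoc, symNil_symMul,
      ← id_tensorHom, tensorHom_comp_tensorHom, symNil_symMap, Category.id_comp,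
      ← rightUnitor_naturality, ← symNil_symMul Y rfl, ← tensorHom_id, ← id_tensorHom,
      tensorHom_comp_tensorHom_assoc]
    simp
  | succ m ih =>
    obtain _ | p := p
    · omega
    · have h1 : n + m = p := by omega
      rw [← cancel_epi (symPow n X ◁ symSnoc m X), ← Category.assoc, ← Category.assoc,
        symSnoc_symMul X h1, ← id_tensorHom, tensorHom_comp_tensorHom, symSnoc_symMap,
        Category.id_comp, Category.assoc, Category.assoc, symSnoc_symMap]
      have h2 : (symMap n f ⊗ₘ ((symMap m f ⊗ₘ f) ≫ symSnoc m Y)) =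
          (symMap n f ⊗ₘ (symMap m f ⊗ₘ f)) ≫ symPow n Y ◁ symSnoc m Y := by
        rw [← id_tensorHom, tensorHom_comp_tensorHom, Category.comp_id]
      rw [h2, Category.assoc, symSnoc_symMul Y h1, associator_inv_naturality_assoc, ← tensorHom_id,
        tensorHom_comp_tensorHom_assoc, ih h1, Category.comp_id, ← tensorHom_id,
        tensorHom_comp_tensorHom_assoc, Category.id_comp]

/-- Induction on `p`: a factor appended to the third argument becomes, on both sides, a factor
appended to the product. -/
lemma symMul_assoc (X : C) {n m p a b c : ℕ} (h₁ : n + m = a) (h₂ : a + p = c) (h₃ : m + p = b)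
    (h₄ : n + b = c) : symMul X h₁ ▷ symPow p X ≫ symMul X h₂ =
      (α_ _ _ _).hom ≫ symPow n X ◁ symMul X h₃ ≫ symMul X h₄ := by
  induction p generalizing b c with
  | zero =>
    obtain rfl : m = b := h₃
    obtain rfl : a = c := h₂
    rw [← cancel_epi (_ ◁ symNil X), whisker_exchange_assoc, symNil_symMul,
      associator_naturality_right_assoc, ← whiskerLeft_comp_assoc, symNil_symMul,
      rightUnitor_naturality]
    simp
  | succ p ih =>
    obtain _ | c := c
    · omega
    obtain _ | b := b
    · omega
    have h₂' : a + p = c := by omega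
    have h₃' : m + p = b := by omega
    have h₄' : n + b = c := by omega
    rw [← cancel_epi (_ ◁ symSnoc p X), whisker_exchange_assoc, symSnoc_symMul X h₂',
      associator_naturality_right_assoc, ← whiskerLeft_comp_assoc, symSnoc_symMul X h₃',
      MonoidalCategory.whiskerLeft_comp, MonoidalCategory.whiskerLeft_comp, Category.assoc,
      Category.assoc, symSnoc_symMul X h₄', associator_inv_naturality_left_assoc,
      ← comp_whiskerRight_assoc, ih h₂' h₃' h₄', associator_inv_naturality_middle_assoc]
    simp

lemma symNil_symMul_left (X : C) {m : ℕ} (h : 0 + m = m) :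
    symNil X ▷ symPow m X ≫ symMul X h = (λ_ _).hom := by
  induction m with
  | zero =>
    rw [← cancel_epi (_ ◁ symNil X), whisker_exchange_assoc, symNil_symMul, rightUnitor_naturality,
      leftUnitor_naturality, unitors_equal]
  | succ m ih =>
    have h' : 0 + m = m := by omega
    rw [← cancel_epi (_ ◁ symSnoc m X), whisker_exchange_assoc, symSnoc_symMul X h',
      associator_inv_naturality_left_assoc, ← comp_whiskerRight_assoc, ih, leftUnitor_naturality]
    simp

/-- In terms of elements, `(x · t) · y = (x · y) · t`. For `y` with one more factor, the induction
hypothesis and one exchange of the last two factors suffice. This is the essential step for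
commutativity. -/
lemma symSnoc_whiskerRight_symMul (X : C) {n m p : ℕ} (h : n + m = p) (h' : n + 1 + m = p + 1) :
    symSnoc n X ▷ symPow m X ≫ symMul X h' =
      (α_ _ _ _).hom ≫ symPow n X ◁ (β_ X (symPow m X)).hom ≫ (α_ _ _ _).inv ≫
        symMul X h ▷ X ≫ symSnoc p X := by
  induction m generalizing p with
  | zero =>
    obtain rfl : n = p := h
    rw [← cancel_epi (_ ◁ symNil X), whisker_exchange_assoc, symNil_symMul,
      associator_naturality_right_assoc, ← whiskerLeft_comp_assoc,
      BraidedCategory.braiding_naturality_right, whiskerLeft_comp_assoc,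
      associator_inv_naturality_middle_assoc, ← comp_whiskerRight_assoc, symNil_symMul,
      rightUnitor_naturality]
    simp
  | succ m ih =>
    obtain _ | p := p
    · omega
    have h1 : n + m = p := by omega
    have h2 : n + 1 + m = p + 1 := by omega
    rw [← cancel_epi (_ ◁ symSnoc m X), whisker_exchange_assoc, symSnoc_symMul X h2,
      associator_naturality_right_assoc, ← whiskerLeft_comp_assoc,
      BraidedCategory.braiding_naturality_right, whiskerLeft_comp_assoc,
      associator_inv_naturality_middle_assoc, ← comp_whiskerRight_assoc (symPow n X ◁ symSnoc m X),
      symSnoc_symMul X h1, associator_inv_naturality_left_assoc, ← comp_whiskerRight_assoc, ih h1 h2]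
    simp only [comp_whiskerRight, Category.assoc]
    conv_lhs => rw [← rightSwap_symSnoc, ← Category.assoc (symMul X h1 ▷ X ▷ X),
      ← rightSwap_whiskerRight, Category.assoc]
    have hc : (α_ (symPow n X ⊗ X) (symPow m X) X).inv ≫ (α_ (symPow n X) X (symPow m X)).hom ▷ X ≫
        (symPow n X ◁ (β_ X (symPow m X)).hom) ▷ X ≫ (α_ (symPow n X) (symPow m X) X).inv ▷ X ≫
          rightSwap (symPow n X ⊗ symPow m X) X =
        (α_ (symPow n X) X (symPow m X ⊗ X)).hom ≫
          symPow n X ◁ (β_ X (symPow m X ⊗ X)).hom ≫ (α_ (symPow n X) (symPow m X ⊗ X) X).inv ≫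
            (α_ (symPow n X) (symPow m X) X).inv ▷ X := by
      unfold rightSwap
      rw [BraidedCategory.braiding_tensor_right_hom]
      simp only [MonoidalCategory.whiskerLeft_comp, Category.assoc]
      monoidal
    rw [reassoc_of% hc]

lemma symMul_comm (X : C) {n m p : ℕ} (h : n + m = p) (h' : m + n = p) :
    (β_ _ _).hom ≫ symMul X h' = symMul X h := by
  induction m generalizing p with
  | zero =>
    obtain rfl : n = p := h
    rw [← cancel_epi (_ ◁ symNil X), BraidedCategory.braiding_naturality_right_assoc,
      symNil_symMul_left, symNil_symMul]
    simp
  | succ m ih =>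
    obtain _ | p := p
    · omega
    have h1 : n + m = p := by omega
    have h2 : m + n = p := by omega
    rw [← cancel_epi (_ ◁ symSnoc m X), BraidedCategory.braiding_naturality_right_assoc,
      symSnoc_whiskerRight_symMul X h2, symSnoc_symMul X h1, ← ih h1 h2]
    rw [BraidedCategory.braiding_tensor_right_hom]
    simp [← whiskerLeft_comp_assoc]

/-- The multiplication with `α : 𝟙 ⟶ X` on symmetric powers. -/
def symStep {X : C} (α : 𝟙_ C ⟶ X) (n : ℕ) : symPow n X ⟶ symPow (n + 1) X :=
  (ρ_ _).inv ≫ symPow n X ◁ α ≫ symSnoc n X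

lemma symStep_naturality {X Y : C} (α : 𝟙_ C ⟶ X) (f : X ⟶ Y) (n : ℕ) :
    symStep α n ≫ symMap (n + 1) f = symMap n f ≫ symStep (α ≫ f) n := by
  unfold symStep
  rw [Category.assoc, Category.assoc, symSnoc_symMap, MonoidalCategory.tensorHom_def,
    Category.assoc, whisker_exchange_assoc, rightUnitor_inv_naturality_assoc,
    MonoidalCategory.whiskerLeft_comp, Category.assoc]

/-- Multiplication by `α` is linear over the symmetric algebra, so the product passes to the colimit
along it. -/
lemma symStep_symMul {X : C} (α : 𝟙_ C ⟶ X) {n m p : ℕ} (h : n + m = p)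
    (h' : n + (m + 1) = p + 1) :
    symPow n X ◁ symStep α m ≫ symMul X h' = symMul X h ≫ symStep α p := by
  unfold symStep
  rw [MonoidalCategory.whiskerLeft_comp, MonoidalCategory.whiskerLeft_comp, Category.assoc,
    Category.assoc, symSnoc_symMul X h, associator_inv_naturality_right_assoc,
    whisker_exchange_assoc, rightUnitor_inv_naturality_assoc]
  simp

lemma symStep_whiskerRight_symMul {X : C} (α : 𝟙_ C ⟶ X) {n m p : ℕ} (h : n + m = p)
    (h' : n + 1 + m = p + 1) :
    symStep α n ▷ symPow m X ≫ symMul X h' = symMul X h ≫ symStep α p := by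
  have h1 : m + n = p := by omega
  have h2 : m + (n + 1) = p + 1 := by omega
  rw [← symMul_comm X h' h2, ← symMul_comm X h h1, BraidedCategory.braiding_naturality_left_assoc,
    symStep_symMul α h1, Category.assoc]

lemma symPowElement_symStep {X : C} (α : 𝟙_ C ⟶ X) (n : ℕ) :
    symPowElement α n ≫ symStep α n = symPowElement α (n + 1) := by
  have h : symPowElement α (n + 1) = ((λ_ (𝟙_ C)).inv ≫ (unitTensorPow α n ⊗ₘ α)) ≫
    symPowπ₁ n X := rfl
  rw [h, ← symPowπ_symSnoc]
  unfold symPowElement symStep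
  rw [rightUnitor_inv_naturality_assoc, comp_whiskerRight_assoc, unitors_inv_equal,
    MonoidalCategory.tensorHom_def, Category.assoc, Category.assoc, whisker_exchange_assoc]

lemma symPowElement_zero {X : C} (α : 𝟙_ C ⟶ X) : symPowElement α 0 = symNil X :=
  Category.id_comp _

end

/-! ### Filtered colimits in `Ind T` and commutative algebras -/

section
variable {T : Type u} [Category.{v} T] {J : Type v} [SmallCategory J] [IsFiltered J] (Φ : J ⥤ T)

lemma essImage_colimit : (Ind.inclusion T).essImage (colimit (Φ ⋙ yoneda)) :=
  mem_essImage_inclusion ⟨⟨.ofCocone (colimit.cocone (Φ ⋙ yoneda)) (colimit.isColimit _)⟩⟩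

/-- The filtered colimit of a diagram in `T`, as an ind-object. -/
def indColim : Ind T := (essImage_colimit Φ).witness

/-- The presheaf underlying a filtered colimit. -/
def indColimIso : colimit (Φ ⋙ yoneda) ≅ (Ind.inclusion T).obj (indColim Φ) :=
  (essImage_colimit Φ).getIso.symm

/-- The defining presentation of a filtered colimit. -/
def indColimPresentation : IndObjectPresentation ((Ind.inclusion T).obj (indColim Φ)) :=
  (IndObjectPresentation.ofCocone (colimit.cocone (Φ ⋙ yoneda)) (colimit.isColimit _)).extend
    (indColimIso Φ).hom

/-- The morphisms to a filtered colimit. -/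
def colimLeg (j : J) : Ind.yoneda.obj (Φ.obj j) ⟶ indColim Φ := leg (indColimPresentation Φ) j

lemma map_colimLeg {i j : J} (f : i ⟶ j) :
    Ind.yoneda.map (Φ.map f) ≫ colimLeg Φ j = colimLeg Φ i :=
  map_leg (indColimPresentation Φ) f

lemma exists_colimLeg {x : T} (a : Ind.yoneda.obj x ⟶ indColim Φ) :
    ∃ (i : J) (u : x ⟶ Φ.obj i), a = Ind.yoneda.map u ≫ colimLeg Φ i :=
  exists_leg (indColimPresentation Φ) a

/-- Two morphisms from an object of `T` which agree in a filtered colimit agree at some stage. This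
will detect whether the unit of the algebra vanishes. -/
lemma exists_eq_of_map_leg_eq {A : Ind T} (P : IndObjectPresentation ((Ind.inclusion T).obj A))
    {x : T} {i j : P.I} (u : x ⟶ P.F.obj i) (w : x ⟶ P.F.obj j)
    (h : Ind.yoneda.map u ≫ leg P i = Ind.yoneda.map w ≫ leg P j) :
    ∃ (k : P.I) (f : i ⟶ k) (g : j ⟶ k), u ≫ P.F.map f = w ≫ P.F.map g := by
  refine gen_eq P u w ?_
  have := congrArg indElt h
  rwa [indElt_map_comp, indElt_map_comp, leg, leg, indElt_ofElt, indElt_ofElt] at this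

lemma exists_eq_of_map_colimLeg_eq {x : T} {i j : J} (u : x ⟶ Φ.obj i) (w : x ⟶ Φ.obj j)
    (h : Ind.yoneda.map u ≫ colimLeg Φ i = Ind.yoneda.map w ≫ colimLeg Φ j) :
    ∃ (k : J) (f : i ⟶ k) (g : j ⟶ k), u ≫ Φ.map f = w ≫ Φ.map g := by
  exact exists_eq_of_map_leg_eq (indColimPresentation Φ) u w h

variable [EssentiallySmall.{v} T] [MonoidalCategory T]

lemma exists_colim_tensor_desc {C : Ind T}
    (h : ∀ i j, Ind.yoneda.obj (Φ.obj i ⊗ Φ.obj j) ⟶ C)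
    (hc : ∀ {i i' j j' : J} (f : i ⟶ i') (g : j ⟶ j'),
      Ind.yoneda.map (Φ.map f ⊗ₘ Φ.map g) ≫ h i' j' = h i j) :
    ∃ φ : indColim Φ ⊗ indColim Φ ⟶ C, ∀ i j, boxHom (colimLeg Φ i) (colimLeg Φ j) ≫ φ = h i j :=
  exists_tensor_desc (indColimPresentation Φ) (indColimPresentation Φ) h hc

lemma colim_tensor_hom_ext {A C : Ind T} {f g : A ⊗ indColim Φ ⟶ C}
    (h : ∀ {x : T} (a : Ind.yoneda.obj x ⟶ A) (j : J),
      boxHom a (colimLeg Φ j) ≫ f = boxHom a (colimLeg Φ j) ≫ g) : f = g := by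
  refine tensor_hom_ext (fun x x' a b => ?_)
  obtain ⟨j, u, rfl⟩ := exists_colimLeg Φ b
  have h1 : boxHom a (Ind.yoneda.map u ≫ colimLeg Φ j) =
      Ind.yoneda.map (𝟙 x ⊗ₘ u) ≫ boxHom a (colimLeg Φ j) := by
    rw [map_boxHom, CategoryTheory.Functor.map_id, Category.id_comp]
  rw [h1, Category.assoc, Category.assoc, h]

end

section
variable {T : Type u} [Category.{v} T] [EssentiallySmall.{v} T] [MonoidalCategory T]
  [SymmetricCategory T] {J : Type v} [SmallCategory J] [IsFiltered J] (Φ : J ⥤ T)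

lemma boxHom_comp_whiskerRight {x x' : T} {A B A' : Ind T} (a : Ind.yoneda.obj x ⟶ A)
    (b : Ind.yoneda.obj x' ⟶ B) (f : A ⟶ A') : boxHom a b ≫ f ▷ B = boxHom (a ≫ f) b := by
  rw [← tensorHom_id, boxHom_tensorHom, Category.comp_id]

lemma boxHom_comp_whiskerLeft {x x' : T} {A B B' : Ind T} (a : Ind.yoneda.obj x ⟶ A)
    (b : Ind.yoneda.obj x' ⟶ B) (f : B ⟶ B') : boxHom a b ≫ A ◁ f = boxHom a (b ≫ f) := by
  rw [← id_tensorHom, boxHom_tensorHom, Category.comp_id]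

lemma boxHom_map_left {x x' z : T} {A B : Ind T} (f : z ⟶ x) (a : Ind.yoneda.obj x ⟶ A)
    (b : Ind.yoneda.obj x' ⟶ B) :
    boxHom (Ind.yoneda.map f ≫ a) b = Ind.yoneda.map (f ▷ x') ≫ boxHom a b := by
  rw [← tensorHom_id, map_boxHom, CategoryTheory.Functor.map_id, Category.id_comp]

lemma boxHom_map_right {x x' z : T} {A B : Ind T} (f : z ⟶ x') (a : Ind.yoneda.obj x ⟶ A)
    (b : Ind.yoneda.obj x' ⟶ B) :
    boxHom a (Ind.yoneda.map f ≫ b) = Ind.yoneda.map (x ◁ f) ≫ boxHom a b := by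
  rw [← id_tensorHom, map_boxHom, CategoryTheory.Functor.map_id, Category.id_comp]

/-- The Kan extension is pointwise, so an element of `A ⊗ B` is represented at a single object of
the indexing category of its colimit formula. -/
lemma exists_boxHom {x : T} {A B : Ind T} (a : Ind.yoneda.obj x ⟶ A ⊗ B) :
    ∃ (z z' : T) (u : x ⟶ z ⊗ z') (b : Ind.yoneda.obj z ⟶ A) (c : Ind.yoneda.obj z' ⟶ B),
      a = Ind.yoneda.map u ≫ boxHom b c := by
  obtain ⟨j, p, hp⟩ := Types.jointly_surjective _
    (LawfulDayConvolutionMonoidalCategoryStruct.isPointwiseLeftKanExtensionConvolutionExtensionUnit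
      A B (op x)) (indElt a)
  obtain ⟨b, hb⟩ := (indElt_bijective j.left.1.unop A).2 p.1
  obtain ⟨c, hc⟩ := (indElt_bijective j.left.2.unop B).2 p.2
  refine ⟨j.left.1.unop, j.left.2.unop, j.hom.unop, b, c, (indElt_bijective _ _).1 ?_⟩
  refine hp.symm.trans (.symm ?_)
  rw [indElt_map_comp, indElt_boxHom, hb, hc]
  rfl

/-- The commutative algebra structure on a filtered colimit given by a multiplication on the
diagram which is commutative, associative and unital up to passage to the colimit. -/
lemma exists_commMon_indColim (k : J → J → J) (m : ∀ i j, Φ.obj i ⊗ Φ.obj j ⟶ Φ.obj (k i j)) (o : J)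
    (e : 𝟙_ T ⟶ Φ.obj o)
    (map_left : ∀ {i i' : J} (f : i ⟶ i') (j : J), Ind.yoneda.map (Φ.map f ▷ Φ.obj j) ≫
      Ind.yoneda.map (m i' j) ≫ colimLeg Φ _ = Ind.yoneda.map (m i j) ≫ colimLeg Φ _)
    (comm : ∀ i j : J, Ind.yoneda.map (β_ _ _).hom ≫ Ind.yoneda.map (m j i) ≫ colimLeg Φ _ =
      Ind.yoneda.map (m i j) ≫ colimLeg Φ _)
    (unit : ∀ i : J, Ind.yoneda.map (e ▷ Φ.obj i) ≫ Ind.yoneda.map (m o i) ≫ colimLeg Φ _ =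
      Ind.yoneda.map (λ_ (Φ.obj i)).hom ≫ colimLeg Φ i)
    (assoc : ∀ i j l : J, Ind.yoneda.map (m i j ▷ Φ.obj l) ≫ Ind.yoneda.map (m (k i j) l) ≫
      colimLeg Φ _ = Ind.yoneda.map (α_ _ _ _).hom ≫ Ind.yoneda.map (Φ.obj i ◁ m j l) ≫
        Ind.yoneda.map (m i (k j l)) ≫ colimLeg Φ _) :
    ∃ A : CommMon (Ind T), ∃ ι : ∀ j, Ind.yoneda.obj (Φ.obj j) ⟶ A.X,
      (∀ {i j : J} (f : i ⟶ j), Ind.yoneda.map (Φ.map f) ≫ ι j = ι i) ∧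
      (∀ {x : T} {i j : J} (u : x ⟶ Φ.obj i) (w : x ⟶ Φ.obj j),
        Ind.yoneda.map u ≫ ι i = Ind.yoneda.map w ≫ ι j →
        ∃ (k : J) (f : i ⟶ k) (g : j ⟶ k), u ≫ Φ.map f = w ≫ Φ.map g) ∧
      unitLeg T ≫ MonObj.one (X := A.X) = Ind.yoneda.map e ≫ ι o := by
  obtain ⟨μ, hμ⟩ := exists_colim_tensor_desc Φ (fun i j => Ind.yoneda.map (m i j) ≫ colimLeg Φ _)
    (fun {i i' j j'} f g => by
      -- Compatibility in the second variable follows from the first by commutativity.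
      have h : Ind.yoneda.map (Φ.obj i' ◁ Φ.map g) ≫ Ind.yoneda.map (m i' j') ≫ colimLeg Φ _ =
          Ind.yoneda.map (m i' j) ≫ colimLeg Φ _ := by
        rw [← comm i' j', ← Functor.map_comp_assoc, BraidedCategory.braiding_naturality_right,
          Functor.map_comp_assoc, map_left, comm]
      rw [MonoidalCategory.tensorHom_def, Functor.map_comp, Category.assoc, h, map_left])
  obtain ⟨η, hη⟩ : ∃ η : 𝟙_ (Ind T) ⟶ indColim Φ, unitLeg T ≫ η = Ind.yoneda.map e ≫ colimLeg Φ o :=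
    ⟨inv (unitLeg T) ≫ Ind.yoneda.map e ≫ colimLeg Φ o, IsIso.hom_inv_id_assoc _ _⟩
  have hcomm : (β_ _ _).hom ≫ μ = μ := by
    refine colim_tensor_hom_ext Φ (fun a j => ?_)
    obtain ⟨i, u, rfl⟩ := exists_colimLeg Φ a
    rw [← Category.assoc, boxHom_braiding, boxHom_map_left, boxHom_map_right, Category.assoc,
      Category.assoc, Category.assoc, hμ, hμ, ← comm i j]
    have h : Ind.yoneda.map (β_ _ _).hom ≫ Ind.yoneda.map (Φ.obj j ◁ u) =
        Ind.yoneda.map (u ▷ Φ.obj j) ≫ Ind.yoneda.map (β_ _ _).hom := by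
      rw [← Functor.map_comp, ← Functor.map_comp, BraidedCategory.braiding_naturality_left]
    rw [reassoc_of% h]
  have hone : η ▷ _ ≫ μ = (λ_ _).hom := by
    refine colim_tensor_hom_ext Φ (fun {x} a j => ?_)
    obtain ⟨f, rfl⟩ : ∃ f : Ind.yoneda.obj x ⟶ Ind.yoneda.obj (𝟙_ T), a = f ≫ unitLeg T :=
      ⟨a ≫ inv (unitLeg T), by simp⟩
    obtain ⟨f, rfl⟩ := Ind.yoneda.map_surjective f
    rw [boxHom_map_left, Category.assoc, Category.assoc, boxHom_leftUnitor,
      ← Category.assoc (boxHom _ _), boxHom_comp_whiskerRight, hη, boxHom_map_left, Category.assoc,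
      hμ, unit]
  have hassoc : μ ▷ _ ≫ μ = (α_ _ _ _).hom ≫ _ ◁ μ ≫ μ := by
    refine colim_tensor_hom_ext Φ (fun {x} a l => ?_)
    obtain ⟨z, z', u, b, c, rfl⟩ := exists_boxHom a
    obtain ⟨i, b, rfl⟩ := exists_colimLeg Φ b
    obtain ⟨j, c, rfl⟩ := exists_colimLeg Φ c
    rw [← map_boxHom, ← Functor.map_comp_assoc, boxHom_map_left, Category.assoc, Category.assoc]
    refine congrArg (_ ≫ ·) ?_
    rw [← Category.assoc, boxHom_comp_whiskerRight, hμ, boxHom_map_left, Category.assoc, hμ,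
      ← Category.assoc (boxHom _ _), boxHom_associator, Category.assoc, ← Category.assoc (boxHom _ _),
      boxHom_comp_whiskerLeft, hμ, boxHom_map_right, Category.assoc, hμ, assoc]
  let _ : MonObj (indColim Φ) :=
    { one := η
      mul := μ
      one_mul := hone
      mul_one := by
        rw [← hcomm, BraidedCategory.braiding_naturality_right_assoc, hone]
        simp
      mul_assoc := hassoc }
  have : IsCommMonObj (indColim Φ) := ⟨hcomm⟩
  exact ⟨⟨indColim Φ⟩, colimLeg Φ, map_colimLeg Φ, exists_eq_of_map_colimLeg_eq Φ, hη⟩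

end

/-! ### The colimit of symmetric powers along multiplication by elements -/

section
variable {T : Type u} [Category.{v} T] [Abelian T] [MonoidalCategory T]
  [SymmetricCategory T] [MonoidalPreadditive T] [RightExactTensor T]
  {K : Type v} [SemilatticeSup K] (Y : K ⥤ T) (a : ∀ k, 𝟙_ T ⟶ Y.obj k)
  (ha : ∀ {k l : K} (f : k ⟶ l), a k ≫ Y.map f = a l)

/-- The symmetric powers of the objects under `𝟙` in a diagram. -/
def symDiagram : K × ℕ ⥤ T :=
  Functor.uncurry.obj
    { obj k := Functor.ofSequence (fun n => symStep (a k) n)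
      map {k l} f := NatTrans.ofSequence (fun n => symMap n (Y.map f)) (fun n => by
        rw [Functor.ofSequence_map_homOfLE_succ, Functor.ofSequence_map_homOfLE_succ]
        exact (symStep_naturality (a k) (Y.map f) n).trans
          (congrArg (fun b => symMap n (Y.map f) ≫ symStep b n) (ha f)))
      map_id k := by
        ext n
        exact (congrArg (symMap n) (Y.map_id k)).trans (symMap_id n _)
      map_comp f g := by
        ext n
        exact (congrArg (symMap n) (Y.map_comp f g)).trans (symMap_comp n _ _) }

/-- The transition morphisms of the diagram of symmetric powers. -/
def symTrans {i j : K × ℕ} (f : i ⟶ j) : symPow i.2 (Y.obj i.1) ⟶ symPow j.2 (Y.obj j.1) :=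
  (symDiagram Y a ha).map f

lemma symTrans_comp {i j l : K × ℕ} (f : i ⟶ j) (g : j ⟶ l) :
    symTrans Y a ha (f ≫ g) = symTrans Y a ha f ≫ symTrans Y a ha g :=
  (symDiagram Y a ha).map_comp f g

lemma symTrans_left {k l : K} (f : k ⟶ l) (n : ℕ) :
    symTrans Y a ha ((f, 𝟙 n) : (k, n) ⟶ (l, n)) = symMap n (Y.map f) :=
  (congrArg (_ ≫ ·) (CategoryTheory.Functor.map_id _ _)).trans (Category.comp_id _)

lemma symTrans_right (k : K) (n : ℕ) :
    symTrans Y a ha ((𝟙 k, homOfLE (Nat.le_add_right n 1)) : (k, n) ⟶ (k, n + 1)) =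
      symStep (a k) n := by
  refine (congrArg (· ≫ _) ((congrArg (symMap n) (Y.map_id k)).trans (symMap_id n _))).trans ?_
  exact (Category.id_comp _).trans (Functor.ofSequence_map_homOfLE_succ _ n)

end

/-! ### Products of symmetric powers of different objects in a diagram -/

section
variable {T : Type u} [Category.{v} T] [Abelian T] [MonoidalCategory T]
  [SymmetricCategory T] [MonoidalPreadditive T] [RightExactTensor T]
  {K : Type v} [SemilatticeSup K] (Y : K ⥤ T)

/-- Multiplication of symmetric powers of objects in a diagram. -/
def symPairing {k k' M : K} (u : k ⟶ M) (w : k' ⟶ M) {n m p : ℕ} (h : n + m = p) :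
    symPow n (Y.obj k) ⊗ symPow m (Y.obj k') ⟶ symPow p (Y.obj M) :=
  (symMap n (Y.map u) ⊗ₘ symMap m (Y.map w)) ≫ symMul (Y.obj M) h

lemma symPairing_symMap {k k' M N : K} (u : k ⟶ M) (w : k' ⟶ M) (g : M ⟶ N) {n m p : ℕ}
    (h : n + m = p) :
    symPairing Y u w h ≫ symMap p (Y.map g) = symPairing Y (u ≫ g) (w ≫ g) h := by
  unfold symPairing
  rw [Category.assoc, ← symMul_naturality, tensorHom_comp_tensorHom_assoc, ← symMap_comp,
    ← symMap_comp, ← Y.map_comp, ← Y.map_comp]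

lemma symMap_symPairing {k l k' M : K} (f : k ⟶ l) (u : l ⟶ M) (w : k' ⟶ M) {n m p : ℕ}
    (h : n + m = p) :
    symMap n (Y.map f) ▷ _ ≫ symPairing Y u w h = symPairing Y (f ≫ u) w h := by
  unfold symPairing
  rw [← tensorHom_id, tensorHom_comp_tensorHom_assoc, ← symMap_comp, Category.id_comp,
    ← Y.map_comp]

lemma whiskerLeft_symMap_symPairing {k l k' M : K} (f : k' ⟶ l) (u : k ⟶ M) (w : l ⟶ M)
    {n m p : ℕ} (h : n + m = p) :
    _ ◁ symMap m (Y.map f) ≫ symPairing Y u w h = symPairing Y u (f ≫ w) h := by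
  unfold symPairing
  rw [← id_tensorHom, tensorHom_comp_tensorHom_assoc, ← symMap_comp, Category.id_comp,
    ← Y.map_comp]

lemma braiding_symPairing {k k' M : K} (u : k ⟶ M) (w : k' ⟶ M) {n m p : ℕ} (h : n + m = p)
    (h' : m + n = p) : (β_ _ _).hom ≫ symPairing Y w u h' = symPairing Y u w h := by
  unfold symPairing
  rw [← BraidedCategory.braiding_naturality_assoc, symMul_comm]

lemma symPairing_assoc {k₁ k₂ k₃ M : K} (u : k₁ ⟶ M) (w : k₂ ⟶ M) (z : k₃ ⟶ M)
    {n m p a b c : ℕ} (h₁ : n + m = a) (h₂ : a + p = c) (h₃ : m + p = b) (h₄ : n + b = c) :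
    symPairing Y u w h₁ ▷ _ ≫ symPairing Y (𝟙 M) z h₂ =
      (α_ _ _ _).hom ≫ _ ◁ symPairing Y w z h₃ ≫ symPairing Y u (𝟙 M) h₄ := by
  unfold symPairing
  rw [Y.map_id, symMap_id, symMap_id, ← tensorHom_id, ← id_tensorHom,
    tensorHom_comp_tensorHom_assoc, tensorHom_comp_tensorHom_assoc, Category.comp_id,
    Category.comp_id, Category.id_comp, Category.id_comp]
  have h1 : ((symMap n (Y.map u) ⊗ₘ symMap m (Y.map w)) ≫ symMul (Y.obj M) h₁) ⊗ₘ
      symMap p (Y.map z) = ((symMap n (Y.map u) ⊗ₘ symMap m (Y.map w)) ⊗ₘ symMap p (Y.map z)) ≫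
        symMul (Y.obj M) h₁ ▷ _ := by
    rw [← tensorHom_id, tensorHom_comp_tensorHom, Category.comp_id]
  have h2 : symMap n (Y.map u) ⊗ₘ ((symMap m (Y.map w) ⊗ₘ symMap p (Y.map z)) ≫
      symMul (Y.obj M) h₃) = (symMap n (Y.map u) ⊗ₘ symMap m (Y.map w) ⊗ₘ symMap p (Y.map z)) ≫
        _ ◁ symMul (Y.obj M) h₃ := by
    rw [← id_tensorHom, tensorHom_comp_tensorHom, Category.comp_id]
  rw [h1, h2, Category.assoc, Category.assoc, symMul_assoc _ h₁ h₂ h₃ h₄,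
    associator_naturality_assoc]

lemma symNil_symPairing {k l M : K} (u : k ⟶ M) (w : l ⟶ M) {n : ℕ} (h : 0 + n = n) :
    symNil (Y.obj k) ▷ _ ≫ symPairing Y u w h = (λ_ _).hom ≫ symMap n (Y.map w) := by
  unfold symPairing
  rw [← tensorHom_id, tensorHom_comp_tensorHom_assoc, symNil_symMap, Category.id_comp,
    MonoidalCategory.tensorHom_def', Category.assoc, symNil_symMul_left, leftUnitor_naturality]

lemma symStep_symPairing {k k' M : K} (u : k ⟶ M) (w : k' ⟶ M) {n m p : ℕ} (h : n + m = p)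
    (h' : n + 1 + m = p + 1) {a : 𝟙_ T ⟶ Y.obj k} {b : 𝟙_ T ⟶ Y.obj M}
    (hab : a ≫ Y.map u = b) :
    symStep a n ▷ _ ≫ symPairing Y u w h' = symPairing Y u w h ≫ symStep b p := by
  unfold symPairing
  rw [← tensorHom_id, tensorHom_comp_tensorHom_assoc, symStep_naturality, hab, Category.id_comp,
    Category.assoc, ← symStep_whiskerRight_symMul _ h h', ← tensorHom_id,
    tensorHom_comp_tensorHom_assoc, Category.comp_id]

end

/-! ### The colimit as a commutative algebra -/

section
variable {T : Type u} [Category.{v} T] [EssentiallySmall.{v} T] [Abelian T] [MonoidalCategory T]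
  [SymmetricCategory T] [MonoidalPreadditive T] [RightExactTensor T]
  {K : Type v} [SemilatticeSup K] [OrderBot K] (Y : K ⥤ T) (a : ∀ k, 𝟙_ T ⟶ Y.obj k)
  (ha : ∀ {k l : K} (f : k ⟶ l), a k ≫ Y.map f = a l)

/-- The morphism of a symmetric power to the colimit. -/
def symLeg (k : K) (n : ℕ) :
    Ind.yoneda.obj (symPow n (Y.obj k)) ⟶ indColim (symDiagram Y a ha) :=
  colimLeg (symDiagram Y a ha) (k, n)

lemma symTrans_symLeg {i j : K × ℕ} (f : i ⟶ j) :
    Ind.yoneda.map (symTrans Y a ha f) ≫ symLeg Y a ha j.1 j.2 = symLeg Y a ha i.1 i.2 :=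
  map_colimLeg (symDiagram Y a ha) f

lemma map_symLeg {k l : K} (f : k ⟶ l) (n : ℕ) :
    Ind.yoneda.map (symMap n (Y.map f)) ≫ symLeg Y a ha l n = symLeg Y a ha k n := by
  rw [← symTrans_left Y a ha]
  exact symTrans_symLeg Y a ha ((f, 𝟙 n) : (k, n) ⟶ (l, n))

lemma step_symLeg (k : K) (n : ℕ) :
    Ind.yoneda.map (symStep (a k) n) ≫ symLeg Y a ha k (n + 1) = symLeg Y a ha k n := by
  rw [← symTrans_right Y a ha]
  exact symTrans_symLeg Y a ha
    ((𝟙 k, homOfLE (Nat.le_add_right n 1)) : (k, n) ⟶ (k, n + 1))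

/-- Parallel morphisms in a partially ordered set are equal, so both products agree after passage to
the join of `M` and `N`. Products may therefore be computed over any common upper bound. -/
lemma pairing_symLeg_eq {k k' M N : K} (u : k ⟶ M) (w : k' ⟶ M) (u' : k ⟶ N) (w' : k' ⟶ N)
    {n m p q : ℕ} (h : n + m = p) (h' : n + m = q) :
    Ind.yoneda.map (symPairing Y u w h) ≫ symLeg Y a ha M p =
      Ind.yoneda.map (symPairing Y u' w' h') ≫ symLeg Y a ha N q := by
  obtain rfl : p = q := h.symm.trans h'
  rw [← map_symLeg Y a ha (homOfLE le_sup_left : M ⟶ M ⊔ N),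
    ← map_symLeg Y a ha (homOfLE le_sup_right : N ⟶ M ⊔ N), ← Functor.map_comp_assoc,
    ← Functor.map_comp_assoc, symPairing_symMap, symPairing_symMap]
  rfl

/-- The multiplication on the filtered colimit of symmetric powers, on the members of the
diagram. -/
def symColimMul (k k' : K) (n m : ℕ) :
    symPow n (Y.obj k) ⊗ symPow m (Y.obj k') ⟶ symPow (n + m) (Y.obj (k ⊔ k')) :=
  symPairing Y (homOfLE le_sup_left) (homOfLE le_sup_right) rfl

lemma symColimMul_symLeg {k k' M : K} (u : k ⟶ M) (w : k' ⟶ M) {n m p : ℕ} (h : n + m = p) :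
    Ind.yoneda.map (symColimMul Y k k' n m) ≫ symLeg Y a ha (k ⊔ k') (n + m) =
      Ind.yoneda.map (symPairing Y u w h) ≫ symLeg Y a ha M p :=
  pairing_symLeg_eq Y a ha _ _ _ _ _ _

/-- Compatibility of the multiplication with a morphism in the diagram. -/
def MulCompatible {k l : K} {n m : ℕ} (f : symPow n (Y.obj k) ⟶ symPow m (Y.obj l)) : Prop :=
  ∀ (k' : K) (p : ℕ), Ind.yoneda.map (f ▷ symPow p (Y.obj k')) ≫
    Ind.yoneda.map (symColimMul Y l k' m p) ≫ symLeg Y a ha _ _ =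
      Ind.yoneda.map (symColimMul Y k k' n p) ≫ symLeg Y a ha _ _

variable {Y a ha} in
lemma MulCompatible.comp {k l l' : K} {n m m' : ℕ} {f : symPow n (Y.obj k) ⟶ symPow m (Y.obj l)}
    {g : symPow m (Y.obj l) ⟶ symPow m' (Y.obj l')} (hf : MulCompatible Y a ha f)
    (hg : MulCompatible Y a ha g) : MulCompatible Y a ha (f ≫ g) := by
  intro k' p
  rw [comp_whiskerRight, Functor.map_comp, Category.assoc, hg, hf]

lemma mulCompatible_left {k l : K} (f : k ⟶ l) (n : ℕ) :
    MulCompatible Y a ha (symMap n (Y.map f)) := by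
  intro k' p
  rw [symColimMul_symLeg Y a ha (f ≫ homOfLE le_sup_left) (homOfLE le_sup_right : k' ⟶ l ⊔ k') rfl,
    ← Functor.map_comp_assoc, symColimMul, symMap_symPairing]

lemma mulCompatible_right (k : K) (n : ℕ) : MulCompatible Y a ha (symStep (a k) n) := by
  intro l m
  have h' : n + 1 + m = n + m + 1 := by omega
  rw [symColimMul_symLeg Y a ha (homOfLE le_sup_left : k ⟶ k ⊔ l) (homOfLE le_sup_right) h',
    symColimMul_symLeg Y a ha (homOfLE le_sup_left : k ⟶ k ⊔ l) (homOfLE le_sup_right) rfl,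
    ← Functor.map_comp_assoc, symStep_symPairing Y _ _ rfl h' (ha _), Functor.map_comp_assoc,
    step_symLeg]

/-- A transition morphism is composed of one in `K` and of successive multiplications by the
element; the induction is on the number of the latter. -/
lemma mulCompatible {i i' : K × ℕ} (f : i ⟶ i') : MulCompatible Y a ha (symTrans Y a ha f) := by
  obtain ⟨k, n⟩ := i
  obtain ⟨l, m⟩ := i'
  obtain ⟨f, g⟩ := f
  change k ⟶ l at f
  change n ⟶ m at g
  obtain ⟨d, rfl⟩ := Nat.exists_eq_add_of_le (leOfHom g)
  induction d with
  | zero =>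
    have h := mulCompatible_left Y a ha f n
    rwa [← symTrans_left Y a ha] at h
  | succ d ih =>
    have h := mulCompatible_right Y a ha l (n + d)
    rw [← symTrans_right Y a ha] at h
    have h' := (ih (homOfLE (Nat.le_add_right n d))).comp h
    rw [← symTrans_comp] at h'
    exact h'

lemma symPowElement_symMap {X Z : T} (α : 𝟙_ T ⟶ X) (f : X ⟶ Z) (n : ℕ) :
    symPowElement α n ≫ symMap n f = symPowElement (α ≫ f) n := by
  induction n with
  | zero => rw [symPowElement_zero, symPowElement_zero, symNil_symMap]
  | succ n ih =>
    rw [← symPowElement_symStep, ← symPowElement_symStep, Category.assoc, symStep_naturality,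
      ← Category.assoc, ih]

/-- The powers of the elements form a compatible family and all represent the unit of the colimit.
-/
lemma symPowElement_symTrans {i j : K × ℕ} (f : i ⟶ j) :
    symPowElement (a i.1) i.2 ≫ symTrans Y a ha f = symPowElement (a j.1) j.2 := by
  obtain ⟨k, n⟩ := i
  obtain ⟨l, m⟩ := j
  obtain ⟨f, g⟩ := f
  change k ⟶ l at f
  change n ⟶ m at g
  obtain ⟨d, rfl⟩ := Nat.exists_eq_add_of_le (leOfHom g)
  induction d with
  | zero =>
    have h := symPowElement_symMap (a k) (Y.map f) n
    rw [ha f, ← symTrans_left Y a ha] at h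
    exact h
  | succ d ih =>
    have h := symPowElement_symStep (a l) (n + d)
    rw [← symTrans_right Y a ha, ← ih (homOfLE (Nat.le_add_right n d)), Category.assoc,
      ← symTrans_comp] at h
    exact h

lemma mul_comm_symLeg (k k' : K) (n m : ℕ) :
    Ind.yoneda.map (β_ _ _).hom ≫ Ind.yoneda.map (symColimMul Y k' k m n) ≫ symLeg Y a ha _ _ =
      Ind.yoneda.map (symColimMul Y k k' n m) ≫ symLeg Y a ha _ _ := by
  rw [symColimMul_symLeg Y a ha (homOfLE le_sup_right) (homOfLE le_sup_left : k ⟶ k ⊔ k')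
    (Nat.add_comm m n), ← Functor.map_comp_assoc, braiding_symPairing _ _ _ rfl]
  rfl

lemma one_mul_symLeg (k : K) (n : ℕ) :
    Ind.yoneda.map (symNil (Y.obj ⊥) ▷ _) ≫ Ind.yoneda.map (symColimMul Y ⊥ k 0 n) ≫
      symLeg Y a ha _ _ = Ind.yoneda.map (λ_ _).hom ≫ symLeg Y a ha k n := by
  rw [symColimMul_symLeg Y a ha (homOfLE bot_le) (𝟙 k) (Nat.zero_add n), ← Functor.map_comp_assoc,
    symNil_symPairing, Y.map_id, symMap_id, Category.comp_id]

lemma mul_assoc_symLeg (k₁ k₂ k₃ : K) (n m p : ℕ) :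
    Ind.yoneda.map (symColimMul Y k₁ k₂ n m ▷ _) ≫
      Ind.yoneda.map (symColimMul Y (k₁ ⊔ k₂) k₃ (n + m) p) ≫ symLeg Y a ha _ _ =
    Ind.yoneda.map (α_ _ _ _).hom ≫ Ind.yoneda.map (_ ◁ symColimMul Y k₂ k₃ m p) ≫
      Ind.yoneda.map (symColimMul Y k₁ (k₂ ⊔ k₃) n (m + p)) ≫ symLeg Y a ha _ _ := by
  let M := k₁ ⊔ k₂ ⊔ k₃
  have h₁ : k₁ ≤ M := le_sup_left.trans le_sup_left
  have h₂ : k₂ ≤ M := le_sup_right.trans le_sup_left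
  have h₃ : k₃ ≤ M := le_sup_right
  rw [symColimMul_symLeg Y a ha (homOfLE (sup_le h₁ h₂) ≫ 𝟙 M) (homOfLE h₃) rfl,
    symColimMul_symLeg Y a ha (homOfLE h₁) (homOfLE (sup_le h₂ h₃) ≫ 𝟙 M)
      (Nat.add_assoc n m p).symm,
    ← symMap_symPairing, ← whiskerLeft_symMap_symPairing, ← Functor.map_comp_assoc,
    ← Functor.map_comp_assoc, ← Functor.map_comp_assoc, ← comp_whiskerRight_assoc,
    Category.assoc (α_ _ _ _).hom, ← MonoidalCategory.whiskerLeft_comp_assoc, symColimMul, symColimMul,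
    symPairing_symMap, symPairing_symMap, symPairing_assoc Y _ _ _ _ _ rfl (Nat.add_assoc n m p).symm]
  rfl

/-- The commutative algebra obtained as the filtered colimit of the symmetric powers of the
objects in a diagram of objects under `𝟙`, along the multiplication with the given elements. -/
lemma exists_symColim (ha : ∀ {k l : K} (f : k ⟶ l), a k ≫ Y.map f = a l) :
    ∃ A : CommMon (Ind T), ∃ ι : ∀ k n, Ind.yoneda.obj (symPow n (Y.obj k)) ⟶ A.X,
      (∀ {k l : K} (f : k ⟶ l) (n : ℕ),
        Ind.yoneda.map (symMap n (Y.map f)) ≫ ι l n = ι k n) ∧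
      (∀ k n, Ind.yoneda.map (symStep (a k) n) ≫ ι k (n + 1) = ι k n) ∧
      (∀ k, unitLeg T ≫ MonObj.one (X := A.X) = Ind.yoneda.map (symNil (Y.obj k)) ≫ ι k 0) ∧
      (∀ k, Ind.yoneda.map (symNil (Y.obj k)) ≫ ι k 0 = 0 →
        ∃ (l : K) (n : ℕ), symPowElement (a l) n = 0) := by
  obtain ⟨A, ι, h₁, h₂, h₃⟩ := exists_commMon_indColim (symDiagram Y a ha)
    (fun i j => (i.1 ⊔ j.1, i.2 + j.2)) (fun i j => symColimMul Y i.1 j.1 i.2 j.2) (⊥, 0)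
    (symNil (Y.obj ⊥)) (fun f j => mulCompatible Y a ha f j.1 j.2)
    (fun i j => mul_comm_symLeg Y a ha i.1 j.1 i.2 j.2)
    (fun i => one_mul_symLeg Y a ha i.1 i.2)
    (fun i j l => mul_assoc_symLeg Y a ha i.1 j.1 l.1 i.2 j.2 l.2)
  let ι' : ∀ k n, Ind.yoneda.obj (symPow n (Y.obj k)) ⟶ A.X := fun k n => ι (k, n)
  have h₄ : ∀ {i j : K × ℕ} (f : i ⟶ j),
      Ind.yoneda.map (symTrans Y a ha f) ≫ ι' j.1 j.2 = ι' i.1 i.2 := h₁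
  have h₅ : ∀ {k l : K} (f : k ⟶ l) (n : ℕ),
      Ind.yoneda.map (symMap n (Y.map f)) ≫ ι' l n = ι' k n := by
    intro k l f n
    rw [← symTrans_left Y a ha]
    exact h₄ ((f, 𝟙 n) : (k, n) ⟶ (l, n))
  refine ⟨A, ι', h₅, ?_, ?_, ?_⟩
  · intro k n
    rw [← symTrans_right Y a ha]
    exact h₄ ((𝟙 k, homOfLE (Nat.le_add_right n 1)) : (k, n) ⟶ (k, n + 1))
  · intro k
    have h : Ind.yoneda.map (symNil (Y.obj ⊥)) ≫ ι' ⊥ 0 =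
        Ind.yoneda.map (symNil (Y.obj k)) ≫ ι' k 0 := by
      rw [← h₅ (homOfLE bot_le : ⊥ ⟶ k) 0, ← Functor.map_comp_assoc, symNil_symMap]
    exact h₃.trans h
  · intro k hk
    -- If the unit is zero in the colimit, it is zero at a stage `(l, n)`, where it is the `n`-th
    -- power of `a l`.
    obtain ⟨⟨l, n⟩, f, g, h⟩ := h₂ (i := (k, 0)) (j := (k, 0)) (symNil (Y.obj k)) 0
      (by rw [Functor.map_zero, zero_comp]; exact hk)
    refine ⟨l, n, ?_⟩
    have h' : symNil (Y.obj k) ≫ symTrans Y a ha f = 0 := h.trans zero_comp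
    rw [← symPowElement_zero (a k)] at h'
    exact (symPowElement_symTrans Y a ha f).symm.trans h'

end

/-! ### Finite amalgamated sums of objects under the unit -/

section
variable {T : Type u} [Category.{v} T] [Abelian T] [MonoidalCategory T]
  [SymmetricCategory T] [MonoidalPreadditive T] [RightExactTensor T] [RigidConnected T]

/-- The tensor product of two objects under `𝟙` receives morphisms from both. Its structure morphism
is that of `Z` followed by the monomorphism `Z ◁ (F s).hom`, so it is not zero. -/
lemma exists_mono_under {S : Type*} (F : S → Under (𝟙_ T)) (hF : ∀ s, (F s).hom ≠ 0)
    (I : Finset S) : ∃ Z : Under (𝟙_ T), Z.hom ≠ 0 ∧ ∀ s ∈ I, Nonempty (F s ⟶ Z) := by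
  classical
  induction I using Finset.induction_on with
  | empty =>
    exact ⟨Under.mk (𝟙 _), RigidConnected.id_unit_ne_zero, by simp⟩
  | insert s I _ ih =>
    obtain ⟨Z, hZ, h⟩ := ih
    have := RigidConnected.mono_of_ne_zero _ (hF s)
    have := RigidConnected.mono_whiskerLeft Z.right (F s).hom
    have e : (λ_ (𝟙_ T)).inv ≫ (Z.hom ⊗ₘ (F s).hom) =
        Z.hom ≫ (ρ_ Z.right).inv ≫ Z.right ◁ (F s).hom := by
      rw [MonoidalCategory.tensorHom_def, unitors_inv_equal, rightUnitor_inv_naturality_assoc]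
    have e' : (λ_ (𝟙_ T)).inv ≫ (Z.hom ⊗ₘ (F s).hom) =
        (F s).hom ≫ (λ_ (F s).right).inv ≫ Z.hom ▷ (F s).right := by
      rw [MonoidalCategory.tensorHom_def', leftUnitor_inv_naturality_assoc]
    refine ⟨Under.mk ((λ_ (𝟙_ T)).inv ≫ (Z.hom ⊗ₘ (F s).hom)), ?_, ?_⟩
    · intro h0
      apply hZ
      rw [← cancel_mono ((ρ_ Z.right).inv ≫ Z.right ◁ (F s).hom), ← e, zero_comp]
      exact h0
    · intro t ht
      obtain rfl | ht := Finset.mem_insert.1 ht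
      · exact ⟨Under.homMk ((λ_ (F t).right).inv ≫ Z.hom ▷ (F t).right) e'.symm⟩
      · obtain ⟨g⟩ := h t ht
        exact ⟨g ≫ Under.homMk ((ρ_ Z.right).inv ≫ Z.right ◁ (F s).hom) e.symm⟩

/-- Coproducts under `𝟙` are functorial in the finite set. Their structure morphisms are not zero
because each coproduct maps to an object as in `exists_mono_under`. -/
lemma exists_diagram_under {S : Type v} (F : S → Under (𝟙_ T)) (hF : ∀ s, (F s).hom ≠ 0) :
    ∃ G : Finset (Discrete S) ⥤ Under (𝟙_ T), (∀ I, (G.obj I).hom ≠ 0) ∧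
      ∀ s, ∃ I, Nonempty (F s ⟶ G.obj I) := by
  refine ⟨CoproductsFromFiniteFiltered.liftToFinsetObj (Discrete.functor F), fun I hI => ?_,
    fun s => ?_⟩
  swap
  · let I : Finset (Discrete S) := {⟨s⟩}
    let i : F s ⟶ ∐ fun x : I => (Discrete.functor F).obj x :=
      Sigma.ι (fun x : I => (Discrete.functor F).obj x) ⟨⟨s⟩, Finset.mem_singleton_self _⟩
    exact ⟨I, ⟨i⟩⟩
  obtain ⟨Z, hZ, h⟩ := exists_mono_under (fun x : Discrete S => F x.as) (fun x => hF x.as) I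
  let g (x : I) : F x.1.as ⟶ Z := (h x.1 x.2).some
  refine hZ ?_
  let d : (∐ fun x : I => (Discrete.functor F).obj x) ⟶ Z := Sigma.desc (fun x => g x)
  rw [← Under.w d]
  exact (congrArg (· ≫ _) hI).trans zero_comp

end

/-! ### An algebra in which all non-zero elements become invertible -/

section
variable {T : Type u} [Category.{v} T] [EssentiallySmall.{v} T] [Abelian T] [MonoidalCategory T]
  [SymmetricCategory T] [MonoidalPreadditive T] [RightExactTensor T] [RigidConnected T]

/-- An algebra over which the unit factors through each member of a small family of nonzero
morphisms from the unit object. -/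
lemma exists_commMon_factors {S : Type v} (F : S → Under (𝟙_ T)) (hF : ∀ s, (F s).hom ≠ 0)
    (h : ∀ (X : T) (n : ℕ) (α : 𝟙_ T ⟶ X), α ≠ 0 → symPowElement α n ≠ 0) :
    ∃ A : CommMon (Ind T), ¬ IsZero A.X ∧ ∀ s, ∃ r : Ind.yoneda.obj (F s).right ⟶ A.X,
      Ind.yoneda.map (F s).hom ≫ r = unitLeg T ≫ MonObj.one (X := A.X) := by
  classical
  obtain ⟨G, hG, hFG⟩ := exists_diagram_under F hF
  obtain ⟨A, ι, -, h₂, h₃, h₄⟩ := exists_symColim (G ⋙ Under.forget _) (fun I => (G.obj I).hom)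
    (fun f => Under.w (G.map f))
  refine ⟨A, fun hA => ?_, fun s => ?_⟩
  · obtain ⟨I, n, hI⟩ := h₄ ⊥ (by rw [← h₃, hA.eq_of_tgt MonObj.one 0, comp_zero])
    exact h _ n _ (hG I) hI
  · obtain ⟨I, ⟨g⟩⟩ := hFG s
    let X : T := (G.obj I).right
    let a : 𝟙_ T ⟶ X := (G.obj I).hom
    have ha : (F s).hom ≫ g.right = a := Under.w g
    -- `q` views `X` as the part of degree one. There `α` is the multiplication by `α` applied to
    -- the unit, hence is identified with `1` in the colimit.
    let q : X ⟶ symPow 1 X := (λ_ X).inv ≫ symNil X ▷ X ≫ symSnoc 0 X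
    have hq : a ≫ q = symNil X ≫ symStep a 0 := by
      dsimp only [q, symStep]
      rw [leftUnitor_inv_naturality_assoc, whisker_exchange_assoc,
        rightUnitor_inv_naturality_assoc, unitors_inv_equal]
    let ι₁ : Ind.yoneda.obj (symPow 1 X) ⟶ A.X := ι I 1
    let ι₀ : Ind.yoneda.obj (symPow 0 X) ⟶ A.X := ι I 0
    have h₂' : Ind.yoneda.map (symStep a 0) ≫ ι₁ = ι₀ := h₂ I 0
    have h₃' : unitLeg T ≫ MonObj.one (X := A.X) = Ind.yoneda.map (symNil X) ≫ ι₀ := h₃ I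
    refine ⟨Ind.yoneda.map (g.right ≫ q) ≫ ι₁, ?_⟩
    rw [← Functor.map_comp_assoc, ← Category.assoc, ha, hq, Functor.map_comp_assoc, h₂', h₃']

/-- The algebra over which the unit factors through each nonzero morphism from the unit object. -/
lemma exists_commMon_factors_all
    (h : ∀ (X : T) (n : ℕ) (α : 𝟙_ T ⟶ X), α ≠ 0 → symPowElement α n ≠ 0) :
    ∃ A : CommMon (Ind T), ¬ IsZero A.X ∧ ∀ (X : T) (α : 𝟙_ T ⟶ X), α ≠ 0 →
      ∃ r : Ind.yoneda.obj X ⟶ A.X,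
        Ind.yoneda.map α ≫ r = unitLeg T ≫ MonObj.one (X := A.X) := by
  let E := equivSmallModel.{v} T
  obtain ⟨A, hA, hr⟩ := exists_commMon_factors
    -- A small family suffices, since every object is isomorphic to one of the small model.
    (S := Σ X : SmallModel.{v} T, {α : 𝟙_ T ⟶ E.inverse.obj X // α ≠ 0})
    (fun s => Under.mk s.2.1) (fun s => s.2.2) h
  refine ⟨A, hA, fun X α hα => ?_⟩
  let i : X ≅ E.inverse.obj (E.functor.obj X) := E.unitIso.app X
  obtain ⟨r, hr⟩ := hr ⟨E.functor.obj X, α ≫ i.hom, fun h0 => hα (by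
    rw [← cancel_mono i.hom, h0, zero_comp])⟩
  let r' : Ind.yoneda.obj (E.inverse.obj (E.functor.obj X)) ⟶ A.X := r
  have hr' : Ind.yoneda.map (α ≫ i.hom) ≫ r' = unitLeg T ≫ MonObj.one (X := A.X) := hr
  exact ⟨Ind.yoneda.map i.hom ≫ r', by rw [← Functor.map_comp_assoc, hr']⟩

/-- The inverse of a monomorphism up to tensoring with an object under `𝟙`. -/
lemma exists_retraction_data {U V : T} (f : U ⟶ V) [Mono f] :
    ∃ (E : T) (α : 𝟙_ T ⟶ E), α ≠ 0 ∧ ∃ (U' : T) (c : 𝟙_ T ⟶ U' ⊗ U) (e : V ⊗ U' ⟶ E),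
      f ≫ (ρ_ V).inv ≫ V ◁ c ≫ (α_ _ _ _).inv ≫ e ▷ U = (λ_ U).inv ≫ α ▷ U := by
  obtain ⟨U', ⟨P⟩⟩ := RigidConnected.exists_dual U
  let P' : ExactPairing U' U := BraidedCategory.exactPairing_swap U U'
  have := RigidConnected.mono_whiskerRight U' f
  -- `α` is the pushout of the monomorphism `f ▷ U'` along the evaluation `U ⊗ U' ⟶ 𝟙`, hence a
  -- monomorphism. The required identity is a snake relation for `U`.
  refine ⟨pushout (f ▷ U') (ε_ U' U), pushout.inr _ _, fun h0 => ?_, U', η_ U' U,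
    pushout.inl _ _, ?_⟩
  · apply RigidConnected.id_unit_ne_zero (T := T)
    rw [← cancel_mono (pushout.inr (f ▷ U') (ε_ U' U)), h0, comp_zero, comp_zero]
  · have h := ExactPairing.coevaluation_evaluation U' U
    rw [rightUnitor_inv_naturality_assoc, ← whisker_exchange_assoc,
      associator_inv_naturality_left_assoc, ← comp_whiskerRight, pushout.condition,
      comp_whiskerRight, reassoc_of% h]
    simp

end

/-! ### Retractions of free modules -/

section
variable {D : Type u} [Category.{v} D] [MonoidalCategory D]

/-- The `A`-linear extension of a morphism to a free module. -/
def freeModDesc (A : D) [MonObj A] {V U : D} (ψ : V ⟶ A ⊗ U) : freeMod A V ⟶ freeMod A U :=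
  Mod.Hom.mk' (M := freeMod A V) (N := freeMod A U)
    (A ◁ ψ ≫ (α_ _ _ _).inv ≫ MonObj.mul ▷ U) (by
      change ((α_ A A V).inv ≫ MonObj.mul ▷ V) ≫ A ◁ ψ ≫ (α_ _ _ _).inv ≫ MonObj.mul ▷ U =
        A ◁ (A ◁ ψ ≫ (α_ _ _ _).inv ≫ MonObj.mul ▷ U) ≫ (α_ A A U).inv ≫ MonObj.mul ▷ U
      have h : MonObj.mul ▷ (A ⊗ U) ≫ (α_ A A U).inv ≫ MonObj.mul ▷ U =
          (α_ A A (A ⊗ U)).hom ≫ A ◁ ((α_ A A U).inv ≫ MonObj.mul ▷ U) ≫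
            (α_ A A U).inv ≫ MonObj.mul ▷ U := (freeMod A U).mod.mul_smul
      rw [Category.assoc, ← whisker_exchange_assoc, h, MonoidalCategory.whiskerLeft_comp,
        Category.assoc, associator_naturality_right_assoc, Iso.inv_hom_id_assoc]
      simp only [MonoidalCategory.whiskerLeft_comp, Category.assoc])

lemma isSplitMono_freeModFunctor_map (A : D) [MonObj A] {U V : D} (f : U ⟶ V) (ψ : V ⟶ A ⊗ U)
    (h : f ≫ ψ = (λ_ U).inv ≫ MonObj.one ▷ U) : IsSplitMono ((freeModFunctor A).map f) := by
  refine ⟨⟨⟨freeModDesc A ψ, Mod.hom_ext _ _ ?_⟩⟩⟩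
  change A ◁ f ≫ A ◁ ψ ≫ (α_ _ _ _).inv ≫ MonObj.mul ▷ U = 𝟙 (A ⊗ U)
  rw [← MonoidalCategory.whiskerLeft_comp_assoc, h, MonoidalCategory.whiskerLeft_comp,
    Category.assoc, associator_inv_naturality_middle_assoc, ← comp_whiskerRight, MonObj.mul_one]
  simp

end

/-! ### Splitting of all short exact sequences -/

section
variable {T : Type u} [Category.{v} T] [EssentiallySmall.{v} T] [Abelian T] [MonoidalCategory T]
  [SymmetricCategory T] [MonoidalPreadditive T] [RightExactTensor T] [RigidConnected T]

/-- The data of `exists_retraction_data` give a morphism `V ⟶ E ⊗ U` which restricts to `α ⊗ U` on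
`U`. Since `α` becomes the unit of `A` after `E ⟶ A`, the composite `V ⟶ A ⊗ U` restricts to the
unit on `U`, and its `A`-linear extension is a retraction. -/
lemma splitsOver_of_factors (A : CommMon (Ind T))
    (h : ∀ (X : T) (α : 𝟙_ T ⟶ X), α ≠ 0 → ∃ r : Ind.yoneda.obj X ⟶ A.X,
      Ind.yoneda.map α ≫ r = unitLeg T ≫ MonObj.one (X := A.X)) {S : ShortComplex T}
    (hS : S.ShortExact) : SplitsOver A S := by
  have := hS.mono_f
  obtain ⟨E, α, hα, U', c, e, hf⟩ := exists_retraction_data S.f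
  obtain ⟨r, hr⟩ := h E α hα
  refine isSplitMono_freeModFunctor_map A.X (Ind.yoneda.map S.f)
    (Ind.yoneda.map ((ρ_ _).inv ≫ S.X₂ ◁ c ≫ (α_ _ _ _).inv ≫ e ▷ S.X₁) ≫ boxHom r (𝟙 _)) ?_
  rw [← Functor.map_comp_assoc, hf, Functor.map_comp, Category.assoc, ← boxHom_map_left, hr,
    ← boxHom_comp_whiskerRight, ← Category.assoc]
  refine congrArg (· ≫ _) ?_
  rw [← cancel_mono (λ_ _).hom, Category.assoc, boxHom_leftUnitor, ← Functor.map_comp_assoc]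
  simp

/-- If the powers of nonzero elements do not vanish, there is an algebra over which all short exact
sequences split. -/
lemma exists_splitsOver
    (h : ∀ (X : T) (n : ℕ) (α : 𝟙_ T ⟶ X), α ≠ 0 → symPowElement α n ≠ 0) :
    ∃ A : CommMon (Ind T), ¬ IsZero A.X ∧ ∀ S : ShortComplex T, S.ShortExact → SplitsOver A S := by
  obtain ⟨A, hA, hr⟩ := exists_commMon_factors_all h
  exact ⟨A, hA, fun S hS => splitsOver_of_factors A hr hS⟩

end

end LSS
end

/-- Characterizations of local semisimplicity. The last conjunct says that the bound on the size of
the target category `C` in the definition of local semisimplicity is immaterial: its two sides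
differ in their universe levels. -/
theorem theorem3p3 {k : Type w} [Field k] {T : Type u} [Category.{v} T] [EssentiallySmall.{v} T]
    [Abelian T] [Linear k T] [MonoidalCategory T] [SymmetricCategory T] [MonoidalPreadditive T]
    [MonoidalLinear k T] [LSS.RightExactTensor T] [LSS.TensorCategory k T] :
    List.TFAE [
      LSS.LocallySemisimple.{max u (v + 1), v} k T,
      ∀ (S : ShortComplex T) (hS : S.ShortExact) (n : ℕ), IsIso (LSS.theta hS n),
      ∀ (X : T) (n : ℕ) (α : 𝟙_ T ⟶ X), α ≠ 0 → LSS.symPowElement α n ≠ 0,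
      ∀ S : ShortComplex T, S.ShortExact →
        ∃ A : CommMon (Ind T), ¬ IsZero A.X ∧ LSS.SplitsOver A S,
      ∃ A : CommMon (Ind T), ¬ IsZero A.X ∧
        ∀ S : ShortComplex T, S.ShortExact → LSS.SplitsOver A S] ∧
    (LSS.LocallySemisimple.{w₁, w₂} k T → LSS.LocallySemisimple.{max u (v + 1), v} k T) := by
  have := LSS.TensorCategory.rigidConnected k T
  -- (ii) leads back to (0) at fixed universe levels, while (0) implies (i), and hence (ii), at any
  -- levels. This also yields the last conjunct.
  have h₄ : (∀ (X : T) (n : ℕ) (α : 𝟙_ T ⟶ X), α ≠ 0 → LSS.symPowElement α n ≠ 0) →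
      LSS.LocallySemisimple.{max u (v + 1), v} k T := fun h => by
    obtain ⟨A, hA, hS⟩ := LSS.exists_splitsOver h
    exact LSS.locallySemisimple_of_splitsOver A hA hS
  refine ⟨?_, fun h => h₄ fun X n α => LSS.symPowElement_ne_zero_of_isIso_theta
    (fun S hS n => LSS.isIso_theta_of_locallySemisimple h hS n) n α⟩
  tfae_have 1 → 2 := fun h S hS n => LSS.isIso_theta_of_locallySemisimple h hS n
  tfae_have 2 → 3 := fun h X n α => LSS.symPowElement_ne_zero_of_isIso_theta h n α
  tfae_have 3 → 5 := LSS.exists_splitsOver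
  tfae_have 5 → 4 := fun ⟨A, hA, h⟩ S hS => ⟨A, hA, h S hS⟩
  tfae_have 4 → 3 := fun h X n α => LSS.symPowElement_ne_zero_of_splitsOver h n α
  tfae_have 5 → 1 := fun ⟨A, hA, h⟩ => LSS.locallySemisimple_of_splitsOver A hA h
  tfae_finish
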